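/- Let $k$ be a field, let $q\in k$, and let $\Lambda_q=k\langle x,y\rangle/(x^2,\,xy+qyx,\,y^2)$. For $n\ge 0$ let $\operatorname{HH}^n(\Lambda_q)$ be the Hochschild cohomology of the $k$-algebra $\Lambda_q$ with coefficients in $\Lambda_q$, and let $\operatorname{HH}^*(\Lambda_q)=\bigoplus_{n\ge 0}\operatorname{HH}^n(\Lambda_q)$ be the graded $k$-algebra whose product is the cup (equivalently, Yoneda) product. (a) If $q\neq 0$ and $q$ is not a root of unity, then $\operatorname{HH}^*(\Lambda_q)$ is a $5$-dimensional $k$-algebra with $\sum_{i\ge 0}\dim_k\operatorname{HH}^i(\Lambda_q)\,t^i=2+2t+t^2$. Moreover, $\operatorname{HH}^*(\Lambda_q)$ is isomorphic as a $k$-algebra to the fibre product $k[z]/(z^2)\times_k\wedge^*(u_1,u_2)$ over the augmentations $z\mapsto 0$ and $u_1,u_2\mapsto 0$, where $\wedge^*(u_1,u_2)$ is the exterior algebra on $u_1,u_2$, in such a way that $z$ corresponds to an element of degree $0$ and $u_1,u_2$ correspond to elements of degree $1$. In particular, $\Lambda_q$ is a finite dimensional algebra with $\operatorname{HH}^n(\Lambda_q)=0$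 for all $n\ge 3$, although its (left and right) global dimension is infinite; this answers negatively Happel's question whether a finite dimensional algebra whose Hochschild cohomology vanishes in all sufficiently high degrees has finite global dimension. (b) If $q$ is a root of unity, then $\operatorname{HH}^*(\Lambda_q)$ is infinite dimensional over $k$, and it has a $k$-subalgebra $H$, isomorphic to the polynomial ring over $k$ in two variables, such that $\operatorname{HH}^*(\Lambda_q)$ is finitely generated as a left and as a right $H$-module. (c) If $q=0$, then $\operatorname{HH}^*(\Lambda_0)$ is not finitely generated as a $k$-algebra, every $\operatorname{HH}^i(\Lambda_0)$ is finite dimensional, and $\sum_{i\ge 0}\dim_k\operatorname{HH}^i(\Lambda_0)\,t^i=1+\frac{1+t^3}{(1-t)^2}$. -/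

import Mathlib

open scoped DirectSum DualNumber

set_option linter.unusedSectionVars false

/-! ## Hochschild cohomology of an associative algebra -/

namespace Hochschild

noncomputable section

section Cochains

variable {k A : Type*} [CommRing k] [Ring A] [Algebra k A]

/-- The sequence `a` with its first `m` entries deleted. -/
def shift (m : ℕ) (a : ℕ → A) : ℕ → A := fun j => a (m + j)

/-- The sequence `a₀, …, aᵢ₋₁, aᵢ aᵢ₊₁, aᵢ₊₂, …`. -/
def contract (i : ℕ) (a : ℕ → A) : ℕ → A := fun j =>
  if j < i then a j else if j = i then a j * a (j + 1) else a (j + 1)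

/-- A finite sequence, continued by zero. Cochains of degree `n` only read the first `n` entries
of a sequence; infinite sequences are used to avoid casts between the types `Fin n`. -/
def extend {n : ℕ} (v : Fin n → A) : ℕ → A := fun j => if h : j < n then v ⟨j, h⟩ else 0

variable (k A) in
/-- Hochschild cochains of degree `n` with coefficients in `A`: the `k`-multilinear maps
`Aⁿ → A`, that is `Hom_k(A^{⊗ n}, A) = Hom_{Aᵉ}(A^{⊗ (n + 2)}, A)`. -/
def Cochain (n : ℕ) : Type _ := MultilinearMap k (fun _ : Fin n => A) A

instance (n : ℕ) : AddCommGroup (Cochain k A n) :=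
  inferInstanceAs (AddCommGroup (MultilinearMap k (fun _ : Fin n => A) A))

instance (n : ℕ) : Module k (Cochain k A n) :=
  inferInstanceAs (Module k (MultilinearMap k (fun _ : Fin n => A) A))

instance (n : ℕ) : FunLike (Cochain k A n) (Fin n → A) A :=
  inferInstanceAs (FunLike (MultilinearMap k (fun _ : Fin n => A) A) (Fin n → A) A)

/-- The value of a cochain on the first `n` entries of a sequence. -/
def ev {n : ℕ} (f : Cochain k A n) (a : ℕ → A) : A := f fun i => a i

lemma extend_coe {n : ℕ} (v : Fin n → A) (i : Fin n) : extend v i = v i := by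
  simp [extend]

lemma ev_extend {n : ℕ} (f : Cochain k A n) (v : Fin n → A) : ev f (extend v) = f v := by
  simp [ev, extend_coe]

lemma ev_congr {n : ℕ} (f : Cochain k A n) {a b : ℕ → A} (h : ∀ i < n, a i = b i) :
    ev f a = ev f b := by
  unfold ev
  congr 1
  funext i
  exact h i i.2

lemma cochain_ext {n : ℕ} {f g : Cochain k A n} (h : ∀ a, ev f a = ev g a) : f = g := by
  refine DFunLike.ext _ _ fun v => ?_
  simpa [ev_extend] using h (extend v)

/-- A function of sequences that only reads the first `n` entries and is `k`-linear in each of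
them, as a cochain. -/
def ofSeq (n : ℕ) (F : (ℕ → A) → A)
    (hF : ∀ a b : ℕ → A, (∀ i < n, a i = b i) → F a = F b)
    (hadd : ∀ (a : ℕ → A) (i : ℕ) (x y : A), i < n → F (Function.update a i (x + y)) =
      F (Function.update a i x) + F (Function.update a i y))
    (hsmul : ∀ (a : ℕ → A) (i : ℕ) (c : k) (x : A), i < n → F (Function.update a i (c • x)) =
      c • F (Function.update a i x)) : Cochain k A n where
  toFun v := F (extend v)
  map_update_add' := by
    intro inst v i x y
    obtain rfl : inst = instDecidableEqFin n := Subsingleton.elim _ _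
    have key : ∀ z : A, F (extend (Function.update v i z)) =
        F (Function.update (extend v) i z) := by
      intro z
      apply hF
      intro j hj
      by_cases h : j = i
      · subst h; simp [extend]
      · have : (⟨j, hj⟩ : Fin n) ≠ i := fun e => h (by rw [← e])
        simp [extend, hj, h, this]
    rw [key, key, key, hadd _ _ _ _ i.2]
  map_update_smul' := by
    intro inst v i c x
    obtain rfl : inst = instDecidableEqFin n := Subsingleton.elim _ _
    have key : ∀ z : A, F (extend (Function.update v i z)) =
        F (Function.update (extend v) i z) := by
      intro z
      apply hF
      intro j hj
      by_cases h : j = i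
      · subst h; simp [extend]
      · have : (⟨j, hj⟩ : Fin n) ≠ i := fun e => h (by rw [← e])
        simp [extend, hj, h, this]
    rw [key, key, hsmul _ _ _ _ i.2]

lemma ev_ofSeq {n : ℕ} {F : (ℕ → A) → A} {hF hadd hsmul} (a : ℕ → A) :
    ev (ofSeq (k := k) n F hF hadd hsmul) a = F a := by
  change F (extend fun i : Fin n => a i) = F a
  apply hF
  intro i hi
  simp [extend, hi]

lemma ev_update_add {n : ℕ} (f : Cochain k A n) (a : ℕ → A) {i : ℕ} (hi : i < n) (x y : A) :
    ev f (Function.update a i (x + y)) =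
      ev f (Function.update a i x) + ev f (Function.update a i y) := by
  have key : ∀ z : A, (fun j : Fin n => Function.update a i z j) =
      Function.update (fun j : Fin n => a j) ⟨i, hi⟩ z := by
    intro z
    funext j
    by_cases h : j = ⟨i, hi⟩
    · subst h; simp
    · have : (j : ℕ) ≠ i := fun e => h (Fin.ext e)
      simp [h, this]
  unfold ev
  rw [key, key, key]
  exact MultilinearMap.map_update_add f _ _ _ _

lemma ev_update_smul {n : ℕ} (f : Cochain k A n) (a : ℕ → A) {i : ℕ} (hi : i < n) (c : k)
    (x : A) : ev f (Function.update a i (c • x)) = c • ev f (Function.update a i x) := by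
  have key : ∀ z : A, (fun j : Fin n => Function.update a i z j) =
      Function.update (fun j : Fin n => a j) ⟨i, hi⟩ z := by
    intro z
    funext j
    by_cases h : j = ⟨i, hi⟩
    · subst h; simp
    · have : (j : ℕ) ≠ i := fun e => h (Fin.ext e)
      simp [h, this]
  unfold ev
  rw [key, key]
  exact MultilinearMap.map_update_smul f _ _ _ _

@[simp] lemma ev_add {n : ℕ} (f g : Cochain k A n) (a : ℕ → A) :
    ev (f + g) a = ev f a + ev g a := rfl

@[simp] lemma ev_smul {n : ℕ} (c : k) (f : Cochain k A n) (a : ℕ → A) :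
    ev (c • f) a = c • ev f a := rfl

@[simp] lemma ev_zero {n : ℕ} (a : ℕ → A) : ev (0 : Cochain k A n) a = 0 := rfl

lemma shift_update_lt {m i : ℕ} (h : i < m) (a : ℕ → A) (x : A) :
    shift m (Function.update a i x) = shift m a := by
  funext j
  have : m + j ≠ i := by omega
  simp [shift, this]

lemma shift_update_add (m i : ℕ) (a : ℕ → A) (x : A) :
    shift m (Function.update a (m + i) x) = Function.update (shift m a) i x := by
  funext j
  by_cases h : j = i
  · subst h; simp [shift]
  · simp [shift, h]

lemma contract_update_lt {i l : ℕ} (h : l < i) (a : ℕ → A) (x : A) :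
    contract i (Function.update a l x) = Function.update (contract i a) l x := by
  funext j
  simp only [contract, Function.update_apply]
  grind

lemma contract_update_left (i : ℕ) (a : ℕ → A) (x : A) :
    contract i (Function.update a i x) = Function.update (contract i a) i (x * a (i + 1)) := by
  funext j
  simp only [contract, Function.update_apply]
  grind

lemma contract_update_right (i : ℕ) (a : ℕ → A) (x : A) :
    contract i (Function.update a (i + 1) x) = Function.update (contract i a) i (a i * x) := by
  funext j
  simp only [contract, Function.update_apply]
  grind

lemma contract_update_gt {i l : ℕ} (h : i < l) (a : ℕ → A) (x : A) :
    contract i (Function.update a (l + 1) x) = Function.update (contract i a) l x := by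
  funext j
  simp only [contract, Function.update_apply]
  grind

/-- The value of the Hochschild differential of `f` on `a₀, …, aₙ`:
`a₀ f(a₁, …, aₙ) + ∑ᵢ (-1)ⁱ⁺¹ f(a₀, …, aᵢ aᵢ₊₁, …, aₙ) + (-1)ⁿ⁺¹ f(a₀, …, aₙ₋₁) aₙ`. -/
def dSeq {n : ℕ} (f : Cochain k A n) (a : ℕ → A) : A :=
  a 0 * ev f (shift 1 a)
    + ∑ i ∈ Finset.range n, (-1 : ℤ) ^ (i + 1) • ev f (contract i a)
    + (-1 : ℤ) ^ (n + 1) • (ev f a * a n)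

lemma ev_contract_update_add {n : ℕ} (f : Cochain k A n) (a : ℕ → A) {i l : ℕ} (hi : i < n)
    (hl : l < n + 1) (x y : A) : ev f (contract i (Function.update a l (x + y))) =
      ev f (contract i (Function.update a l x)) + ev f (contract i (Function.update a l y)) := by
  rcases lt_trichotomy l i with h | rfl | h
  · simp only [contract_update_lt h]
    exact ev_update_add f _ (by omega) x y
  · simp only [contract_update_left, add_mul]
    exact ev_update_add f _ hi _ _
  · obtain ⟨l, rfl⟩ : ∃ l', l = l' + 1 := ⟨l - 1, by omega⟩
    rcases Nat.lt_or_ge i l with h' | h'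
    · simp only [contract_update_gt h']
      exact ev_update_add f _ (by omega) x y
    · obtain rfl : l = i := by omega
      simp only [contract_update_right, mul_add]
      exact ev_update_add f _ hi _ _

lemma ev_contract_update_smul {n : ℕ} (f : Cochain k A n) (a : ℕ → A) {i l : ℕ} (hi : i < n)
    (hl : l < n + 1) (c : k) (x : A) : ev f (contract i (Function.update a l (c • x))) =
      c • ev f (contract i (Function.update a l x)) := by
  rcases lt_trichotomy l i with h | rfl | h
  · simp only [contract_update_lt h]
    exact ev_update_smul f _ (by omega) c x
  · simp only [contract_update_left, smul_mul_assoc]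
    exact ev_update_smul f _ hi _ _
  · obtain ⟨l, rfl⟩ : ∃ l', l = l' + 1 := ⟨l - 1, by omega⟩
    rcases Nat.lt_or_ge i l with h' | h'
    · simp only [contract_update_gt h']
      exact ev_update_smul f _ (by omega) c x
    · obtain rfl : l = i := by omega
      simp only [contract_update_right, mul_smul_comm]
      exact ev_update_smul f _ hi _ _

lemma head_update_add {n : ℕ} (f : Cochain k A n) (a : ℕ → A) {l : ℕ} (hl : l < n + 1)
    (x y : A) : Function.update a l (x + y) 0 * ev f (shift 1 (Function.update a l (x + y))) =
      Function.update a l x 0 * ev f (shift 1 (Function.update a l x)) +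
      Function.update a l y 0 * ev f (shift 1 (Function.update a l y)) := by
  rcases l with _ | l
  · simp [shift_update_lt, add_mul]
  · rw [add_comm l 1]
    simp only [shift_update_add]
    rw [ev_update_add f _ (by omega)]
    have h0 : (0 : ℕ) ≠ 1 + l := by omega
    simp [mul_add, h0]

lemma head_update_smul {n : ℕ} (f : Cochain k A n) (a : ℕ → A) {l : ℕ} (hl : l < n + 1)
    (c : k) (x : A) :
    Function.update a l (c • x) 0 * ev f (shift 1 (Function.update a l (c • x))) =
      c • (Function.update a l x 0 * ev f (shift 1 (Function.update a l x))) := by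
  rcases l with _ | l
  · simp [shift_update_lt]
  · rw [add_comm l 1]
    simp only [shift_update_add]
    rw [ev_update_smul f _ (by omega)]
    have h0 : (0 : ℕ) ≠ 1 + l := by omega
    simp [h0]

lemma ev_update_ge {n : ℕ} (f : Cochain k A n) (a : ℕ → A) {l : ℕ} (hl : n ≤ l) (x : A) :
    ev f (Function.update a l x) = ev f a := by
  apply ev_congr
  intro i hi
  have : i ≠ l := by omega
  simp [this]

lemma tail_update_add {n : ℕ} (f : Cochain k A n) (a : ℕ → A) {l : ℕ} (hl : l < n + 1)
    (x y : A) : ev f (Function.update a l (x + y)) * Function.update a l (x + y) n =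
      ev f (Function.update a l x) * Function.update a l x n +
      ev f (Function.update a l y) * Function.update a l y n := by
  rcases Nat.lt_or_ge l n with h | h
  · rw [ev_update_add f _ h]
    have : n ≠ l := by omega
    simp [add_mul, this]
  · obtain rfl : l = n := by omega
    simp [ev_update_ge, mul_add]

lemma tail_update_smul {n : ℕ} (f : Cochain k A n) (a : ℕ → A) {l : ℕ} (hl : l < n + 1)
    (c : k) (x : A) : ev f (Function.update a l (c • x)) * Function.update a l (c • x) n =
      c • (ev f (Function.update a l x) * Function.update a l x n) := by
  rcases Nat.lt_or_ge l n with h | h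
  · rw [ev_update_smul f _ h]
    have : n ≠ l := by omega
    simp [this]
  · obtain rfl : l = n := by omega
    simp [ev_update_ge]

/-- The Hochschild differential of a cochain. -/
def dFun {n : ℕ} (f : Cochain k A n) : Cochain k A (n + 1) :=
  ofSeq (n + 1) (dSeq f)
    (by
      intro a b h
      unfold dSeq
      rw [h 0 (by omega), h n (by omega),
        ev_congr f (a := a) (b := b) (fun i hi => h i (by omega)),
        ev_congr f (a := shift 1 a) (b := shift 1 b) (fun i hi => h (1 + i) (by omega))]
      congr 2
      apply Finset.sum_congr rfl
      intro i hi
      rw [ev_congr f (a := contract i a) (b := contract i b)]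
      intro j hj
      simp only [contract, h j (by omega), h (j + 1) (by omega)])
    (by
      intro a l x y hl
      unfold dSeq
      rw [head_update_add f a hl, tail_update_add f a hl, Finset.sum_congr rfl fun i hi => by
        rw [ev_contract_update_add f a (Finset.mem_range.mp hi) hl, smul_add],
        Finset.sum_add_distrib, smul_add]
      abel)
    (by
      intro a l c x hl
      unfold dSeq
      rw [head_update_smul f a hl, tail_update_smul f a hl, Finset.sum_congr rfl fun i hi => by
        rw [ev_contract_update_smul f a (Finset.mem_range.mp hi) hl, smul_comm],
        ← Finset.smul_sum, smul_add, smul_add, smul_comm c ((-1 : ℤ) ^ (n + 1))])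

lemma ev_dFun {n : ℕ} (f : Cochain k A n) (a : ℕ → A) : ev (dFun f) a = dSeq f a :=
  ev_ofSeq a

variable (k A) in
/-- The Hochschild differential. -/
def d (n : ℕ) : Cochain k A n →ₗ[k] Cochain k A (n + 1) where
  toFun := dFun
  map_add' f g := cochain_ext fun a => by
    simp only [ev_dFun, ev_add, dSeq, mul_add, add_mul, smul_add, Finset.sum_add_distrib]
    abel
  map_smul' c f := cochain_ext fun a => by
    simp only [ev_dFun, ev_smul, dSeq, mul_smul_comm, smul_mul_assoc, smul_add,
      Finset.smul_sum, RingHom.id_apply, smul_comm c]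

lemma ev_d {n : ℕ} (f : Cochain k A n) (a : ℕ → A) : ev (d k A n f) a =
    a 0 * ev f (shift 1 a)
      + ∑ i ∈ Finset.range n, (-1 : ℤ) ^ (i + 1) • ev f (contract i a)
      + (-1 : ℤ) ^ (n + 1) • (ev f a * a n) :=
  ev_dFun f a

/-- The cup product of cochains,
`(f ∪ g)(a₀, …, aₘ₊ₙ₋₁) = f(a₀, …, aₘ₋₁) g(aₘ, …, aₘ₊ₙ₋₁)`. -/
def cup {m n : ℕ} (f : Cochain k A m) (g : Cochain k A n) : Cochain k A (m + n) :=
  ofSeq (m + n) (fun a => ev f a * ev g (shift m a))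
    (by
      intro a b h
      rw [ev_congr f (a := a) (b := b) fun i hi => h i (by omega),
        ev_congr g (a := shift m a) (b := shift m b) fun i hi => h (m + i) (by omega)])
    (by
      intro a l x y hl
      rcases Nat.lt_or_ge l m with h | h
      · simp only [shift_update_lt h]
        rw [ev_update_add f _ h, add_mul]
      · obtain ⟨l, rfl⟩ := Nat.exists_eq_add_of_le h
        simp only [shift_update_add, ev_update_ge f _ h]
        rw [ev_update_add g _ (by omega), mul_add])
    (by
      intro a l c x hl
      rcases Nat.lt_or_ge l m with h | h
      · simp only [shift_update_lt h]
        rw [ev_update_smul f _ h, smul_mul_assoc]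
      · obtain ⟨l, rfl⟩ := Nat.exists_eq_add_of_le h
        simp only [shift_update_add, ev_update_ge f _ h]
        rw [ev_update_smul g _ (by omega), mul_smul_comm])

lemma ev_cup {m n : ℕ} (f : Cochain k A m) (g : Cochain k A n) (a : ℕ → A) :
    ev (cup f g) a = ev f a * ev g (shift m a) :=
  ev_ofSeq a

@[simp] lemma shift_zero (a : ℕ → A) : shift 0 a = a := by
  funext j
  simp [shift]

lemma shift_shift (m n : ℕ) (a : ℕ → A) : shift n (shift m a) = shift (m + n) a := by
  funext j
  simp [shift, add_assoc]

lemma shift_contract_lt {i m : ℕ} (h : i < m) (a : ℕ → A) :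
    shift m (contract i a) = shift (m + 1) a := by
  funext j
  have h1 : ¬ m + j < i := by omega
  have h2 : m + j ≠ i := by omega
  simp only [shift, contract, h1, h2, if_false]
  congr 1
  omega

lemma shift_contract_add (m i : ℕ) (a : ℕ → A) :
    shift m (contract (m + i) a) = contract i (shift m a) := by
  funext j
  simp [shift, contract, add_assoc]

lemma ev_contract_ge {n i : ℕ} (h : n ≤ i) (f : Cochain k A n) (a : ℕ → A) :
    ev f (contract i a) = ev f a := by
  apply ev_congr
  intro j hj
  have : j < i := by omega
  simp [contract, this]

/-- The Leibniz rule `d(f ∪ g) = df ∪ g + (-1)ᵐ f ∪ dg`. -/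
lemma ev_d_cup {m n : ℕ} (f : Cochain k A m) (g : Cochain k A n) (a : ℕ → A) :
    ev (d k A (m + n) (cup f g)) a =
      ev (cup (d k A m f) g) a + (-1 : ℤ) ^ m • ev (cup f (d k A n g)) a := by
  simp only [ev_d, ev_cup, Finset.sum_range_add, shift_shift]
  have e1 : ∑ i ∈ Finset.range m, (-1 : ℤ) ^ (i + 1) •
        (ev f (contract i a) * ev g (shift m (contract i a))) =
      (∑ i ∈ Finset.range m, (-1 : ℤ) ^ (i + 1) • ev f (contract i a)) *
        ev g (shift (m + 1) a) := by
    rw [Finset.sum_mul]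
    refine Finset.sum_congr rfl fun i hi => ?_
    rw [shift_contract_lt (Finset.mem_range.mp hi), smul_mul_assoc]
  have e2 : ∑ i ∈ Finset.range n, (-1 : ℤ) ^ (m + i + 1) •
        (ev f (contract (m + i) a) * ev g (shift m (contract (m + i) a))) =
      (-1 : ℤ) ^ m • (ev f a *
        ∑ i ∈ Finset.range n, (-1 : ℤ) ^ (i + 1) • ev g (contract i (shift m a))) := by
    rw [Finset.mul_sum, Finset.smul_sum]
    refine Finset.sum_congr rfl fun i hi => ?_
    rw [shift_contract_add, ev_contract_ge (by omega), mul_smul_comm, smul_smul, add_assoc,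
      pow_add]
  rw [e1, e2]
  have e3 : shift m a 0 = a m := rfl
  have e4 : shift m a n = a (m + n) := rfl
  have e5 : (1 + m) = m + 1 := add_comm _ _
  rw [e3, e4, e5]
  rw [pow_succ (-1 : ℤ) m, pow_succ (-1 : ℤ) n, pow_succ (-1 : ℤ) (m + n), pow_add (-1 : ℤ) m n]
  rcases neg_one_pow_eq_or ℤ m with hm | hm <;> rcases neg_one_pow_eq_or ℤ n with hn | hn <;>
    · simp only [hm, hn, add_mul, mul_add, smul_add, neg_mul, mul_neg, mul_one, neg_smul,
        one_smul, neg_neg, mul_assoc]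
      abel

lemma contract_contract {i j : ℕ} (h : i ≤ j) (a : ℕ → A) :
    contract j (contract i a) = contract i (contract (j + 1) a) := by
  funext l
  simp only [contract]
  grind [mul_assoc]

lemma sum_contract_contract {n : ℕ} (f : Cochain k A n) (a : ℕ → A) :
    ∑ i ∈ Finset.range (n + 1), (-1 : ℤ) ^ (i + 1) •
      ∑ j ∈ Finset.range n, (-1 : ℤ) ^ (j + 1) • ev f (contract j (contract i a)) = 0 := by
  simp only [Finset.smul_sum]
  rw [← Finset.sum_product']
  refine Finset.sum_involution
    (fun p _ => if p.1 ≤ p.2 then (p.2 + 1, p.1) else (p.2, p.1 - 1)) ?_ ?_ ?_ ?_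
  · rintro ⟨i, j⟩ hp
    by_cases h : i ≤ j
    · simp only [h, if_true]
      rw [contract_contract h]
      simp only [pow_succ, smul_smul, ← add_smul]
      rw [show (-1 : ℤ) ^ i * -1 * ((-1) ^ j * -1) +
        (-1) ^ j * -1 * -1 * ((-1) ^ i * -1) = 0 by ring, zero_smul]
    · obtain ⟨i, rfl⟩ : ∃ i', i = i' + 1 := ⟨i - 1, by omega⟩
      have h' : j ≤ i := by omega
      simp only [h, if_false, Nat.add_sub_cancel]
      rw [contract_contract h']
      simp only [pow_succ, smul_smul, ← add_smul]
      rw [show (-1 : ℤ) ^ i * -1 * -1 * ((-1) ^ j * -1) +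
        (-1) ^ j * -1 * ((-1) ^ i * -1) = 0 by ring, zero_smul]
  · rintro ⟨i, j⟩ hp _
    by_cases h : i ≤ j
    · simp only [h, if_true, ne_eq, Prod.mk.injEq]
      omega
    · simp only [h, if_false, ne_eq, Prod.mk.injEq]
      omega
  · rintro ⟨i, j⟩ hp
    simp only [Finset.mem_product, Finset.mem_range] at hp ⊢
    by_cases h : i ≤ j
    · simp only [h, if_true]
      omega
    · simp only [h, if_false]
      omega
  · rintro ⟨i, j⟩ hp
    by_cases h : i ≤ j
    · have h2 : ¬ j + 1 ≤ i := by omega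
      simp [h, h2]
    · have h2 : j ≤ i - 1 := by omega
      have h3 : i - 1 + 1 = i := by omega
      simp [h, h2, h3]

lemma d_d {n : ℕ} (f : Cochain k A n) : d k A (n + 1) (d k A n f) = 0 := by
  refine cochain_ext fun a => ?_
  have hc0 : ∀ i, contract (i + 1) a 0 = a 0 := fun i => by simp [contract]
  have hc00 : contract 0 a 0 = a 0 * a 1 := by simp [contract]
  have hcn : ∀ i ∈ Finset.range n, contract i a n = a (n + 1) := fun i hi => by
    have h1 : ¬ n < i := by have := Finset.mem_range.mp hi; omega
    have h2 : n ≠ i := by have := Finset.mem_range.mp hi; omega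
    simp [contract, h1, h2]
  have hcnn : contract n a n = a n * a (n + 1) := by simp [contract]
  have hs0 : shift 1 (contract 0 a) = shift 2 a := shift_contract_lt (by omega) a
  have hs : ∀ i, shift 1 (contract (i + 1) a) = contract i (shift 1 a) := fun i => by
    rw [add_comm i 1, shift_contract_add]
  have hsn : shift 1 a n = a (n + 1) := by simp [shift, add_comm]
  have hs1 : shift 1 a 0 = a 1 := rfl
  have e0 : ∑ i ∈ Finset.range n, (-1 : ℤ) ^ (i + 1) • (-1 : ℤ) ^ (n + 1) •
      (ev f (contract i a) * contract i a n) =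
      ∑ i ∈ Finset.range n, (-1 : ℤ) ^ (i + 1) • (-1 : ℤ) ^ (n + 1) •
      (ev f (contract i a) * a (n + 1)) :=
    Finset.sum_congr rfl fun i hi => by rw [hcn i hi]
  simp only [ev_d, smul_add, Finset.sum_add_distrib, sum_contract_contract, ev_zero, shift_shift]
  rw [Finset.sum_range_succ' (fun i => (-1 : ℤ) ^ (i + 1) •
      (contract i a 0 * ev f (shift 1 (contract i a)))),
    Finset.sum_range_succ (fun i => (-1 : ℤ) ^ (i + 1) • (-1 : ℤ) ^ (n + 1) •
      (ev f (contract i a) * contract i a n)), e0]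
  simp only [hc0, hc00, hcnn, hs0, hs, hsn, hs1, ev_contract_ge le_rfl]
  have e1 : ∑ i ∈ Finset.range n, (-1 : ℤ) ^ (i + 1 + 1) •
      (a 0 * ev f (contract i (shift 1 a))) =
      - (a 0 * ∑ i ∈ Finset.range n, (-1 : ℤ) ^ (i + 1) • ev f (contract i (shift 1 a))) := by
    rw [Finset.mul_sum, ← Finset.sum_neg_distrib]
    refine Finset.sum_congr rfl fun i _ => ?_
    rw [pow_succ _ (i + 1), mul_neg, mul_one, neg_smul, mul_smul_comm]
  have e2 : ∑ i ∈ Finset.range n, (-1 : ℤ) ^ (i + 1) • (-1 : ℤ) ^ (n + 1) •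
      (ev f (contract i a) * a (n + 1)) =
      (-1 : ℤ) ^ (n + 1) • ((∑ i ∈ Finset.range n, (-1 : ℤ) ^ (i + 1) • ev f (contract i a)) *
        a (n + 1)) := by
    rw [Finset.sum_mul, Finset.smul_sum]
    refine Finset.sum_congr rfl fun i _ => ?_
    rw [smul_comm, smul_mul_assoc]
  rw [e1, e2, pow_succ (-1 : ℤ) (n + 1), pow_succ (-1 : ℤ) n]
  rcases neg_one_pow_eq_or ℤ n with hn | hn <;>
    · simp only [hn, add_mul, mul_add, smul_add, neg_mul, mul_neg, mul_one, neg_smul, one_smul,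
        neg_neg, mul_assoc, pow_succ, pow_zero]
      abel

variable (k A) in
/-- Hochschild cocycles. -/
def cocycles (n : ℕ) : Submodule k (Cochain k A n) := LinearMap.ker (d k A n)

variable (k A) in
/-- Hochschild coboundaries. -/
def coboundaries : (n : ℕ) → Submodule k (Cochain k A n)
  | 0 => ⊥
  | n + 1 => LinearMap.range (d k A n)

variable (k A) in
/-- The Hochschild cohomology group `HHⁿ(A)`: cocycles modulo coboundaries. -/
abbrev HH (n : ℕ) : Type _ :=
  cocycles k A n ⧸ (coboundaries k A n).comap (cocycles k A n).subtype

lemma cup_add {m n : ℕ} (f : Cochain k A m) (g g' : Cochain k A n) :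
    cup f (g + g') = cup f g + cup f g' :=
  cochain_ext fun a => by simp [ev_cup, mul_add]

lemma add_cup {m n : ℕ} (f f' : Cochain k A m) (g : Cochain k A n) :
    cup (f + f') g = cup f g + cup f' g :=
  cochain_ext fun a => by simp [ev_cup, add_mul]

lemma cup_smul {m n : ℕ} (c : k) (f : Cochain k A m) (g : Cochain k A n) :
    cup f (c • g) = c • cup f g :=
  cochain_ext fun a => by simp [ev_cup]

lemma smul_cup {m n : ℕ} (c : k) (f : Cochain k A m) (g : Cochain k A n) :
    cup (c • f) g = c • cup f g :=
  cochain_ext fun a => by simp [ev_cup]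

lemma cup_mem_cocycles {m n : ℕ} {f : Cochain k A m} {g : Cochain k A n}
    (hf : f ∈ cocycles k A m) (hg : g ∈ cocycles k A n) : cup f g ∈ cocycles k A (m + n) := by
  rw [cocycles, LinearMap.mem_ker] at *
  refine cochain_ext fun a => ?_
  simp [ev_d_cup, ev_cup, hf, hg]

/-- Cochains that agree up to the identification of equal degrees. -/
lemma mem_coboundaries_of_ev_eq {m n : ℕ} (h : m = n) {f : Cochain k A m} {g : Cochain k A n}
    (hfg : ∀ a, ev f a = ev g a) (hf : f ∈ coboundaries k A m) : g ∈ coboundaries k A n := by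
  subst h
  rwa [← cochain_ext hfg]

lemma cup_mem_coboundaries_right {m n : ℕ} {f : Cochain k A m} {g : Cochain k A n}
    (hf : f ∈ cocycles k A m) (hg : g ∈ coboundaries k A n) :
    cup f g ∈ coboundaries k A (m + n) := by
  rw [cocycles, LinearMap.mem_ker] at hf
  cases n with
  | zero =>
    obtain rfl : g = 0 := hg
    have : cup f (0 : Cochain k A 0) = 0 := cochain_ext fun a => by simp [ev_cup]
    rw [this]
    exact Submodule.zero_mem _
  | succ n =>
    obtain ⟨b, rfl⟩ := hg
    refine ⟨((-1 : k) ^ m) • cup f b, cochain_ext fun a => ?_⟩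
    have key := ev_d_cup f b a
    rw [hf] at key
    rw [map_smul, ev_smul]
    refine (congrArg (fun t => (-1 : k) ^ m • t) key).trans ?_
    rcases Nat.even_or_odd m with he | he <;> simp [ev_cup, he.neg_pow]

lemma cup_mem_coboundaries_left {m n : ℕ} {f : Cochain k A m} {g : Cochain k A n}
    (hf : f ∈ coboundaries k A m) (hg : g ∈ cocycles k A n) :
    cup f g ∈ coboundaries k A (m + n) := by
  rw [cocycles, LinearMap.mem_ker] at hg
  cases m with
  | zero =>
    obtain rfl : f = 0 := hf
    have : cup (0 : Cochain k A 0) g = 0 := cochain_ext fun a => by simp [ev_cup]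
    rw [this]
    exact Submodule.zero_mem _
  | succ m =>
    obtain ⟨b, rfl⟩ := hf
    refine mem_coboundaries_of_ev_eq (m := m + n + 1) (f := d k A (m + n) (cup b g)) (by omega)
      (fun a => ?_) ⟨_, rfl⟩
    rw [ev_d_cup, hg]
    simp [ev_cup]

lemma coboundaries_le_cocycles (n : ℕ) : coboundaries k A n ≤ cocycles k A n := by
  cases n with
  | zero => exact bot_le
  | succ n =>
    rintro _ ⟨b, rfl⟩
    exact d_d b

/-- The cohomology class of a cocycle. -/
def cls {n : ℕ} (f : cocycles k A n) : HH k A n := Submodule.Quotient.mk f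

/-- The cup product of cocycles. -/
def cupZ {m n : ℕ} : cocycles k A m →ₗ[k] cocycles k A n →ₗ[k] cocycles k A (m + n) :=
  LinearMap.mk₂ k (fun f g => ⟨cup f.1 g.1, cup_mem_cocycles f.2 g.2⟩)
    (fun f f' g => Subtype.ext (add_cup f.1 f'.1 g.1))
    (fun c f g => Subtype.ext (smul_cup c f.1 g.1))
    (fun f g g' => Subtype.ext (cup_add f.1 g.1 g'.1))
    (fun c f g => Subtype.ext (cup_smul c f.1 g.1))

/-- The cup product on Hochschild cohomology, `[f] ∪ [g] = [f ∪ g]`. -/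
def cupHH {m n : ℕ} : HH k A m →ₗ[k] HH k A n →ₗ[k] HH k A (m + n) :=
  Submodule.liftQ _
    (LinearMap.flip (Submodule.liftQ _
      (LinearMap.flip (cupZ.compr₂ (Submodule.mkQ
        ((coboundaries k A (m + n)).comap (cocycles k A (m + n)).subtype))))
      (fun g hg => by
        rw [LinearMap.mem_ker]
        refine LinearMap.ext fun f => ?_
        exact (Submodule.Quotient.mk_eq_zero _).mpr (cup_mem_coboundaries_right f.2 hg))))
    (fun f hf => by
      rw [LinearMap.mem_ker]
      refine LinearMap.ext fun g => ?_
      induction g using Submodule.Quotient.induction_on with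
      | H g => exact (Submodule.Quotient.mk_eq_zero _).mpr (cup_mem_coboundaries_left hf g.2))

lemma cupHH_cls {m n : ℕ} (f : cocycles k A m) (g : cocycles k A n) :
    cupHH (cls f) (cls g) = cls ⟨cup f.1 g.1, cup_mem_cocycles f.2 g.2⟩ := rfl

/-- The element `x` of `A` as a cochain of degree `0`. -/
def const (x : A) : Cochain k A 0 := MultilinearMap.constOfIsEmpty k _ x

@[simp] lemma ev_const (x : A) (a : ℕ → A) : ev (const (k := k) x) a = x := rfl

lemma const_algebraMap_mem (c : k) : const (algebraMap k A c) ∈ cocycles k A 0 := by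
  rw [cocycles, LinearMap.mem_ker]
  refine cochain_ext fun a => ?_
  simp [ev_d, Algebra.commutes]

/-- The scalar `c` as a class of degree `0`. -/
def scalar (c : k) : HH k A 0 := cls ⟨const (algebraMap k A c), const_algebraMap_mem c⟩

lemma graded_ext {m n : ℕ} (h : m = n) {f : cocycles k A m} {g : cocycles k A n}
    (hfg : ∀ a, ev f.1 a = ev g.1 a) :
    (GradedMonoid.mk m (cls f) : GradedMonoid (HH k A)) = GradedMonoid.mk n (cls g) := by
  subst h
  rw [Subtype.ext (cochain_ext hfg)]

lemma exists_cls {n : ℕ} (x : HH k A n) : ∃ f, cls f = x := Submodule.Quotient.mk_surjective _ x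

instance : GradedMonoid.GMul (HH k A) where
  mul x y := cupHH x y

instance : GradedMonoid.GOne (HH k A) where
  one := scalar 1

lemma graded_mul {m n : ℕ} (f : cocycles k A m) (g : cocycles k A n) :
    (GradedMonoid.mk m (cls f) : GradedMonoid (HH k A)) * GradedMonoid.mk n (cls g) =
      GradedMonoid.mk (m + n) (cls ⟨cup f.1 g.1, cup_mem_cocycles f.2 g.2⟩) := rfl

/-- The graded ring structure on Hochschild cohomology given by the cup product. -/
instance : DirectSum.GRing (HH k A) where
  mul_zero x := map_zero (cupHH x)
  zero_mul y := by
    change cupHH 0 y = 0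
    rw [map_zero, LinearMap.zero_apply]
  mul_add x y z := map_add (cupHH x) y z
  add_mul x y z := by
    change cupHH (x + y) z = cupHH x z + cupHH y z
    rw [map_add, LinearMap.add_apply]
  one_mul := by
    rintro ⟨n, x⟩
    obtain ⟨f, rfl⟩ := exists_cls x
    refine (graded_mul _ _).trans (graded_ext (zero_add n) fun a => ?_)
    simp [ev_cup]
  mul_one := by
    rintro ⟨n, x⟩
    obtain ⟨f, rfl⟩ := exists_cls x
    refine (graded_mul _ _).trans (graded_ext (add_zero n) fun a => ?_)
    simp [ev_cup]
  mul_assoc := by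
    rintro ⟨l, x⟩ ⟨m, y⟩ ⟨n, z⟩
    obtain ⟨f, rfl⟩ := exists_cls x
    obtain ⟨g, rfl⟩ := exists_cls y
    obtain ⟨h, rfl⟩ := exists_cls z
    change GradedMonoid.mk _ (cls f) * GradedMonoid.mk _ (cls g) * GradedMonoid.mk _ (cls h) =
      GradedMonoid.mk _ (cls f) * (GradedMonoid.mk _ (cls g) * GradedMonoid.mk _ (cls h))
    simp only [graded_mul]
    refine graded_ext (add_assoc l m n) fun a => ?_
    simp [ev_cup, shift_shift, mul_assoc]
  natCast n := n • scalar 1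
  natCast_zero := zero_smul _ _
  natCast_succ n := succ_nsmul _ n
  intCast n := n • scalar 1
  intCast_ofNat n := natCast_zsmul _ n
  intCast_negSucc_ofNat n := negSucc_zsmul _ n

/-- The `k`-algebra structure on Hochschild cohomology. -/
instance : DirectSum.GAlgebra k (HH k A) where
  toFun :=
    { toFun := scalar
      map_zero' := by
        refine congrArg cls (Subtype.ext (cochain_ext fun a => ?_))
        simp
      map_add' := fun c c' => by
        refine congrArg cls (Subtype.ext (cochain_ext fun a => ?_))
        simp }
  map_one := rfl
  map_mul c c' := by
    refine graded_ext (g := ⟨cup (const (algebraMap k A c)) (const (algebraMap k A c')),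
      cup_mem_cocycles (const_algebraMap_mem c) (const_algebraMap_mem c')⟩) rfl fun a => ?_
    simp [ev_cup]
  commutes := by
    rintro c ⟨n, x⟩
    obtain ⟨f, rfl⟩ := exists_cls x
    refine (graded_mul _ _).trans (Eq.trans (graded_ext (add_comm 0 n) fun a => ?_)
      (graded_mul _ _).symm)
    simp [ev_cup, Algebra.commutes]
  smul_def := by
    rintro c ⟨n, x⟩
    obtain ⟨f, rfl⟩ := exists_cls x
    refine Eq.trans (graded_ext (f := c • f) (zero_add n).symm fun a => ?_)
      (graded_mul _ _).symm
    simp [ev_cup, Algebra.smul_def]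

variable (k A) in
/-- The Hochschild cohomology ring `HH*(A) = ⨁ₙ HHⁿ(A)`. -/
abbrev HHRing : Type _ := ⨁ n, HH k A n

variable (k A) in
/-- The Hilbert series `∑ₙ dim_k HHⁿ(A) tⁿ` (meaningful if all `HHⁿ(A)` are finite
dimensional). -/
def hilbertSeries : PowerSeries ℚ := PowerSeries.mk fun n => (Module.finrank k (HH k A n) : ℚ)

end Cochains

end

end Hochschild

/-! ## The algebras and rings of the theorem -/

noncomputable section

/-- The defining relations `x² = 0`, `xy + q yx = 0`, `y² = 0`, where `x` and `y` are the free
generators with index `0` and `1`. -/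
inductive QuantumRel (k : Type*) [Field k] (q : k) :
    FreeAlgebra k (Fin 2) → FreeAlgebra k (Fin 2) → Prop
  | xx : QuantumRel k q (FreeAlgebra.ι k 0 * FreeAlgebra.ι k 0) 0
  | xy : QuantumRel k q
      (FreeAlgebra.ι k 0 * FreeAlgebra.ι k 1 + q • (FreeAlgebra.ι k 1 * FreeAlgebra.ι k 0)) 0
  | yy : QuantumRel k q (FreeAlgebra.ι k 1 * FreeAlgebra.ι k 1) 0

/-- The algebra `Λ_q = k⟨x, y⟩ / (x², xy + q yx, y²)`. -/
abbrev QuantumExterior (k : Type*) [Field k] (q : k) : Type _ := RingQuot (QuantumRel k q)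

/-- The fibre product `k[z]/(z²) ×_k ∧*(u₁, u₂)` over the two augmentations `z ↦ 0` and
`u₁, u₂ ↦ 0`. Here `k[z]/(z²)` is the ring of dual numbers. -/
abbrev DualNumberFibreExterior (k : Type*) [Field k] :
    Subalgebra k (k[ε] × ExteriorAlgebra k (Fin 2 → k)) :=
  AlgHom.equalizer
    ((TrivSqZeroExt.fstHom k k k).comp (AlgHom.fst k k[ε] (ExteriorAlgebra k (Fin 2 → k))))
    (ExteriorAlgebra.algebraMapInv.comp (AlgHom.snd k k[ε] (ExteriorAlgebra k (Fin 2 → k))))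

/-- The (left) global dimension of a ring: the supremum of the projective dimensions of its left
modules. For the right global dimension, apply it to the opposite ring. -/
def globalDimension.{u} (R : Type u) [Ring R] : WithBot ℕ∞ :=
  ⨆ M : ModuleCat.{u} R, CategoryTheory.projectiveDimension M

end

noncomputable section

/-! ## The basis `1, x, y, yx` of a quantum exterior algebra -/

/-! The algebra is Koszul, and its quadratic dual is the quantum plane `k⟨ξ, η⟩ / (ηξ - q ξη)`. Its
Hochschild cohomology ring is therefore the cohomology of the small differential algebra `A ⊗ k⟨ξ,
η⟩ / (ηξ - q ξη)`, whose differential is the graded commutator with `x ⊗ ξ + y ⊗ η`.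

The comparison is made directly on cochains. Summing the values of a cochain over all words in `x`
and `y` gives a map `restrict` that commutes with the differentials (`restrict_dIn`), is onto
(`exists_restrict_eq`) and multiplicative (`restrict_cup`). Its kernel is acyclic in positive
degrees (`exists_dIn_of_restrict_eq_zero`). This is dimension shifting: a bimodule `M` embeds into
the coinduced bimodule `Hom_k(A, M)`, for which both complexes are exact in positive degrees, so
general bimodule coefficients have to be carried along.

In the coordinates of `1, x, y, yx` the differential sends constants to the coordinates of `x` and
`y`, and those to the coordinate of `yx`. Give `x, y` the weights opposite to `ξ, η`. Then the
complex splits by weight into pieces of dimension at most four, with matrix entries such as `1 ±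
qʲ`, `qⁱ ± 1` and `q` times these, and all three cases become linear algebra.

If `q ≠ 0` is not a root of unity, these entries vanish only in weight zero, where the differential
is zero. This leaves `1`, `xξ`, `yη`, `yx ξη`, together with the central element `yx`
(`isKoszulBoundary_of_notRoot`, `cocycle_zero_of_notRoot`), and the products of these classes are
those of the fibre product. The global dimension is infinite because the ideal generated by `x` on
one side is its own syzygy.

If `q` has finite order, let `N` be twice an exponent that kills it. The monomials in `ξᴺ` and `ηᴺ`
are central cocycles, independent modulo boundaries because a boundary has no constant coordinate.
Every cocycle of high degree is a sum of multiples of `ξᴺ` and `ηᴺ` (`exists_eq_translate_add`), so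
the classes of low degree generate.

If `q = 0`, the classes without constant coordinate have zero products
(`kmul_eq_zero_of_c1_eq_zero`) and span a complement of `k`. An algebra of this kind is finitely
generated only if it is finite dimensional, but no cohomology group vanishes. -/

/-- Generators `x`, `y` of an algebra with `x² = 0`, `xy = -q yx`, `y² = 0`, such that
`1, x, y, yx` is a basis, the coordinates of which are `c1`, `cx`, `cy`, `cz`. -/
structure QuantumFrame {k : Type*} (A : Type*) [Field k] [Ring A] [Algebra k A] (q : k) where
  x : A
  y : A
  xx : x * x = 0
  yy : y * y = 0
  xy : x * y = (-q) • (y * x)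
  c1 : A →ₗ[k] k
  cx : A →ₗ[k] k
  cy : A →ₗ[k] k
  cz : A →ₗ[k] k
  c1_one : c1 1 = 1
  c1_x : c1 x = 0
  c1_y : c1 y = 0
  c1_z : c1 (y * x) = 0
  cx_one : cx 1 = 0
  cx_x : cx x = 1
  cx_y : cx y = 0
  cx_z : cx (y * x) = 0
  cy_one : cy 1 = 0
  cy_x : cy x = 0
  cy_y : cy y = 1
  cy_z : cy (y * x) = 0
  cz_one : cz 1 = 0
  cz_x : cz x = 0
  cz_y : cz y = 0
  cz_z : cz (y * x) = 1
  sum_coord : ∀ a, c1 a • (1 : A) + cx a • x + cy a • y + cz a • (y * x) = a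

attribute [simp] QuantumFrame.xx QuantumFrame.yy QuantumFrame.c1_one QuantumFrame.c1_x
  QuantumFrame.c1_y QuantumFrame.c1_z QuantumFrame.cx_one QuantumFrame.cx_x QuantumFrame.cx_y
  QuantumFrame.cx_z QuantumFrame.cy_one QuantumFrame.cy_x QuantumFrame.cy_y QuantumFrame.cy_z
  QuantumFrame.cz_one QuantumFrame.cz_x QuantumFrame.cz_y QuantumFrame.cz_z

namespace QuantumExterior

variable (k : Type*) [Field k] (q : k)

/-- The generator `x` of `Λ_q`. -/
def genX : QuantumExterior k q := RingQuot.mkAlgHom k (QuantumRel k q) (FreeAlgebra.ι k 0)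

/-- The generator `y` of `Λ_q`. -/
def genY : QuantumExterior k q := RingQuot.mkAlgHom k (QuantumRel k q) (FreeAlgebra.ι k 1)

lemma genX_mul_genX : genX k q * genX k q = 0 := by
  simpa [genX] using RingQuot.mkAlgHom_rel k (QuantumRel.xx (k := k) (q := q))

lemma genY_mul_genY : genY k q * genY k q = 0 := by
  simpa [genY] using RingQuot.mkAlgHom_rel k (QuantumRel.yy (k := k) (q := q))

lemma genX_mul_genY : genX k q * genY k q = (-q) • (genY k q * genX k q) := by
  have h : genX k q * genY k q + q • (genY k q * genX k q) = 0 := by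
    simpa [genX, genY] using RingQuot.mkAlgHom_rel k (QuantumRel.xy (k := k) (q := q))
  have h' : q • (genY k q * genX k q) + (-q) • (genY k q * genX k q) = 0 := by
    rw [← add_smul, add_neg_cancel, zero_smul]
  rw [← add_zero (genX k q * genY k q), ← h', ← add_assoc, h, zero_add]

/-- Left multiplication by `x` in the coordinates with respect to `1, x, y, yx`. -/
def mulX : Module.End k (Fin 4 → k) where
  toFun v := ![0, v 0, 0, -(q * v 2)]
  map_add' v w := by ext i; fin_cases i <;> simp; ring
  map_smul' c v := by ext i; fin_cases i <;> simp; ring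

/-- Left multiplication by `y` in the coordinates with respect to `1, x, y, yx`. -/
def mulY : Module.End k (Fin 4 → k) where
  toFun v := ![0, 0, v 0, v 1]
  map_add' v w := by ext i; fin_cases i <;> simp
  map_smul' c v := by ext i; fin_cases i <;> simp

/-- The left regular representation of `Λ_q` in coordinates. -/
def regular : QuantumExterior k q →ₐ[k] Module.End k (Fin 4 → k) :=
  RingQuot.liftAlgHom k ⟨FreeAlgebra.lift k ![mulX k q, mulY k], by
    rintro _ _ (_ | _ | _) <;>
    · refine LinearMap.ext fun v => ?_
      ext i
      fin_cases i <;> simp [mulX, mulY]⟩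

lemma regular_genX (v : Fin 4 → k) :
    regular k q (genX k q) v = ![0, v 0, 0, -(q * v 2)] := by
  simp [regular, genX, mulX]

lemma regular_genY (v : Fin 4 → k) :
    regular k q (genY k q) v = ![0, 0, v 0, v 1] := by
  simp [regular, genY, mulY]

/-- The coordinates with respect to `1, x, y, yx`. -/
def coord (i : Fin 4) : QuantumExterior k q →ₗ[k] k :=
  -- The value of the regular representation at the vector of `1`. As it is defined on the quotient
  -- algebra, it shows that `1, x, y, yx` are independent.
  (LinearMap.proj i).comp ((LinearMap.applyₗ ![1, 0, 0, 0]).comp (regular k q).toLinearMap)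

lemma coord_apply (i : Fin 4) (a : QuantumExterior k q) :
    coord k q i a = regular k q a ![1, 0, 0, 0] i := rfl

lemma mem_span (a : QuantumExterior k q) : ∃ c : Fin 4 → k,
    a = c 0 • 1 + c 1 • genX k q + c 2 • genY k q + c 3 • (genY k q * genX k q) := by
  obtain ⟨a, rfl⟩ := RingQuot.mkAlgHom_surjective k (QuantumRel k q) a
  have hx : RingQuot.mkAlgHom k (QuantumRel k q) (FreeAlgebra.ι k 0) = genX k q := rfl
  have hy : RingQuot.mkAlgHom k (QuantumRel k q) (FreeAlgebra.ι k 1) = genY k q := rfl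
  have hyxx : genY k q * genX k q * genX k q = 0 := by rw [mul_assoc, genX_mul_genX, mul_zero]
  have hyxy : genY k q * genX k q * genY k q = 0 := by
    rw [mul_assoc, genX_mul_genY, mul_smul_comm, ← mul_assoc, genY_mul_genY]; simp
  -- Stability of the span under right multiplication is the form of the claim that passes through
  -- products in the free algebra.
  suffices h : ∀ b : QuantumExterior k q, (∃ c : Fin 4 → k,
      b = c 0 • 1 + c 1 • genX k q + c 2 • genY k q + c 3 • (genY k q * genX k q)) →
      ∃ c : Fin 4 → k, b * RingQuot.mkAlgHom k (QuantumRel k q) a =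
        c 0 • 1 + c 1 • genX k q + c 2 • genY k q + c 3 • (genY k q * genX k q) by
    simpa using h 1 ⟨![1, 0, 0, 0], by simp⟩
  induction a using FreeAlgebra.induction with
  | grade0 r =>
    rintro b ⟨c, rfl⟩
    refine ⟨r • c, ?_⟩
    rw [AlgHom.commutes, ← Algebra.commutes, ← Algebra.smul_def]
    simp [smul_add, smul_smul]
  | grade1 i =>
    rintro b ⟨c, rfl⟩
    fin_cases i
    · refine ⟨![0, c 0, 0, c 2], ?_⟩
      simp [hx, add_mul, hyxx, genX_mul_genX]
    · refine ⟨![0, 0, c 0, (-q) * c 1], ?_⟩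
      simp [hy, add_mul, hyxy, genY_mul_genY, genX_mul_genY, smul_smul, mul_comm, -neg_smul,
        -neg_mul, -mul_neg]
  | mul a b iha ihb =>
    intro c hc
    rw [map_mul, ← mul_assoc]
    exact ihb _ (iha _ hc)
  | add a b iha ihb =>
    intro c hc
    obtain ⟨u, hu⟩ := iha c hc
    obtain ⟨v, hv⟩ := ihb c hc
    refine ⟨u + v, ?_⟩
    rw [map_add, mul_add, hu, hv]
    simp only [Pi.add_apply, add_smul]
    abel

/-- The basis `1, x, y, yx` of `Λ_q`. -/
def frame : QuantumFrame (QuantumExterior k q) q where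
  x := genX k q
  y := genY k q
  xx := genX_mul_genX k q
  yy := genY_mul_genY k q
  xy := genX_mul_genY k q
  c1 := coord k q 0
  cx := coord k q 1
  cy := coord k q 2
  cz := coord k q 3
  c1_one := by simp [coord_apply]
  c1_x := by simp [coord_apply, regular_genX]
  c1_y := by simp [coord_apply, regular_genY]
  c1_z := by simp [coord_apply, regular_genX, regular_genY]
  cx_one := by simp [coord_apply]
  cx_x := by simp [coord_apply, regular_genX]
  cx_y := by simp [coord_apply, regular_genY]
  cx_z := by simp [coord_apply, regular_genX, regular_genY]
  cy_one := by simp [coord_apply]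
  cy_x := by simp [coord_apply, regular_genX]
  cy_y := by simp [coord_apply, regular_genY]
  cy_z := by simp [coord_apply, regular_genX, regular_genY]
  cz_one := by simp [coord_apply]
  cz_x := by simp [coord_apply, regular_genX]
  cz_y := by simp [coord_apply, regular_genY]
  cz_z := by simp [coord_apply, regular_genX, regular_genY]
  sum_coord a := by
    obtain ⟨c, rfl⟩ := mem_span k q a
    simp [coord_apply, regular_genX, regular_genY]

end QuantumExterior

namespace QuantumFrame

variable {k A : Type*} [Field k] [Ring A] [Algebra k A] {q : k} (Q : QuantumFrame A q)

lemma ext {a b : A} (h1 : Q.c1 a = Q.c1 b) (hx : Q.cx a = Q.cx b) (hy : Q.cy a = Q.cy b)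
    (hz : Q.cz a = Q.cz b) : a = b := by
  rw [← Q.sum_coord a, ← Q.sum_coord b, h1, hx, hy, hz]

lemma linearMap_ext {M : Type*} [AddCommGroup M] [Module k M] {f g : A →ₗ[k] M}
    (h1 : f 1 = g 1) (hx : f Q.x = g Q.x) (hy : f Q.y = g Q.y)
    (hz : f (Q.y * Q.x) = g (Q.y * Q.x)) : f = g := by
  refine LinearMap.ext fun a => ?_
  rw [← Q.sum_coord a]
  simp only [map_add, map_smul, h1, hx, hy, hz]

@[simp] lemma z_mul_x : Q.y * Q.x * Q.x = 0 := by rw [mul_assoc, Q.xx, mul_zero]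

@[simp] lemma z_mul_y : Q.y * Q.x * Q.y = 0 := by
  rw [mul_assoc, Q.xy, mul_smul_comm, ← mul_assoc, Q.yy]; simp

@[simp] lemma y_mul_z : Q.y * (Q.y * Q.x) = 0 := by rw [← mul_assoc, Q.yy, zero_mul]

@[simp] lemma x_mul_z : Q.x * (Q.y * Q.x) = 0 := by
  rw [← mul_assoc, Q.xy, smul_mul_assoc, mul_assoc, Q.xx]; simp

@[simp] lemma c1_mul (a b : A) : Q.c1 (a * b) = Q.c1 a * Q.c1 b := by
  conv_lhs => rw [← Q.sum_coord a, ← Q.sum_coord b]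
  simp [add_mul, mul_add, Q.xy, ← mul_assoc]
  ring

@[simp] lemma cx_mul (a b : A) : Q.cx (a * b) = Q.c1 a * Q.cx b + Q.cx a * Q.c1 b := by
  conv_lhs => rw [← Q.sum_coord a, ← Q.sum_coord b]
  simp [add_mul, mul_add, Q.xy, ← mul_assoc]
  ring

@[simp] lemma cy_mul (a b : A) : Q.cy (a * b) = Q.c1 a * Q.cy b + Q.cy a * Q.c1 b := by
  conv_lhs => rw [← Q.sum_coord a, ← Q.sum_coord b]
  simp [add_mul, mul_add, Q.xy, ← mul_assoc]
  ring

-- Apart from products with `1`, only `y · x = yx` and `x · y = -q yx` contribute.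
@[simp] lemma cz_mul (a b : A) : Q.cz (a * b) =
    Q.c1 a * Q.cz b + Q.cz a * Q.c1 b + Q.cy a * Q.cx b - q * Q.cx a * Q.cy b := by
  conv_lhs => rw [← Q.sum_coord a, ← Q.sum_coord b]
  simp [add_mul, mul_add, Q.xy, ← mul_assoc]
  ring

lemma finite (Q : QuantumFrame A q) : Module.Finite k A := by
  classical
  refine ⟨⟨{1, Q.x, Q.y, Q.y * Q.x}, ?_⟩⟩
  rw [eq_top_iff]
  intro a _
  rw [← Q.sum_coord a]
  refine add_mem (add_mem (add_mem ?_ ?_) ?_) ?_ <;>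
    exact Submodule.smul_mem _ _ (Submodule.subset_span (by simp))

end QuantumFrame

end


noncomputable section

/-! ## Hochschild cochains with coefficients in a bimodule -/

/-- The structure of an `A`-bimodule, compatible with the action of `k`, on a `k`-module `M`. -/
structure BimoduleAction (k A M : Type*) [CommRing k] [Ring A] [Algebra k A] [AddCommGroup M]
    [Module k M] where
  l : A →ₗ[k] M →ₗ[k] M
  r : A →ₗ[k] M →ₗ[k] M
  one_l : ∀ m, l 1 m = m
  one_r : ∀ m, r 1 m = m
  mul_l : ∀ a b m, l (a * b) m = l a (l b m)
  mul_r : ∀ a b m, r (a * b) m = r b (r a m)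
  l_r : ∀ a b m, l a (r b m) = r b (l a m)

namespace BimoduleAction

variable {k A M : Type*} [CommRing k] [Ring A] [Algebra k A] [AddCommGroup M] [Module k M]

variable (k A) in
/-- The bimodule `A`. -/
def self : BimoduleAction k A A where
  l := LinearMap.mul k A
  r := (LinearMap.mul k A).flip
  one_l := by simp
  one_r := by simp
  mul_l := by simp [mul_assoc]
  mul_r := by simp [mul_assoc]
  l_r := by simp [mul_assoc]

/-- The coinduced bimodule `Hom_k(A, M)` with `(a φ b)(c) = φ(c a) b`. -/
def coind (B : BimoduleAction k A M) : BimoduleAction k A (A →ₗ[k] M) where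
  l := LinearMap.mk₂ k (fun a φ => φ.comp (LinearMap.mulRight k a))
    (by intros; ext; simp [mul_add]) (by intros; ext; simp)
    (by intros; ext; simp) (by intros; ext; simp)
  r := LinearMap.mk₂ k (fun a φ => (B.r a).comp φ)
    (by intros; ext; simp) (by intros; ext; simp)
    (by intros; ext; simp) (by intros; ext; simp)
  one_l := by intros; ext; simp
  one_r := by intros; ext; simp [B.one_r]
  mul_l := by intros; ext; simp [mul_assoc]
  mul_r := by intros; ext; simp [B.mul_r]
  l_r := by intros; ext; simp

@[simp] lemma coind_l (B : BimoduleAction k A M) (a c : A) (φ : A →ₗ[k] M) :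
    B.coind.l a φ c = φ (c * a) := rfl

@[simp] lemma coind_r (B : BimoduleAction k A M) (a c : A) (φ : A →ₗ[k] M) :
    B.coind.r a φ c = B.r a (φ c) := rfl

/-- The bimodule structure on the quotient by a subbimodule. -/
def quotient (B : BimoduleAction k A M) (N : Submodule k M) (hl : ∀ a, N ≤ N.comap (B.l a))
    (hr : ∀ a, N ≤ N.comap (B.r a)) : BimoduleAction k A (M ⧸ N) where
  l :=
    { toFun := fun a => N.mapQ N (B.l a) (hl a)
      map_add' := fun a b => by ext; simp
      map_smul' := fun c a => by ext; simp }
  r :=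
    { toFun := fun a => N.mapQ N (B.r a) (hr a)
      map_add' := fun a b => by ext; simp
      map_smul' := fun c a => by ext; simp }
  one_l m := by
    obtain ⟨m, rfl⟩ := N.mkQ_surjective m
    simp [B.one_l]
  one_r m := by
    obtain ⟨m, rfl⟩ := N.mkQ_surjective m
    simp [B.one_r]
  mul_l a b m := by
    obtain ⟨m, rfl⟩ := N.mkQ_surjective m
    simp [B.mul_l]
  mul_r a b m := by
    obtain ⟨m, rfl⟩ := N.mkQ_surjective m
    simp [B.mul_r]
  l_r a b m := by
    obtain ⟨m, rfl⟩ := N.mkQ_surjective m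
    simp [B.l_r]

/-- The embedding of a bimodule into the coinduced bimodule. -/
def toCoind (B : BimoduleAction k A M) : M →ₗ[k] A →ₗ[k] M := B.l.flip

@[simp] lemma toCoind_apply (B : BimoduleAction k A M) (m : M) (a : A) :
    B.toCoind m a = B.l a m := rfl

end BimoduleAction

namespace Hochschild

variable {k A M M' : Type*} [CommRing k] [Ring A] [Algebra k A] [AddCommGroup M] [Module k M]
  [AddCommGroup M'] [Module k M']

variable (k A M) in
/-- Hochschild cochains of degree `n` with coefficients in `M`. -/
abbrev CochainIn (n : ℕ) : Type _ := MultilinearMap k (fun _ : Fin n => A) M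

/-- The value of a cochain on the first `n` entries of a sequence. -/
def evIn {n : ℕ} (f : CochainIn k A M n) (a : ℕ → A) : M := f fun i => a i

lemma evIn_congr {n : ℕ} (f : CochainIn k A M n) {a b : ℕ → A} (h : ∀ i < n, a i = b i) :
    evIn f a = evIn f b := by
  unfold evIn
  congr 1
  funext i
  exact h i i.2

lemma evIn_extend {n : ℕ} (f : CochainIn k A M n) (v : Fin n → A) :
    evIn f (extend v) = f v := by
  simp [evIn, extend_coe]

lemma cochainIn_ext {n : ℕ} {f g : CochainIn k A M n} (h : ∀ a, evIn f a = evIn g a) :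
    f = g := by
  refine MultilinearMap.ext fun v => ?_
  simpa [evIn_extend] using h (extend v)

@[simp] lemma evIn_add {n : ℕ} (f g : CochainIn k A M n) (a : ℕ → A) :
    evIn (f + g) a = evIn f a + evIn g a := rfl

@[simp] lemma evIn_sub {n : ℕ} (f g : CochainIn k A M n) (a : ℕ → A) :
    evIn (f - g) a = evIn f a - evIn g a := rfl

@[simp] lemma evIn_smul {n : ℕ} (c : k) (f : CochainIn k A M n) (a : ℕ → A) :
    evIn (c • f) a = c • evIn f a := rfl

@[simp] lemma evIn_zero {n : ℕ} (a : ℕ → A) : evIn (0 : CochainIn k A M n) a = 0 := rfl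

@[simp] lemma evIn_comp {n : ℕ} (p : M →ₗ[k] M') (f : CochainIn k A M n) (a : ℕ → A) :
    evIn (p.compMultilinearMap f) a = p (evIn f a) := rfl

lemma extend_update {n : ℕ} (v : Fin n → A) (i : Fin n) (z : A) :
    extend (Function.update v i z) = Function.update (extend v) i z := by
  funext j
  by_cases hj : j < n
  · by_cases h : j = i
    · subst h; simp [extend]
    · have : (⟨j, hj⟩ : Fin n) ≠ i := fun e => h (by rw [← e])
      simp [extend, hj, h, this]
  · have : j ≠ i := by have := i.2; omega
    simp [extend, hj, this]

lemma update_restrict {n i : ℕ} (hi : i < n) (a : ℕ → A) (z : A) :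
    (fun j : Fin n => Function.update a i z j) =
      Function.update (fun j : Fin n => a j) ⟨i, hi⟩ z := by
  funext j
  by_cases h : j = ⟨i, hi⟩
  · subst h; simp
  · have : (j : ℕ) ≠ i := fun e => h (Fin.ext e)
    simp [h, this]

/-- The linear map given by a cochain if all entries but the `i`-th one are fixed. -/
def slot {n : ℕ} (f : CochainIn k A M n) (a : ℕ → A) (i : Fin n) : A →ₗ[k] M :=
  f.toLinearMap (fun j => a j) i

lemma evIn_update {n : ℕ} (f : CochainIn k A M n) (a : ℕ → A) {i : ℕ} (hi : i < n) (z : A) :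
    evIn f (Function.update a i z) = slot f a ⟨i, hi⟩ z := by
  unfold evIn
  rw [update_restrict hi]
  rfl

lemma evIn_update_ge {n : ℕ} (f : CochainIn k A M n) (a : ℕ → A) {l : ℕ} (hl : n ≤ l) (x : A) :
    evIn f (Function.update a l x) = evIn f a := by
  apply evIn_congr
  intro i hi
  have : i ≠ l := by omega
  simp [this]

/-- A function of sequences that only reads the first `n` entries and is `k`-linear in each of
them, as a cochain. -/
def ofSeqIn (n : ℕ) (F : (ℕ → A) → M)
    (hF : ∀ (a : ℕ → A) (i : ℕ), i < n → ∃ φ : A →ₗ[k] M,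
      ∀ z, F (Function.update a i z) = φ z) : CochainIn k A M n where
  toFun v := F (extend v)
  map_update_add' := by
    intro inst v i x y
    obtain rfl : inst = instDecidableEqFin n := Subsingleton.elim _ _
    obtain ⟨φ, hφ⟩ := hF (extend v) i i.2
    simp only [extend_update, hφ, map_add]
  map_update_smul' := by
    intro inst v i c x
    obtain rfl : inst = instDecidableEqFin n := Subsingleton.elim _ _
    obtain ⟨φ, hφ⟩ := hF (extend v) i i.2
    simp only [extend_update, hφ, map_smul]

lemma evIn_ofSeqIn {n : ℕ} {F : (ℕ → A) → M} {hF} (h : ∀ a b, (∀ i < n, a i = b i) → F a = F b)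
    (a : ℕ → A) : evIn (ofSeqIn (k := k) n F hF) a = F a := by
  change F (extend fun i : Fin n => a i) = F a
  apply h
  intro i hi
  simp [extend, hi]

variable (B : BimoduleAction k A M)

/-- The value of the Hochschild differential of `f` on `a₀, …, aₙ`. -/
def dSeqIn {n : ℕ} (f : CochainIn k A M n) (a : ℕ → A) : M :=
  B.l (a 0) (evIn f (shift 1 a))
    + ∑ i ∈ Finset.range n, (-1 : ℤ) ^ (i + 1) • evIn f (contract i a)
    + (-1 : ℤ) ^ (n + 1) • B.r (a n) (evIn f a)

/-- The two outer terms and the contractions of the differential are treated separately. Exhibiting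
the linear map in each slot yields additivity and homogeneity at once, as `ofSeqIn` requires. -/
lemma head_linear {n : ℕ} (f : CochainIn k A M n) (a : ℕ → A) {i : ℕ} (hi : i < n + 1) :
    ∃ φ : A →ₗ[k] M, ∀ z, B.l (Function.update a i z 0) (evIn f (shift 1 (Function.update a i z)))
      = φ z := by
  rcases i with _ | i
  · exact ⟨B.l.flip (evIn f (shift 1 a)), fun z => by simp [shift_update_lt]⟩
  · refine ⟨(B.l (a 0)).comp (slot f (shift 1 a) ⟨i, by omega⟩), fun z => ?_⟩
    have h0 : (0 : ℕ) ≠ 1 + i := by omega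
    rw [add_comm i 1, shift_update_add, Function.update_of_ne h0, evIn_update f _ (by omega)]
    rfl

lemma tail_linear {n : ℕ} (f : CochainIn k A M n) (a : ℕ → A) {i : ℕ} (hi : i < n + 1) :
    ∃ φ : A →ₗ[k] M, ∀ z, B.r (Function.update a i z n) (evIn f (Function.update a i z)) = φ z := by
  rcases Nat.lt_or_ge i n with h | h
  · refine ⟨(B.r (a n)).comp (slot f a ⟨i, h⟩), fun z => ?_⟩
    rw [Function.update_of_ne (by omega), evIn_update f _ h]
    rfl
  · obtain rfl : i = n := by omega
    exact ⟨B.r.flip (evIn f a), fun z => by simp [evIn_update_ge f a le_rfl]⟩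

lemma contract_linear {n : ℕ} (f : CochainIn k A M n) (a : ℕ → A) {i l : ℕ} (hi : i < n)
    (hl : l < n + 1) :
    ∃ φ : A →ₗ[k] M, ∀ z, evIn f (contract i (Function.update a l z)) = φ z := by
  rcases lt_trichotomy l i with h | rfl | h
  · refine ⟨slot f (contract i a) ⟨l, by omega⟩, fun z => ?_⟩
    rw [contract_update_lt h, evIn_update f _ (by omega)]
  · refine ⟨(slot f (contract l a) ⟨l, hi⟩).comp (LinearMap.mulRight k (a (l + 1))), fun z => ?_⟩
    rw [contract_update_left, evIn_update f _ hi]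
    rfl
  · obtain ⟨l, rfl⟩ : ∃ l', l = l' + 1 := ⟨l - 1, by omega⟩
    rcases Nat.lt_or_ge i l with h' | h'
    · refine ⟨slot f (contract i a) ⟨l, by omega⟩, fun z => ?_⟩
      rw [contract_update_gt h', evIn_update f _ (by omega)]
    · obtain rfl : l = i := by omega
      refine ⟨(slot f (contract l a) ⟨l, hi⟩).comp (LinearMap.mulLeft k (a l)), fun z => ?_⟩
      rw [contract_update_right, evIn_update f _ hi]
      rfl

/-- The Hochschild differential of a cochain. -/
def dIn {n : ℕ} (f : CochainIn k A M n) : CochainIn k A M (n + 1) :=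
  ofSeqIn (n + 1) (dSeqIn B f) (by
    intro a l hl
    obtain ⟨φ, hφ⟩ := head_linear B f a hl
    obtain ⟨ψ, hψ⟩ := tail_linear B f a hl
    choose χ hχ using fun i : Fin n => contract_linear f a i.2 hl
    refine ⟨φ + ∑ i : Fin n, (-1 : ℤ) ^ ((i : ℕ) + 1) • χ i + (-1 : ℤ) ^ (n + 1) • ψ,
      fun z => ?_⟩
    simp only [dSeqIn, hφ, hψ, Finset.sum_range, hχ, LinearMap.add_apply, LinearMap.smul_apply,
      LinearMap.sum_apply])

lemma evIn_d {n : ℕ} (f : CochainIn k A M n) (a : ℕ → A) : evIn (dIn B f) a =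
    B.l (a 0) (evIn f (shift 1 a))
      + ∑ i ∈ Finset.range n, (-1 : ℤ) ^ (i + 1) • evIn f (contract i a)
      + (-1 : ℤ) ^ (n + 1) • B.r (a n) (evIn f a) := by
  refine evIn_ofSeqIn (fun a b h => ?_) a
  unfold dSeqIn
  rw [h 0 (by omega), h n (by omega),
    evIn_congr f (a := a) (b := b) (fun i hi => h i (by omega)),
    evIn_congr f (a := shift 1 a) (b := shift 1 b) (fun i hi => h (1 + i) (by omega))]
  congr 2
  apply Finset.sum_congr rfl
  intro i hi
  rw [evIn_congr f (a := contract i a) (b := contract i b)]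
  intro j hj
  simp only [contract, h j (by omega), h (j + 1) (by omega)]

lemma dIn_sub {n : ℕ} (f g : CochainIn k A M n) : dIn B (f - g) = dIn B f - dIn B g :=
  cochainIn_ext fun a => by
    simp only [evIn_d, evIn_sub, map_sub, smul_sub, Finset.sum_sub_distrib]
    abel

lemma dIn_zero {n : ℕ} : dIn B (0 : CochainIn k A M n) = 0 := by
  simpa using dIn_sub B (0 : CochainIn k A M n) 0

lemma evIn_contract_ge {n i : ℕ} (h : n ≤ i) (f : CochainIn k A M n) (a : ℕ → A) :
    evIn f (contract i a) = evIn f a := by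
  apply evIn_congr
  intro j hj
  have : j < i := by omega
  simp [contract, this]

lemma dIn_comp (B' : BimoduleAction k A M') (p : M →ₗ[k] M')
    (hl : ∀ a m, p (B.l a m) = B'.l a (p m)) (hr : ∀ a m, p (B.r a m) = B'.r a (p m)) {n : ℕ}
    (f : CochainIn k A M n) :
    dIn B' (p.compMultilinearMap f) = p.compMultilinearMap (dIn B f) :=
  cochainIn_ext fun a => by
    simp only [evIn_d, evIn_comp, map_add, map_sum, map_zsmul, hl, hr]

/-- By `contract_contract`, the terms cancel in pairs under the involution that exchanges `(i, j)`
with `(j + 1, i)` for `i ≤ j`. -/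
lemma sum_contract_contractIn {n : ℕ} (f : CochainIn k A M n) (a : ℕ → A) :
    ∑ i ∈ Finset.range (n + 1), (-1 : ℤ) ^ (i + 1) •
      ∑ j ∈ Finset.range n, (-1 : ℤ) ^ (j + 1) • evIn f (contract j (contract i a)) = 0 := by
  simp only [Finset.smul_sum]
  rw [← Finset.sum_product']
  refine Finset.sum_involution
    (fun p _ => if p.1 ≤ p.2 then (p.2 + 1, p.1) else (p.2, p.1 - 1)) ?_ ?_ ?_ ?_
  · rintro ⟨i, j⟩ hp
    by_cases h : i ≤ j
    · simp only [h, if_true]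
      rw [contract_contract h]
      simp only [pow_succ, smul_smul, ← add_smul]
      rw [show (-1 : ℤ) ^ i * -1 * ((-1) ^ j * -1) +
        (-1) ^ j * -1 * -1 * ((-1) ^ i * -1) = 0 by ring, zero_smul]
    · obtain ⟨i, rfl⟩ : ∃ i', i = i' + 1 := ⟨i - 1, by omega⟩
      have h' : j ≤ i := by omega
      simp only [h, if_false, Nat.add_sub_cancel]
      rw [contract_contract h']
      simp only [pow_succ, smul_smul, ← add_smul]
      rw [show (-1 : ℤ) ^ i * -1 * -1 * ((-1) ^ j * -1) +
        (-1) ^ j * -1 * ((-1) ^ i * -1) = 0 by ring, zero_smul]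
  all_goals
    rintro ⟨i, j⟩ hp
    simp only [Finset.mem_product, Finset.mem_range] at hp
    by_cases h : i ≤ j
    · have h2 : ¬ j + 1 ≤ i := by omega
      simp [h, h2]
      try omega
    · have h2 : j ≤ i - 1 := by omega
      have h3 : i - 1 + 1 = i := by omega
      simp [h, h2, h3]
      try omega

/-- The double contractions cancel among themselves. The terms with an outer factor cancel by the
bimodule axioms, after the contractions at the two ends have been split off. -/
lemma dIn_dIn {n : ℕ} (f : CochainIn k A M n) : dIn B (dIn B f) = 0 := by
  refine cochainIn_ext fun a => ?_
  have hc0 : ∀ i, contract (i + 1) a 0 = a 0 := fun i => by simp [contract]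
  have hc00 : contract 0 a 0 = a 0 * a 1 := by simp [contract]
  have hcn : ∀ i ∈ Finset.range n, contract i a n = a (n + 1) := fun i hi => by
    have h1 : ¬ n < i := by have := Finset.mem_range.mp hi; omega
    have h2 : n ≠ i := by have := Finset.mem_range.mp hi; omega
    simp [contract, h1, h2]
  have hcnn : contract n a n = a n * a (n + 1) := by simp [contract]
  have hs0 : shift 1 (contract 0 a) = shift 2 a := shift_contract_lt (by omega) a
  have hs : ∀ i, shift 1 (contract (i + 1) a) = contract i (shift 1 a) := fun i => by
    rw [add_comm i 1, shift_contract_add]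
  have hsn : shift 1 a n = a (n + 1) := by simp [shift, add_comm]
  have hs1 : shift 1 a 0 = a 1 := rfl
  have e0 : ∑ i ∈ Finset.range n, (-1 : ℤ) ^ (i + 1) • (-1 : ℤ) ^ (n + 1) •
      B.r (contract i a n) (evIn f (contract i a)) =
      ∑ i ∈ Finset.range n, (-1 : ℤ) ^ (i + 1) • (-1 : ℤ) ^ (n + 1) •
      B.r (a (n + 1)) (evIn f (contract i a)) :=
    Finset.sum_congr rfl fun i hi => by rw [hcn i hi]
  simp only [evIn_d, smul_add, Finset.sum_add_distrib, sum_contract_contractIn, evIn_zero,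
    shift_shift]
  rw [Finset.sum_range_succ' (fun i => (-1 : ℤ) ^ (i + 1) •
      B.l (contract i a 0) (evIn f (shift 1 (contract i a)))),
    Finset.sum_range_succ (fun i => (-1 : ℤ) ^ (i + 1) • (-1 : ℤ) ^ (n + 1) •
      B.r (contract i a n) (evIn f (contract i a))), e0]
  simp only [hc0, hc00, hcnn, hs0, hs, hsn, hs1, evIn_contract_ge le_rfl]
  have e1 : ∑ i ∈ Finset.range n, (-1 : ℤ) ^ (i + 1 + 1) •
      B.l (a 0) (evIn f (contract i (shift 1 a))) =
      - B.l (a 0) (∑ i ∈ Finset.range n, (-1 : ℤ) ^ (i + 1) • evIn f (contract i (shift 1 a))) := by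
    rw [map_sum, ← Finset.sum_neg_distrib]
    refine Finset.sum_congr rfl fun i _ => ?_
    rw [pow_succ _ (i + 1), mul_neg, mul_one, neg_smul, map_zsmul]
  have e2 : ∑ i ∈ Finset.range n, (-1 : ℤ) ^ (i + 1) • (-1 : ℤ) ^ (n + 1) •
      B.r (a (n + 1)) (evIn f (contract i a)) =
      (-1 : ℤ) ^ (n + 1) • B.r (a (n + 1))
        (∑ i ∈ Finset.range n, (-1 : ℤ) ^ (i + 1) • evIn f (contract i a)) := by
    rw [map_sum, Finset.smul_sum]
    refine Finset.sum_congr rfl fun i _ => ?_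
    rw [smul_comm, map_zsmul]
  rw [e1, e2, pow_succ (-1 : ℤ) (n + 1), pow_succ (-1 : ℤ) n]
  rcases neg_one_pow_eq_or ℤ n with hn | hn <;>
    · simp only [hn, map_add, smul_add, mul_neg, mul_one, neg_smul, one_smul, map_neg,
        neg_neg, pow_succ, pow_zero, B.mul_l, B.mul_r, B.l_r]
      abel

/-- The sequence `c, a₀, a₁, …`. -/
def cons (c : A) (a : ℕ → A) : ℕ → A
  | 0 => c
  | j + 1 => a j

@[simp] lemma cons_zero (c : A) (a : ℕ → A) : cons c a 0 = c := rfl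

@[simp] lemma cons_succ (c : A) (a : ℕ → A) (j : ℕ) : cons c a (j + 1) = a j := rfl

@[simp] lemma shift_succ_cons (m : ℕ) (c : A) (a : ℕ → A) :
    shift (m + 1) (cons c a) = shift m a := by
  funext j
  simp [shift, add_right_comm]

lemma contract_zero_cons (c : A) (a : ℕ → A) :
    contract 0 (cons c a) = cons (c * a 0) (shift 1 a) := by
  funext j
  cases j <;> simp [contract, shift, Nat.add_comm 1]

lemma contract_succ_cons (i : ℕ) (c : A) (a : ℕ → A) :
    contract (i + 1) (cons c a) = cons c (contract i a) := by
  funext j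
  cases j <;> simp [contract]

lemma cons_update (c : A) (a : ℕ → A) (i : ℕ) (z : A) :
    cons c (Function.update a i z) = Function.update (cons c a) (i + 1) z := by
  funext j
  cases j <;> simp [Function.update_apply]

lemma evIn_curryLeft {n : ℕ} (f : CochainIn k A M (n + 1)) (c : A) (a : ℕ → A) :
    evIn (f.curryLeft c) a = evIn f (cons c a) := by
  unfold evIn
  rw [MultilinearMap.curryLeft_apply]
  congr 1
  funext j
  refine Fin.cases ?_ (fun j => ?_) j <;> simp

lemma evIn_uncurryLeft {n : ℕ} (T : A →ₗ[k] CochainIn k A M n) (a : ℕ → A) :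
    evIn (LinearMap.uncurryLeft (M := fun _ : Fin (n + 1) => A) T) a =
      evIn (T (a 0)) (shift 1 a) := by
  unfold evIn
  rw [LinearMap.uncurryLeft_apply]
  congr 1
  funext j
  simp [Fin.tail, shift, add_comm]

/-- A linear family of cochains as a cochain with values in linear maps. -/
def flipIn {n : ℕ} (T : A →ₗ[k] CochainIn k A M n) : CochainIn k A (A →ₗ[k] M) n :=
  ofSeqIn n
    (fun a => { toFun := fun c => evIn (T c) a
                map_add' := fun c c' => by simp
                map_smul' := fun t c => by simp })
    (by
      intro a i hi
      refine ⟨LinearMap.mk₂ k (fun z c => slot (T c) a ⟨i, hi⟩ z) ?_ ?_ ?_ ?_, fun z => ?_⟩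
      · intros; simp
      · intros; simp
      · intros; simp [slot]
      · intros; simp [slot]
      · refine LinearMap.ext fun c => ?_
        simp [evIn_update _ _ hi])

lemma evIn_flipIn {n : ℕ} (T : A →ₗ[k] CochainIn k A M n) (a : ℕ → A) (c : A) :
    evIn (flipIn T) a c = evIn (T c) a := by
  unfold flipIn
  rw [evIn_ofSeqIn]
  · rfl
  · intro a b h
    exact LinearMap.ext fun c => evIn_congr _ h

/-- The coinduced bimodule has no Hochschild cohomology in positive degrees. -/
lemma exists_dIn_coind {n : ℕ} (f : CochainIn k A (A →ₗ[k] M) (n + 1)) (hf : dIn B.coind f = 0) :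
    ∃ g : CochainIn k A (A →ₗ[k] M) n, dIn B.coind g = f := by
  -- The contracting homotopy: `g(a)(c) = f(c, a)(1)`. Since `(c φ)(1) = φ(c)`, the cocycle identity
  -- of `f` on the sequence `c, a`, evaluated at `1`, is the identity to be proved.
  refine ⟨flipIn ((LinearMap.applyₗ (1 : A)).compMultilinearMap f).curryLeft,
    cochainIn_ext fun a => LinearMap.ext fun c => ?_⟩
  have h := congrArg (fun t : CochainIn k A (A →ₗ[k] M) (n + 2) => evIn t (cons c a) 1) hf
  simp only [evIn_d, Finset.sum_range_succ', contract_succ_cons, contract_zero_cons,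
    LinearMap.add_apply, LinearMap.sum_apply, LinearMap.smul_apply, BimoduleAction.coind_l,
    BimoduleAction.coind_r, shift_succ_cons, shift_zero, cons_zero, cons_succ, one_mul,
    evIn_zero, LinearMap.zero_apply] at h
  simp only [evIn_d, LinearMap.add_apply, LinearMap.sum_apply, LinearMap.smul_apply,
    BimoduleAction.coind_l, BimoduleAction.coind_r, evIn_flipIn, evIn_curryLeft, evIn_comp,
    LinearMap.applyₗ_apply_apply]
  simp only [pow_succ, mul_neg, mul_one, neg_smul, Finset.sum_neg_distrib, pow_zero, neg_neg,
    one_smul] at h ⊢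
  rw [← sub_eq_zero, ← neg_eq_zero, ← h]
  abel

end Hochschild
end


noncomputable section

/-! ## The Koszul complex of a quantum exterior algebra

Cochains of the Koszul complex with coefficients in `M` are written as functions
`g : ℕ → ℕ → M`, where `g i j` is the coefficient of `ξⁱ ηʲ`, with `ηξ = q ξη`. -/

namespace Koszul

open Hochschild

variable {k A M M' : Type*} [Field k] [Ring A] [Algebra k A] [AddCommGroup M] [Module k M]
  [AddCommGroup M'] [Module k M']

/-- Left multiplication by `ξ`. -/
def lXi (g : ℕ → ℕ → M) : ℕ → ℕ → M
  | 0, _ => 0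
  | i + 1, j => g i j

/-- Left multiplication by `η`. -/
def lEta (q : k) (g : ℕ → ℕ → M) : ℕ → ℕ → M
  | _, 0 => 0
  | i, j + 1 => q ^ i • g i j

/-- Right multiplication by `ξ`. -/
def rXi (q : k) (g : ℕ → ℕ → M) : ℕ → ℕ → M
  | 0, _ => 0
  | i + 1, j => q ^ j • g i j

/-- Right multiplication by `η`. -/
def rEta (g : ℕ → ℕ → M) : ℕ → ℕ → M
  | _, 0 => 0
  | i, j + 1 => g i j

@[simp] lemma lXi_zero_left (g : ℕ → ℕ → M) (j : ℕ) : lXi g 0 j = 0 := rfl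
@[simp] lemma lXi_succ (g : ℕ → ℕ → M) (i j : ℕ) : lXi g (i + 1) j = g i j := rfl
@[simp] lemma lEta_zero_right (q : k) (g : ℕ → ℕ → M) (i : ℕ) : lEta q g i 0 = 0 := by
  cases i <;> rfl
@[simp] lemma lEta_succ (q : k) (g : ℕ → ℕ → M) (i j : ℕ) :
    lEta q g i (j + 1) = q ^ i • g i j := by cases i <;> rfl
@[simp] lemma rXi_zero_left (q : k) (g : ℕ → ℕ → M) (j : ℕ) : rXi q g 0 j = 0 := rfl
@[simp] lemma rXi_succ (q : k) (g : ℕ → ℕ → M) (i j : ℕ) :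
    rXi q g (i + 1) j = q ^ j • g i j := rfl
@[simp] lemma rEta_zero_right (g : ℕ → ℕ → M) (i : ℕ) : rEta g i 0 = 0 := by cases i <;> rfl
@[simp] lemma rEta_succ (g : ℕ → ℕ → M) (i j : ℕ) : rEta g i (j + 1) = g i j := by
  cases i <;> rfl

/-- A family is supported in degree `n`. -/
def Supported (n : ℕ) (g : ℕ → ℕ → M) : Prop := ∀ i j, i + j ≠ n → g i j = 0

lemma Supported.add {n : ℕ} {g h : ℕ → ℕ → M} (hg : Supported n g) (hh : Supported n h) :
    Supported n (g + h) := fun i j hij => by simp [hg i j hij, hh i j hij]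

lemma Supported.sub {n : ℕ} {g h : ℕ → ℕ → M} (hg : Supported n g) (hh : Supported n h) :
    Supported n (g - h) := fun i j hij => by simp [hg i j hij, hh i j hij]

lemma Supported.smul {n : ℕ} {g : ℕ → ℕ → M} (c : k) (hg : Supported n g) :
    Supported n (c • g) := fun i j hij => by simp [hg i j hij]

lemma supported_zero (n : ℕ) : Supported n (0 : ℕ → ℕ → M) := fun _ _ _ => rfl

lemma Supported.map {n : ℕ} {g : ℕ → ℕ → M} (hg : Supported n g) (p : M →ₗ[k] M') :
    Supported n fun i j => p (g i j) := fun i j hij => by simp [hg i j hij]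

lemma Supported.lXi {n : ℕ} {g : ℕ → ℕ → M} (hg : Supported n g) : Supported (n + 1) (lXi g) := by
  rintro (_ | i) j hij
  · rfl
  · exact hg i j (by omega)

lemma Supported.lEta {n : ℕ} {g : ℕ → ℕ → M} (q : k) (hg : Supported n g) :
    Supported (n + 1) (lEta q g) := by
  rintro i (_ | j) hij
  · simp
  · simp [hg i j (by omega)]

lemma Supported.rXi {n : ℕ} {g : ℕ → ℕ → M} (q : k) (hg : Supported n g) :
    Supported (n + 1) (rXi q g) := by
  rintro (_ | i) j hij
  · rfl
  · simp [hg i j (by omega)]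

lemma Supported.rEta {n : ℕ} {g : ℕ → ℕ → M} (hg : Supported n g) :
    Supported (n + 1) (rEta g) := by
  rintro i (_ | j) hij
  · simp
  · simp [hg i j (by omega)]

variable {q : k} (Q : QuantumFrame A q)

/-- The sum of the values of `F` over all words of length `n` in `x` and `y`: the words with `i`
letters `x` and `j` letters `y`, weighted by the power of `q` that takes the corresponding word in
`ξ` and `η` to `ξⁱ ηʲ`, contribute to the coefficient of `ξⁱ ηʲ`. -/
def wordSum : ℕ → ((ℕ → A) → M) → ℕ → ℕ → M
  | 0, F => fun i j => if i = 0 ∧ j = 0 then F 0 else 0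
  | n + 1, F => lXi (wordSum n fun s => F (cons Q.x s)) +
      lEta q (wordSum n fun s => F (cons Q.y s))

lemma wordSum_supported (n : ℕ) (F : (ℕ → A) → M) : Supported n (wordSum Q n F) := by
  induction n generalizing F with
  | zero =>
    intro i j hij
    have : ¬ (i = 0 ∧ j = 0) := by omega
    simp [wordSum, this]
  | succ n ih => exact (ih _).lXi.add ((ih _).lEta q)

lemma lXi_add (g h : ℕ → ℕ → M) : lXi (g + h) = lXi g + lXi h := by
  ext (_ | i) j <;> simp

lemma lEta_add (g h : ℕ → ℕ → M) : lEta q (g + h) = lEta q g + lEta q h := by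
  ext i (_ | j) <;> simp

lemma wordSum_add (n : ℕ) (F G : (ℕ → A) → M) :
    wordSum Q n (fun s => F s + G s) = wordSum Q n F + wordSum Q n G := by
  induction n generalizing F G with
  | zero => ext i j; by_cases h : i = 0 ∧ j = 0 <;> simp [wordSum, h]
  | succ n ih =>
    simp only [wordSum, ih, lXi_add, lEta_add]
    abel

lemma wordSum_map (p : M →ₗ[k] M') (n : ℕ) (F : (ℕ → A) → M) :
    wordSum Q n (fun s => p (F s)) = fun i j => p (wordSum Q n F i j) := by
  induction n generalizing F with
  | zero =>
    ext i j
    by_cases h : i = 0 ∧ j = 0 <;> simp [wordSum, h]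
  | succ n ih =>
    simp only [wordSum, ih]
    ext (_ | i) (_ | j) <;> simp

lemma wordSum_smul (c : k) (n : ℕ) (F : (ℕ → A) → M) :
    wordSum Q n (fun s => c • F s) = c • wordSum Q n F :=
  wordSum_map Q (LinearMap.lsmul k M c) n F

lemma wordSum_zsmul (c : ℤ) (n : ℕ) (F : (ℕ → A) → M) :
    wordSum Q n (fun s => c • F s) = c • wordSum Q n F := by
  have := wordSum_smul Q (c : k) n F
  simpa only [Int.cast_smul_eq_zsmul] using this

lemma wordSum_zero (n : ℕ) : wordSum Q n (fun _ => (0 : M)) = 0 := by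
  simpa using wordSum_smul Q (0 : k) n (fun _ => (0 : M))

lemma wordSum_sum {ι : Type*} (t : Finset ι) (n : ℕ) (F : ι → (ℕ → A) → M) :
    wordSum Q n (fun s => ∑ i ∈ t, F i s) = ∑ i ∈ t, wordSum Q n (F i) := by
  classical
  induction t using Finset.induction_on with
  | empty => simp [wordSum_zero]
  | insert i t hi ih => simp only [Finset.sum_insert hi, wordSum_add, ih]

/-- Words can be split at the last letter instead of the first, because left and right
multiplications commute. The last letter then acts by multiplication from the right, which is what
the final term of the Hochschild differential needs. -/
lemma wordSum_last (n : ℕ) (F : (ℕ → A) → M) : wordSum Q (n + 1) F =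
    rXi q (wordSum Q n fun s => F (Function.update s n Q.x)) +
      rEta (wordSum Q n fun s => F (Function.update s n Q.y)) := by
  induction n generalizing F with
  | zero =>
    have h : ∀ z : A, cons z 0 = Function.update (0 : ℕ → A) 0 z := by
      intro z; funext j; cases j <;> simp
    ext (_ | i) (_ | j)
    · simp [wordSum]
    · by_cases hj : j = 0 <;> simp [wordSum, h, hj]
    · by_cases hi : i = 0 <;> simp [wordSum, h, hi]
    · simp [wordSum]
  | succ n ih =>
    rw [wordSum, ih, ih]
    simp only [wordSum, cons_update]
    ext (_ | i) (_ | j)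
    · simp
    · cases j <;> simp
    · cases i <;> simp
    · cases i <;> cases j <;> simp [smul_add, smul_smul] <;> module

/-- The contraction at position `i` sees only the product of two adjacent letters. The words with
`xx` or `yy` there contribute nothing. Those with `yx` carry an extra factor `q` compared with `xy`,
as `ηξ = q ξη`, so the defining relation of the algebra cancels them. This is the orthogonality of a
quadratic algebra and its dual. -/
lemma wordSum_contract (i n : ℕ) (hi : i ≤ n) (F : (ℕ → A) → M)
    (hxx : ∀ s, F (Function.update s i (Q.x * Q.x)) = 0)
    (hyy : ∀ s, F (Function.update s i (Q.y * Q.y)) = 0)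
    (hxy : ∀ s, F (Function.update s i (Q.x * Q.y)) +
      q • F (Function.update s i (Q.y * Q.x)) = 0) :
    wordSum Q (n + 2) (fun s => F (contract i s)) = 0 := by
  induction i generalizing n F with
  | zero =>
    have h : ∀ (a b : A) (s : ℕ → A), contract 0 (cons a (cons b s)) =
        Function.update (cons 0 s) 0 (a * b) := by
      intro a b s
      rw [contract_zero_cons]
      funext j
      cases j <;> simp
    have key : wordSum Q n (fun s => F (contract 0 (cons Q.x (cons Q.y s)))) =
        -(q • wordSum Q n fun s => F (contract 0 (cons Q.y (cons Q.x s)))) := by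
      rw [← add_eq_zero_iff_eq_neg, ← wordSum_smul, ← wordSum_add, ← wordSum_zero Q n]
      congr 1
      funext s
      rw [h, h, hxy]
    have kx : wordSum Q n (fun s => F (contract 0 (cons Q.x (cons Q.x s)))) = 0 := by
      rw [← wordSum_zero Q n]
      congr 1
      funext s
      rw [h, hxx]
    have ky : wordSum Q n (fun s => F (contract 0 (cons Q.y (cons Q.y s)))) = 0 := by
      rw [← wordSum_zero Q n]
      congr 1
      funext s
      rw [h, hyy]
    simp only [wordSum, key, kx, ky]
    ext (_ | i) (_ | j)
    · simp
    · cases j <;> simp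
    · cases i <;> simp
    · cases i <;> cases j <;> simp [smul_smul, pow_succ, mul_comm]
  | succ i ih =>
    obtain ⟨n, rfl⟩ : ∃ m, n = m + 1 := ⟨n - 1, by omega⟩
    rw [wordSum]
    simp only [contract_succ_cons]
    rw [ih n (by omega) (fun s => F (cons Q.x s)), ih n (by omega) (fun s => F (cons Q.y s))]
    · ext (_ | i) (_ | j) <;> simp
    all_goals
      intro s
      simp only [cons_update, hxx, hyy, hxy]

/-- The restriction of a Hochschild cochain to the Koszul complex. -/
def restrict {n : ℕ} (f : CochainIn k A M n) : ℕ → ℕ → M := wordSum Q n (evIn f)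

lemma restrict_supported {n : ℕ} (f : CochainIn k A M n) : Supported n (restrict Q f) :=
  wordSum_supported Q n _

lemma restrict_add {n : ℕ} (f g : CochainIn k A M n) :
    restrict Q (f + g) = restrict Q f + restrict Q g := wordSum_add Q n _ _

lemma restrict_smul {n : ℕ} (c : k) (f : CochainIn k A M n) :
    restrict Q (c • f) = c • restrict Q f := wordSum_smul Q c n _

lemma restrict_sub {n : ℕ} (f g : CochainIn k A M n) :
    restrict Q (f - g) = restrict Q f - restrict Q g := by
  rw [sub_eq_add_neg, ← neg_one_smul k g, restrict_add, restrict_smul, neg_one_smul,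
    ← sub_eq_add_neg]

lemma restrict_comp {n : ℕ} (p : M →ₗ[k] M') (f : CochainIn k A M n) :
    restrict Q (p.compMultilinearMap f) = fun i j => p (restrict Q f i j) :=
  wordSum_map Q p n _

variable (B : BimoduleAction k A M)

/-- The differential of the Koszul complex in degree `n`: the graded commutator with
`x ⊗ ξ + y ⊗ η`. -/
def dK (n : ℕ) (g : ℕ → ℕ → M) : ℕ → ℕ → M :=
  lXi (fun i j => B.l Q.x (g i j)) + lEta q (fun i j => B.l Q.y (g i j)) +
    (-1 : k) ^ (n + 1) • (rXi q (fun i j => B.r Q.x (g i j)) + rEta fun i j => B.r Q.y (g i j))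

/-- The inner terms vanish by `wordSum_contract`. The first and last terms give the left and right
multiplications by `x ⊗ ξ + y ⊗ η`. -/
lemma restrict_dIn {n : ℕ} (f : CochainIn k A M n) :
    restrict Q (dIn B f) = dK Q B n (restrict Q f) := by
  have e : evIn (dIn B f) = fun a => (B.l (a 0) (evIn f (shift 1 a))
      + ∑ i ∈ Finset.range n, (-1 : ℤ) ^ (i + 1) • evIn f (contract i a))
      + (-1 : k) ^ (n + 1) • B.r (a n) (evIn f a) := by
    funext a
    rw [evIn_d, ← Int.cast_smul_eq_zsmul k]
    simp
  unfold restrict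
  rw [e, wordSum_add, wordSum_add, wordSum_sum, Finset.sum_eq_zero, add_zero, wordSum_smul]
  · rw [wordSum_last Q n fun a => B.r (a n) (evIn f a), dK, wordSum]
    simp only [cons_zero, shift_succ_cons, shift_zero, Function.update_self,
      evIn_update_ge f _ le_rfl, wordSum_map]
  · intro i hi
    have hi' := Finset.mem_range.mp hi
    obtain ⟨n, rfl⟩ : ∃ m, n = m + 1 := ⟨n - 1, by omega⟩
    rw [wordSum_zsmul, wordSum_contract Q i n (by omega), smul_zero]
    · intro s; simp [evIn_update _ _ hi']
    · intro s; simp [evIn_update _ _ hi']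
    · intro s; simp [evIn_update _ _ hi', Q.xy]

/-- The part of `ξ⁻¹ g` with nonnegative exponents. -/
def divXi (g : ℕ → ℕ → M) : ℕ → ℕ → M := fun i j => g (i + 1) j

/-- The part of `η⁻¹ g` that involves only powers of `η`. -/
def divEta (g : ℕ → ℕ → M) : ℕ → ℕ → M := fun i j => if i = 0 then g 0 (j + 1) else 0

/-- A monomial of positive degree is divisible by `ξ` or is a pure power of `η`. On the latter the
factor `qⁱ` of `lEta` is `1`, so nothing is divided by `q` and `q = 0` is allowed. -/
lemma lXi_divXi_add {n : ℕ} {g : ℕ → ℕ → M} (hg : Supported (n + 1) g) :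
    lXi (divXi g) + lEta q (divEta g) = g := by
  ext (_ | i) (_ | j) <;> simp [divXi, divEta]
  exact (hg 0 0 (by omega)).symm

lemma Supported.divXi {n : ℕ} {g : ℕ → ℕ → M} (hg : Supported (n + 1) g) :
    Supported n (divXi g) := fun i j hij => hg _ _ (by omega)

lemma Supported.divEta {n : ℕ} {g : ℕ → ℕ → M} (hg : Supported (n + 1) g) :
    Supported n (divEta g) := by
  intro i j hij
  by_cases h : i = 0
  · subst h; exact hg _ _ (by omega)
  · simp [Koszul.divEta, h]

/-- The lift is built letter by letter: its first entry is read through the coordinates `cx` and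
`cy`, which pick out the words that begin with `x` and with `y`. -/
lemma exists_restrict_eq (n : ℕ) {g : ℕ → ℕ → M} (hg : Supported n g) :
    ∃ f : CochainIn k A M n, restrict Q f = g := by
  induction n generalizing g with
  | zero =>
    refine ⟨MultilinearMap.constOfIsEmpty k _ (g 0 0), ?_⟩
    ext i j
    by_cases h : i = 0 ∧ j = 0
    · obtain ⟨rfl, rfl⟩ := h
      simp [restrict, wordSum, evIn]
    · simp [restrict, wordSum, h, hg i j (by omega)]
  | succ n ih =>
    obtain ⟨f₁, h₁⟩ := ih hg.divXi
    obtain ⟨f₂, h₂⟩ := ih hg.divEta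
    refine ⟨LinearMap.uncurryLeft (M := fun _ : Fin (n + 1) => A)
      (Q.cx.smulRight f₁ + Q.cy.smulRight f₂), ?_⟩
    unfold restrict at *
    rw [wordSum]
    simp only [evIn_uncurryLeft, cons_zero, shift_succ_cons, shift_zero, LinearMap.add_apply,
      LinearMap.smulRight_apply, QuantumFrame.cx_x, QuantumFrame.cx_y, QuantumFrame.cy_x,
      QuantumFrame.cy_y, one_smul, zero_smul, add_zero, zero_add]
    change lXi (wordSum Q n (evIn f₁)) + lEta q (wordSum Q n (evIn f₂)) = g
    rw [h₁, h₂, lXi_divXi_add hg]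

/-- Inherited from the Hochschild complex, since restriction is onto and commutes with the
differentials. -/
lemma dK_dK {n : ℕ} {g : ℕ → ℕ → M} (hg : Supported n g) :
    dK Q B (n + 1) (dK Q B n g) = 0 := by
  obtain ⟨f, rfl⟩ := exists_restrict_eq Q n hg
  rw [← restrict_dIn, ← restrict_dIn, dIn_dIn]
  exact wordSum_zero Q _

lemma dK_supported {n : ℕ} {g : ℕ → ℕ → M} (hg : Supported n g) :
    Supported (n + 1) (dK Q B n g) :=
  ((hg.map _).lXi.add ((hg.map _).lEta q)).add
    ((((hg.map _).rXi q).add (hg.map _).rEta).smul _)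

lemma dK_sub (n : ℕ) (g h : ℕ → ℕ → M) : dK Q B n (g - h) = dK Q B n g - dK Q B n h := by
  ext (_ | i) (_ | j) <;> simp [dK, smul_sub, smul_add] <;> abel

lemma dK_add (n : ℕ) (g h : ℕ → ℕ → M) : dK Q B n (g + h) = dK Q B n g + dK Q B n h := by
  ext (_ | i) (_ | j) <;> simp [dK, smul_add] <;> abel

lemma dK_smul (n : ℕ) (c : k) (g : ℕ → ℕ → M) : dK Q B n (c • g) = c • dK Q B n g := by
  ext (_ | i) (_ | j) <;> simp [dK, smul_add, smul_comm c]

end Koszul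
end


/-! ### Comparison of the Hochschild and Koszul complexes by dimension shifting -/

noncomputable section

namespace Koszul

open Hochschild

section Comparison

universe v u

variable {k : Type v} {A M : Type u} [Field k] [Ring A] [Algebra k A] [AddCommGroup M] [Module k M]
  {q : k} (Q : QuantumFrame A q) (B : BimoduleAction k A M)

lemma dK_coind_apply (n : ℕ) (g : ℕ → ℕ → A →ₗ[k] M) (i j : ℕ) (c : A) :
    dK Q B.coind n g i j c = lXi (fun i j => g i j (c * Q.x)) i j +
      lEta q (fun i j => g i j (c * Q.y)) i j +
      (-1 : k) ^ (n + 1) • (rXi q (fun i j => B.r Q.x (g i j c)) i j +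
        rEta (fun i j => B.r Q.y (g i j c)) i j) := by
  rcases i with _ | i <;> rcases j with _ | j <;> simp [dK]

/-- The Koszul complex with coefficients in a coinduced bimodule is exact in positive degrees. -/
lemma exists_dK_coind {n : ℕ} {g : ℕ → ℕ → A →ₗ[k] M} (hg : Supported (n + 1) g)
    (hd : dK Q B.coind (n + 1) g = 0) : ∃ p, Supported n p ∧ dK Q B.coind n p = g := by
  have hs : ∀ {t : ℕ} {h : ℕ → ℕ → A →ₗ[k] M} (c : A), Supported t h →
      Supported t fun i j => h i j c := fun c h i j hij => by simp [h i j hij]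
  -- First correction, making the value at `1` zero. As `p₁` vanishes at `1`, the value of its
  -- differential there is `ξ p₁(x) + η p₁(y)`, which is the decomposition of `g(1)` given by
  -- `lXi_divXi_add`.
  let p₁ : ℕ → ℕ → A →ₗ[k] M := fun i j => Q.cx.smulRight (divXi (fun i j => g i j 1) i j) +
    Q.cy.smulRight (divEta (fun i j => g i j 1) i j)
  have hp₁ : Supported n p₁ := fun i j hij => by
    simp only [p₁, (hs 1 hg).divXi i j hij, (hs 1 hg).divEta i j hij]
    simp
  let g' := g - dK Q B.coind n p₁
  have hg' : Supported (n + 1) g' := hg.sub (dK_supported Q _ hp₁)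
  have hd' : dK Q B.coind (n + 1) g' = 0 := by
    rw [dK_sub, hd, dK_dK Q _ hp₁, sub_zero]
  have h1 : ∀ i j, g' i j 1 = 0 := by
    intro i j
    have h := congrFun₂ (lXi_divXi_add (q := q) (hs 1 hg)) i j
    change g i j 1 - dK Q B.coind n p₁ i j 1 = 0
    rw [dK_coind_apply, ← h]
    rcases i with _ | i <;> rcases j with _ | j <;> simp [p₁]
  -- With `g'(1) = 0`, the cocycle condition at `1` reads `ξ g'(x) + η g'(y) = 0`.
  have e1 : ∀ i j, lXi (fun i j => g' i j Q.x) i j + lEta q (fun i j => g' i j Q.y) i j = 0 := by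
    intro i j
    have h := congrArg (fun f => f 1) (congrFun₂ hd' i j)
    simp only [dK_coind_apply, h1, one_mul] at h
    rw [← LinearMap.zero_apply (1 : A) (σ₁₂ := RingHom.id k) (M₂ := M)]
    refine Eq.trans ?_ h
    rcases i with _ | i <;> rcases j with _ | j <;> simp
  -- This syzygy forces `g'(y) = ξ r` and, by `ηξ = q ξη`, also `g'(x) = -q η r`.
  let r : ℕ → ℕ → M := divXi fun i j => g' i j Q.y
  have hy0 : ∀ j, g' 0 j Q.y = 0 := fun j => by simpa using e1 0 (j + 1)
  have hx : ∀ i j, g' i j Q.x = (-q) • lEta q r i j := by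
    intro i j
    have h := e1 (i + 1) j
    rw [lXi_succ, add_eq_zero_iff_eq_neg] at h
    rw [h]
    rcases j with _ | j
    · simp
    · simp [r, divXi, pow_succ', smul_smul]
  -- Second correction, supported on `yx`. Its differential takes the value `-q η r` at `x`, from
  -- `xy = -q yx`, and the value `ξ r` at `y`.
  let p₂ : ℕ → ℕ → A →ₗ[k] M := fun i j => Q.cz.smulRight (r i j)
  have hp₂ : Supported n p₂ := fun i j hij => by
    simp only [p₂, r, (hs Q.y hg').divXi i j hij]
    simp
  let g'' := g' - dK Q B.coind n p₂
  have hd'' : dK Q B.coind (n + 1) g'' = 0 := by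
    rw [dK_sub, hd', dK_dK Q _ hp₂, sub_zero]
  have h1'' : ∀ i j, g'' i j 1 = 0 := by
    intro i j
    change g' i j 1 - dK Q B.coind n p₂ i j 1 = 0
    rw [dK_coind_apply, h1]
    rcases i with _ | i <;> rcases j with _ | j <;> simp [p₂]
  have hx'' : ∀ i j, g'' i j Q.x = 0 := by
    intro i j
    change g' i j Q.x - dK Q B.coind n p₂ i j Q.x = 0
    rw [dK_coind_apply, hx]
    rcases i with _ | i <;> rcases j with _ | j <;> simp [p₂, Q.xy, smul_comm q]
  have hy'' : ∀ i j, g'' i j Q.y = 0 := by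
    intro i j
    change g' i j Q.y - dK Q B.coind n p₂ i j Q.y = 0
    rw [dK_coind_apply]
    rcases i with _ | i <;> rcases j with _ | j <;> simp [p₂, hy0, r, divXi]
  have hz'' : ∀ i j, g'' i j (Q.y * Q.x) = 0 := by
    intro i j
    -- The cocycle condition at `y` reduces to `ξ g''(yx) = 0`, because `y² = 0` and `g''(y) = 0`.
    -- Left multiplication by `ξ` is injective.
    have h := congrArg (fun f => f Q.y) (congrFun₂ hd'' (i + 1) j)
    simp only [dK_coind_apply, hy''] at h
    rcases j with _ | j <;> simpa using h
  have h0 : g'' = 0 := by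
    ext i j : 2
    exact Q.linearMap_ext (by simpa using h1'' i j) (by simpa using hx'' i j)
      (by simpa using hy'' i j) (by simpa using hz'' i j)
  refine ⟨p₁ + p₂, hp₁.add hp₂, ?_⟩
  rw [dK_add]
  have : g - dK Q B.coind n p₁ - dK Q B.coind n p₂ = 0 := h0
  rw [sub_sub, sub_eq_zero] at this
  exact this.symm

/-- A cocycle of degree one is a derivation, hence determined by its values at `x` and `y`, and
these are its coefficients in the Koszul complex. -/
lemma eq_zero_of_restrict_eq_zero (f : CochainIn k A M 1) (hd : dIn B f = 0)
    (hf : restrict Q f = 0) : f = 0 := by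
  have hx : evIn f (cons Q.x 0) = 0 := by
    simpa [restrict, wordSum] using congrFun₂ hf 1 0
  have hy : evIn f (cons Q.y 0) = 0 := by
    simpa [restrict, wordSum] using congrFun₂ hf 0 1
  have hu : ∀ a, evIn f a = slot f 0 0 (a 0) := fun a => by
    refine Eq.trans ?_ (evIn_update f 0 Nat.zero_lt_one (a 0))
    exact evIn_congr f fun i hi => by obtain rfl : i = 0 := by omega
                                      simp
  have hder : ∀ a b, slot f 0 0 (a * b) = B.l a (slot f 0 0 b) + B.r b (slot f 0 0 a) := by
    intro a b
    have h := congrArg (fun t : CochainIn k A M 2 => evIn t (cons a (cons b 0))) hd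
    simp only [evIn_d, hu, evIn_zero] at h
    simp [contract, shift] at h
    rw [add_right_comm, add_neg_eq_zero] at h
    exact h.symm
  rw [hu, cons_zero] at hx hy
  have h1 : slot f 0 0 1 = 0 := by simpa [B.one_l, B.one_r] using hder 1 1
  have h0 : slot f 0 0 = 0 := Q.linearMap_ext (by simpa using h1) (by simpa using hx)
    (by simpa using hy) (by simp [hder, hx, hy])
  exact cochainIn_ext fun a => by rw [hu, h0]; rfl

/-- A cocycle that vanishes on the Koszul complex is the differential of a cochain that vanishes
on the Koszul complex. -/
theorem exists_dIn_of_restrict_eq_zero (n : ℕ) {M : Type u} [AddCommGroup M] [Module k M]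
    (B : BimoduleAction k A M) (f : CochainIn k A M (n + 1)) (hd : dIn B f = 0)
    (hf : restrict Q f = 0) : ∃ g : CochainIn k A M n, dIn B g = f ∧ restrict Q g = 0 := by
  induction n generalizing M with
  | zero =>
    refine ⟨0, ?_, wordSum_zero Q _⟩
    rw [eq_zero_of_restrict_eq_zero Q B f hd hf, dIn_zero]
  | succ n ih =>
    have hιl : ∀ a m, B.toCoind (B.l a m) = B.coind.l a (B.toCoind m) := fun a m =>
      LinearMap.ext fun c => by simp [B.mul_l]
    have hιr : ∀ a m, B.toCoind (B.r a m) = B.coind.r a (B.toCoind m) := fun a m =>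
      LinearMap.ext fun c => by simp [B.l_r]
    -- The exact sequence `0 → M → Hom_k(A, M) → C → 0` of bimodules. The induction hypothesis is
    -- applied to `C`, in one degree less.
    let N : Submodule k (A →ₗ[k] M) := LinearMap.range B.toCoind
    let B' := B.coind.quotient N (by rintro a _ ⟨m, rfl⟩; exact ⟨_, hιl a m⟩)
      (by rintro a _ ⟨m, rfl⟩; exact ⟨_, hιr a m⟩)
    have hπl : ∀ a φ, N.mkQ (B.coind.l a φ) = B'.l a (N.mkQ φ) := fun _ _ => rfl
    have hπr : ∀ a φ, N.mkQ (B.coind.r a φ) = B'.r a (N.mkQ φ) := fun _ _ => rfl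
    have hιf : dIn B.coind (B.toCoind.compMultilinearMap f) = 0 := by
      rw [dIn_comp B B.coind _ hιl hιr, hd]
      exact cochainIn_ext fun a => by simp
    have hριf : restrict Q (B.toCoind.compMultilinearMap f) = 0 := by
      rw [restrict_comp, hf]; ext i j : 2; simp
    -- In the coinduced bimodule `f` becomes the differential of some `g`. The restriction of `g` is
    -- a Koszul cocycle of positive degree, hence a boundary, and lifting a primitive of it corrects
    -- `g` to vanish on the Koszul complex.
    obtain ⟨g, hg⟩ := exists_dIn_coind B _ hιf
    obtain ⟨κ, hκ, hκg⟩ := exists_dK_coind Q B (restrict_supported Q g)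
      (by rw [← restrict_dIn, hg, hριf])
    obtain ⟨c, rfl⟩ := exists_restrict_eq Q n hκ
    have hg₁ : dIn B.coind (g - dIn B.coind c) = B.toCoind.compMultilinearMap f := by
      rw [dIn_sub, hg, dIn_dIn, sub_zero]
    have hρg₁ : restrict Q (g - dIn B.coind c) = 0 := by
      rw [restrict_sub, restrict_dIn, hκg, sub_self]
    generalize g - dIn B.coind c = g₁ at hg₁ hρg₁
    -- The image of `g₁` in `C` is a cocycle, since its differential comes from `M`, and it vanishes
    -- on the Koszul complex.
    obtain ⟨e, he, hρe⟩ := ih B' (N.mkQ.compMultilinearMap g₁)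
      (by
        rw [dIn_comp B.coind B' _ hπl hπr, hg₁]
        exact cochainIn_ext fun a => by
          simp only [evIn_comp, evIn_zero]
          exact (Submodule.Quotient.mk_eq_zero _).mpr ⟨_, rfl⟩)
      (by rw [restrict_comp, hρg₁]; ext i j : 2; simp)
    -- A `k`-linear section is enough to lift the cochain `e`. Subtracting the differential of the
    -- lift from `g₁` leaves a cochain with values in `M`.
    obtain ⟨s, hs⟩ := N.mkQ.exists_rightInverse_of_surjective N.range_mkQ
    have hρg₂ : restrict Q (g₁ - dIn B.coind (s.compMultilinearMap e)) = 0 := by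
      have : restrict Q (s.compMultilinearMap e) = 0 := by
        rw [restrict_comp, hρe]; ext i j : 2; simp
      rw [restrict_sub, restrict_dIn, hρg₁, this, zero_sub, neg_eq_zero]
      simpa using dK_sub Q B.coind n 0 0
    have hg₂ : dIn B.coind (g₁ - dIn B.coind (s.compMultilinearMap e)) =
        B.toCoind.compMultilinearMap f := by
      rw [dIn_sub, hg₁, dIn_dIn, sub_zero]
    have hπg₂ : N.mkQ.compMultilinearMap (g₁ - dIn B.coind (s.compMultilinearMap e)) = 0 := by
      have h1 : N.mkQ.compMultilinearMap (s.compMultilinearMap e) = e :=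
        cochainIn_ext fun a => by simpa using LinearMap.congr_fun hs (evIn e a)
      have h2 := dIn_comp B.coind B' _ hπl hπr (s.compMultilinearMap e)
      rw [h1, he] at h2
      exact cochainIn_ext fun a => by
        have := congrArg (fun t => evIn t a) h2
        simp only [evIn_comp] at this
        simp only [evIn_comp, evIn_sub, map_sub, this, sub_self, evIn_zero]
    generalize g₁ - dIn B.coind (s.compMultilinearMap e) = g₂ at hρg₂ hg₂ hπg₂
    -- Evaluation at `1` inverts the embedding of `M` on its image.
    let h : CochainIn k A M (n + 1) := (LinearMap.applyₗ (1 : A)).compMultilinearMap g₂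
    have hh : B.toCoind.compMultilinearMap h = g₂ := cochainIn_ext fun a => by
      have := congrArg (fun t => evIn t a) hπg₂
      simp only [evIn_comp, evIn_zero] at this
      obtain ⟨m, hm⟩ := (Submodule.Quotient.mk_eq_zero N).mp this
      simp only [h, evIn_comp, ← hm]
      congr 1
      simp [B.one_l]
    refine ⟨h, cochainIn_ext fun a => ?_, ?_⟩
    · rw [← hh, dIn_comp B B.coind _ hιl hιr] at hg₂
      have := congrArg (fun t : CochainIn k A (A →ₗ[k] M) (n + 2) => evIn t a (1 : A)) hg₂
      simpa [B.one_l] using this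
    · rw [restrict_comp, hρg₂]
      ext i j
      simp

end Comparison

end Koszul
end


noncomputable section

/-! ## Hochschild cohomology in terms of the Koszul complex -/

namespace Koszul

open Hochschild Finset

universe v u

variable {k : Type v} {A : Type u} [Field k] [Ring A] [Algebra k A] {q : k}

variable (q) in
/-- The product of the Koszul complex: multiplication in `A ⊗ k⟨ξ, η⟩ / (ηξ - q ξη)`. -/
def kmul (g h : ℕ → ℕ → A) : ℕ → ℕ → A := fun i j =>
  ∑ p ∈ antidiagonal i, ∑ r ∈ antidiagonal j, q ^ (r.1 * p.2) • (g p.1 r.1 * h p.2 r.2)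

lemma kmul_add_left (g g' h : ℕ → ℕ → A) : kmul q (g + g') h = kmul q g h + kmul q g' h := by
  ext i j
  simp [kmul, add_mul, sum_add_distrib]

lemma kmul_lXi (g h : ℕ → ℕ → A) : kmul q (lXi g) h = lXi (kmul q g h) := by
  ext (_ | i) j
  · simp [kmul]
  · simp [kmul, Nat.sum_antidiagonal_succ]

lemma kmul_lEta (g h : ℕ → ℕ → A) : kmul q (lEta q g) h = lEta q (kmul q g h) := by
  ext i (_ | j)
  · simp [kmul]
  · simp only [kmul, Nat.sum_antidiagonal_succ, lEta_zero_right, zero_mul, smul_zero, zero_add,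
      lEta_succ, smul_sum]
    refine sum_congr rfl fun p hp => sum_congr rfl fun r _ => ?_
    rw [smul_mul_assoc, smul_smul, smul_smul, ← mem_antidiagonal.mp hp]
    congr 1
    ring

variable (Q : QuantumFrame A q)

/-- A word of length `m + n` splits uniquely into its first `m` letters and the rest, and the
weights multiply. The condition on `F` makes it a constant when `m = 0`. -/
lemma wordSum_cup (m n : ℕ) (F G : (ℕ → A) → A)
    (hF : ∀ a b : ℕ → A, (∀ i < m, a i = b i) → F a = F b) :
    wordSum Q (m + n) (fun s => F s * G (shift m s)) =
      kmul q (wordSum Q m F) (wordSum Q n G) := by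
  induction m generalizing F with
  | zero =>
    have : (fun s => F s * G (shift 0 s)) = fun s => LinearMap.mulLeft k (F 0) (G s) := by
      funext s
      rw [hF s 0 (by simp), shift_zero]
      rfl
    rw [this, Nat.zero_add, wordSum_map]
    ext i j
    rw [kmul, sum_eq_single (0, i), sum_eq_single (0, j)]
    · simp [wordSum]
    · rintro ⟨a, b⟩ h hne
      have : a ≠ 0 := by rintro rfl; simp_all
      simp [wordSum, this]
    · simp
    · rintro ⟨a, b⟩ h hne
      have : a ≠ 0 := by rintro rfl; simp_all
      simp [wordSum, this]
    · simp
  | succ m ih =>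
    rw [Nat.add_right_comm, wordSum, wordSum]
    simp only [shift_succ_cons]
    rw [ih (fun s => F (cons Q.x s)), ih (fun s => F (cons Q.y s)), kmul_add_left, kmul_lXi,
      kmul_lEta]
    all_goals
      intro a b h
      refine hF _ _ fun i hi => ?_
      rcases i with _ | i
      · rfl
      · exact h i (by omega)

/-- The differential of the Koszul complex with coefficients in `A`. -/
abbrev dA (n : ℕ) (g : ℕ → ℕ → A) : ℕ → ℕ → A := dK Q (BimoduleAction.self k A) n g

/-- The cocycles of degree `n` of the Koszul complex. -/
def koszulCocycles (n : ℕ) : Submodule k (ℕ → ℕ → A) where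
  carrier := {g | Supported n g ∧ dA Q n g = 0}
  add_mem' := fun ha hb => ⟨ha.1.add hb.1, (dK_add Q _ n _ _).trans
    ((congrArg₂ (· + ·) ha.2 hb.2).trans (add_zero _))⟩
  zero_mem' := ⟨supported_zero n, by simpa using dK_smul Q (BimoduleAction.self k A) n 0 0⟩
  smul_mem' := fun c g hg => ⟨hg.1.smul c, (dK_smul Q _ n c g).trans
    ((congrArg (c • ·) hg.2).trans (smul_zero c))⟩

/-- The boundaries of degree `n` of the Koszul complex. -/
def IsKoszulBoundary : (n : ℕ) → (ℕ → ℕ → A) → Prop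
  | 0, g => g = 0
  | n + 1, g => ∃ p, Supported n p ∧ dA Q n p = g

/-- A Hochschild cochain of `A` as a cochain with coefficients in the bimodule `A`. -/
def toIn {n : ℕ} (f : Cochain k A n) : CochainIn k A A n := f

lemma evIn_toIn {n : ℕ} (f : Cochain k A n) (a : ℕ → A) : evIn (toIn f) a = ev f a := rfl

lemma toIn_d {n : ℕ} (f : Cochain k A n) :
    toIn (d k A n f) = dIn (BimoduleAction.self k A) (toIn f) :=
  cochainIn_ext fun a => by rw [evIn_toIn, ev_d, evIn_d]; rfl

/-- If the restriction of `f` is a boundary, lift a primitive to a Hochschild cochain `b`. Then `f -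
db` is a cocycle that vanishes on the Koszul complex, hence a coboundary. -/
lemma mem_coboundaries_iff {n : ℕ} {f : Cochain k A n} (hf : f ∈ cocycles k A n) :
    f ∈ coboundaries k A n ↔ IsKoszulBoundary Q n (restrict Q (toIn f)) := by
  cases n with
  | zero =>
    change f = 0 ↔ restrict Q (toIn f) = 0
    refine ⟨fun h => h ▸ wordSum_zero Q 0, fun h => cochain_ext fun a => ?_⟩
    have h0 : evIn (toIn f) 0 = 0 := by simpa [restrict, wordSum] using congrFun₂ h 0 0
    exact (ev_congr f (b := 0) (by simp)).trans h0
  | succ n =>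
    constructor
    · rintro ⟨b, rfl⟩
      exact ⟨_, restrict_supported Q (toIn b), by rw [toIn_d, restrict_dIn]⟩
    · rintro ⟨p, hp, hpf⟩
      obtain ⟨b, rfl⟩ := exists_restrict_eq Q n hp
      have hdf : dIn (BimoduleAction.self k A) (toIn f) = 0 := by
        rw [← toIn_d, LinearMap.mem_ker.mp hf]
        rfl
      obtain ⟨g, hg, -⟩ := exists_dIn_of_restrict_eq_zero Q n (BimoduleAction.self k A)
        (toIn f - dIn _ b) (by rw [dIn_sub, hdf, dIn_dIn, sub_zero])
        (by rw [restrict_sub, restrict_dIn, ← hpf, sub_self])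
      refine ⟨(g + b : CochainIn k A A n), ?_⟩
      have h := sub_eq_iff_eq_add.mp hg.symm
      have h2 : dIn (BimoduleAction.self k A) (g + b) = toIn f := by
        rw [h, ← sub_eq_iff_eq_add, ← dIn_sub, add_sub_cancel_right]
      exact (toIn_d _).trans h2

/-- The restriction of Hochschild cocycles to the Koszul complex. -/
def restrictZ (n : ℕ) : cocycles k A n →ₗ[k] koszulCocycles Q n where
  toFun f := ⟨restrict Q (toIn f.1), restrict_supported Q _, by
    rw [dA, ← restrict_dIn, ← toIn_d, LinearMap.mem_ker.mp f.2]
    exact wordSum_zero Q _⟩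
  map_add' f g := Subtype.ext (restrict_add Q _ _)
  map_smul' c f := Subtype.ext (restrict_smul Q c _)

/-- A lift `f` of a Koszul cocycle need not be closed, but `df` vanishes on the Koszul complex. So
`df = db` with `b` vanishing there too, and `f - b` is closed with the same restriction. -/
lemma restrictZ_surjective (n : ℕ) : Function.Surjective (restrictZ Q n) := by
  rintro ⟨g, hg, hd⟩
  obtain ⟨f, rfl⟩ := exists_restrict_eq Q n hg
  obtain ⟨b, hb, hρ⟩ := exists_dIn_of_restrict_eq_zero Q n (BimoduleAction.self k A) (dIn _ f)
    (dIn_dIn _ f) (by rw [restrict_dIn, ← hd])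
  refine ⟨⟨(f - b : CochainIn k A A n), ?_⟩, Subtype.ext ?_⟩
  · refine LinearMap.mem_ker.mpr ?_
    refine (toIn_d _).trans ((dIn_sub _ f b).trans ?_)
    rw [hb, sub_self]
    rfl
  · exact (restrict_sub Q f b).trans (by rw [hρ, sub_zero])

/-- The Hochschild class of a cocycle of the Koszul complex. -/
def hcls (n : ℕ) : koszulCocycles Q n →ₗ[k] HH k A n :=
  ((LinearMap.ker (restrictZ Q n)).liftQ (Submodule.mkQ _) (by
    intro f hf
    rw [LinearMap.mem_ker] at hf ⊢
    refine (Submodule.Quotient.mk_eq_zero _).mpr ((mem_coboundaries_iff Q f.2).mpr ?_)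
    have h : restrict Q (toIn f.1) = 0 := congrArg Subtype.val hf
    rw [h]
    cases n with
    | zero => rfl
    | succ n => exact ⟨0, supported_zero n, by
        simpa using dK_smul Q (BimoduleAction.self k A) n 0 0⟩)).comp
    ((restrictZ Q n).quotKerEquivOfSurjective (restrictZ_surjective Q n)).symm.toLinearMap

lemma hcls_restrictZ {n : ℕ} (f : cocycles k A n) : hcls Q n (restrictZ Q n f) = cls f := by
  have h : ((restrictZ Q n).quotKerEquivOfSurjective (restrictZ_surjective Q n)).symm
      (restrictZ Q n f) = Submodule.Quotient.mk f := by
    rw [LinearEquiv.symm_apply_eq]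
    rfl
  simp only [hcls, LinearMap.comp_apply, LinearEquiv.coe_coe, h]
  rfl

lemma hcls_surjective (n : ℕ) : Function.Surjective (hcls Q n) := fun x => by
  obtain ⟨f, rfl⟩ := exists_cls x
  exact ⟨_, hcls_restrictZ Q f⟩

lemma hcls_eq_zero_iff {n : ℕ} (g : koszulCocycles Q n) :
    hcls Q n g = 0 ↔ IsKoszulBoundary Q n g.1 := by
  obtain ⟨f, rfl⟩ := restrictZ_surjective Q n g
  rw [hcls_restrictZ]
  exact (Submodule.Quotient.mk_eq_zero _).trans (mem_coboundaries_iff Q f.2)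

lemma restrict_cup {m n : ℕ} (f : Cochain k A m) (g : Cochain k A n) :
    restrict Q (toIn (cup f g)) = kmul q (restrict Q (toIn f)) (restrict Q (toIn g)) := by
  have : evIn (toIn (cup f g)) = fun s => ev f s * ev g (shift m s) := by
    funext s
    rw [evIn_toIn, ev_cup]
  rw [restrict, this]
  exact wordSum_cup Q m n _ _ fun a b h => ev_congr f h

/-- Follows from the cup product of Hochschild cocycles, so no Leibniz rule for the Koszul complex
is needed. -/
lemma kmul_mem {m n : ℕ} {g h : ℕ → ℕ → A} (hg : g ∈ koszulCocycles Q m)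
    (hh : h ∈ koszulCocycles Q n) : kmul q g h ∈ koszulCocycles Q (m + n) := by
  obtain ⟨f, hf⟩ := restrictZ_surjective Q m ⟨g, hg⟩
  obtain ⟨f', hf'⟩ := restrictZ_surjective Q n ⟨h, hh⟩
  obtain rfl : restrict Q (toIn f.1) = g := congrArg Subtype.val hf
  obtain rfl : restrict Q (toIn f'.1) = h := congrArg Subtype.val hf'
  rw [← restrict_cup]
  exact (restrictZ Q (m + n) ⟨_, cup_mem_cocycles f.2 f'.2⟩).2

/-- The class of a cocycle of the Koszul complex in the Hochschild cohomology ring. -/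
def rcls (n : ℕ) : koszulCocycles Q n →ₗ[k] HHRing k A :=
  (DirectSum.lof k ℕ (HH k A) n).comp (hcls Q n)

lemma rcls_apply (n : ℕ) (g : koszulCocycles Q n) :
    rcls Q n g = DirectSum.of (HH k A) n (hcls Q n g) := rfl

lemma rcls_mul {m n : ℕ} (g : koszulCocycles Q m) (h : koszulCocycles Q n) :
    rcls Q m g * rcls Q n h = rcls Q (m + n) ⟨kmul q g.1 h.1, kmul_mem Q g.2 h.2⟩ := by
  obtain ⟨f, rfl⟩ := restrictZ_surjective Q m g
  obtain ⟨f', rfl⟩ := restrictZ_surjective Q n h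
  rw [rcls_apply, rcls_apply, rcls_apply, DirectSum.of_mul_of, hcls_restrictZ, hcls_restrictZ]
  congr 1
  have : (⟨kmul q (restrictZ Q m f).1 (restrictZ Q n f').1,
      kmul_mem Q (restrictZ Q m f).2 (restrictZ Q n f').2⟩ : koszulCocycles Q (m + n)) =
      restrictZ Q (m + n) ⟨_, cup_mem_cocycles f.2 f'.2⟩ :=
    Subtype.ext (restrict_cup Q f.1 f'.1).symm
  rw [this, hcls_restrictZ]
  rfl

/-- Inside the direct sum, classes can be compared without transport when their degrees are equal
but not definitionally so. -/
lemma rcls_congr {m n : ℕ} (h : m = n) {g g' : ℕ → ℕ → A} (hg : g ∈ koszulCocycles Q m)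
    (hg' : g' ∈ koszulCocycles Q n) (e : g = g') : rcls Q m ⟨g, hg⟩ = rcls Q n ⟨g', hg'⟩ := by
  subst h e
  rfl

lemma rcls_eq_zero_iff {n : ℕ} (g : koszulCocycles Q n) :
    rcls Q n g = 0 ↔ IsKoszulBoundary Q n g.1 := by
  rw [← hcls_eq_zero_iff, rcls_apply]
  exact (DirectSum.of_injective (β := HH k A) n).eq_iff' (map_zero _)

lemma rcls_eq_iff {n : ℕ} (g g' : koszulCocycles Q n) :
    rcls Q n g = rcls Q n g' ↔ IsKoszulBoundary Q n (g.1 - g'.1) := by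
  rw [rcls_apply, rcls_apply, (DirectSum.of_injective (β := HH k A) n).eq_iff, ← sub_eq_zero,
    ← map_sub, hcls_eq_zero_iff]
  rfl

/-- The element `a ξⁱ ηʲ` of the Koszul complex. -/
def mono (i j : ℕ) (a : A) : ℕ → ℕ → A := Pi.single i (Pi.single j a)

lemma mono_apply (i j : ℕ) (a : A) (i' j' : ℕ) :
    mono i j a i' j' = if i' = i ∧ j' = j then a else 0 := by
  unfold mono
  by_cases h : i' = i
  · subst h
    by_cases h' : j' = j
    · subst h'; simp
    · simp [h']
  · simp [h]

lemma mono_supported {i j n : ℕ} (h : i + j = n) (a : A) : Supported n (mono i j a) := by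
  intro i' j' hij
  rw [mono_apply, if_neg (by omega)]

lemma one_mem : mono 0 0 (1 : A) ∈ koszulCocycles Q 0 := by
  refine ⟨mono_supported (Nat.add_zero 0) 1, ?_⟩
  ext (_ | i) (_ | j) <;> simp [dA, dK, BimoduleAction.self, mono_apply]

lemma rcls_one : rcls Q 0 ⟨mono 0 0 1, one_mem Q⟩ = 1 := by
  have h : (⟨mono 0 0 1, one_mem Q⟩ : koszulCocycles Q 0) =
      restrictZ Q 0 ⟨const (algebraMap k A 1), const_algebraMap_mem 1⟩ := by
    refine Subtype.ext ?_
    ext i j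
    change mono 0 0 1 i j = restrict Q (toIn (const (algebraMap k A 1))) i j
    rw [mono_apply]
    simp [restrict, wordSum, evIn_toIn]
  rw [rcls_apply, h, hcls_restrictZ]
  rfl

end Koszul
end


/-! ### The Koszul differential in coordinates -/

noncomputable section

namespace Koszul

open Hochschild Finset

universe v u

variable {k : Type v} {A : Type u} [Field k] [Ring A] [Algebra k A] {q : k}
  (Q : QuantumFrame A q)

-- Multiplication by `x` or `y` raises the number of factors `x, y` by one. The differential
-- therefore has no constant coordinate; its `x` and `y` coordinates involve only constants, and its
-- `yx` coordinate only the coordinates of `x` and `y`. On the edges `i = 0` and `j = 0` one of the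
-- two terms is missing.
@[simp] lemma c1_dA (n : ℕ) (g : ℕ → ℕ → A) (i j : ℕ) : Q.c1 (dA Q n g i j) = 0 := by
  rcases i with _ | i <;> rcases j with _ | j <;> simp [dA, dK, BimoduleAction.self]

@[simp] lemma cx_dA_zero (n : ℕ) (g : ℕ → ℕ → A) (j : ℕ) : Q.cx (dA Q n g 0 j) = 0 := by
  rcases j with _ | j <;> simp [dA, dK, BimoduleAction.self]

@[simp] lemma cx_dA_succ (n : ℕ) (g : ℕ → ℕ → A) (i j : ℕ) :
    Q.cx (dA Q n g (i + 1) j) = (1 + (-1) ^ (n + 1) * q ^ j) * Q.c1 (g i j) := by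
  rcases j with _ | j <;> simp [dA, dK, BimoduleAction.self] <;> ring

@[simp] lemma cy_dA_zero (n : ℕ) (g : ℕ → ℕ → A) (i : ℕ) : Q.cy (dA Q n g i 0) = 0 := by
  rcases i with _ | i <;> simp [dA, dK, BimoduleAction.self]

@[simp] lemma cy_dA_succ (n : ℕ) (g : ℕ → ℕ → A) (i j : ℕ) :
    Q.cy (dA Q n g i (j + 1)) = (q ^ i + (-1) ^ (n + 1)) * Q.c1 (g i j) := by
  rcases i with _ | i <;> simp [dA, dK, BimoduleAction.self] <;> ring

@[simp] lemma cz_dA_zero_zero (n : ℕ) (g : ℕ → ℕ → A) : Q.cz (dA Q n g 0 0) = 0 := by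
  simp [dA, dK, BimoduleAction.self]

@[simp] lemma cz_dA_succ_zero (n : ℕ) (g : ℕ → ℕ → A) (i : ℕ) :
    Q.cz (dA Q n g (i + 1) 0) = (-q + (-1) ^ (n + 1)) * Q.cy (g i 0) := by
  simp [dA, dK, BimoduleAction.self]
  ring

@[simp] lemma cz_dA_zero_succ (n : ℕ) (g : ℕ → ℕ → A) (j : ℕ) :
    Q.cz (dA Q n g 0 (j + 1)) = (1 - (-1) ^ (n + 1) * q) * Q.cx (g 0 j) := by
  simp [dA, dK, BimoduleAction.self]
  ring

@[simp] lemma cz_dA_succ_succ (n : ℕ) (g : ℕ → ℕ → A) (i j : ℕ) :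
    Q.cz (dA Q n g (i + 1) (j + 1)) = (-q + (-1) ^ (n + 1) * q ^ (j + 1)) * Q.cy (g i (j + 1)) +
      (q ^ (i + 1) - (-1) ^ (n + 1) * q) * Q.cx (g (i + 1) j) := by
  simp [dA, dK, BimoduleAction.self]
  ring

lemma mem_koszulCocycles_iff {n : ℕ} {g : ℕ → ℕ → A} : g ∈ koszulCocycles Q n ↔ Supported n g ∧
    (∀ i j, (1 + (-1) ^ (n + 1) * q ^ j) * Q.c1 (g i j) = 0) ∧
    (∀ i j, (q ^ i + (-1) ^ (n + 1)) * Q.c1 (g i j) = 0) ∧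
    (∀ i, (-q + (-1) ^ (n + 1)) * Q.cy (g i 0) = 0) ∧
    (∀ j, (1 - (-1) ^ (n + 1) * q) * Q.cx (g 0 j) = 0) ∧
    (∀ i j, (-q + (-1) ^ (n + 1) * q ^ (j + 1)) * Q.cy (g i (j + 1)) +
      (q ^ (i + 1) - (-1) ^ (n + 1) * q) * Q.cx (g (i + 1) j) = 0) := by
  refine and_congr_right fun _ => ⟨fun h => ?_, fun ⟨h1, h2, h3, h4, h5⟩ => ?_⟩
  · refine ⟨fun i j => ?_, fun i j => ?_, fun i => ?_, fun j => ?_, fun i j => ?_⟩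
    · rw [← cx_dA_succ, h]; simp
    · rw [← cy_dA_succ, h]; simp
    · rw [← cz_dA_succ_zero, h]; simp
    · rw [← cz_dA_zero_succ, h]; simp
    · rw [← cz_dA_succ_succ, h]; simp
  · ext i j
    refine Q.ext ?_ ?_ ?_ ?_
    · simp
    · rcases i with _ | i
      · simp
      · rw [cx_dA_succ, h1]; simp
    · rcases j with _ | j
      · simp
      · rw [cy_dA_succ, h2]; simp
    · rcases i with _ | i <;> rcases j with _ | j
      · simp
      · rw [cz_dA_zero_succ, h4]; simp
      · rw [cz_dA_succ_zero, h3]; simp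
      · rw [cz_dA_succ_succ, h5]; simp

/-- Outside the degree of `p` both sides vanish by the support conditions, so a candidate primitive
has to be tested only where `i + j = n`. -/
lemma dA_eq_iff {n : ℕ} {p g : ℕ → ℕ → A} (hp : Supported n p) (hg : Supported (n + 1) g) :
    dA Q n p = g ↔ (∀ i j, Q.c1 (g i j) = 0) ∧ (∀ j, Q.cx (g 0 j) = 0) ∧
      (∀ i, Q.cy (g i 0) = 0) ∧
      (∀ i j, i + j = n → (1 + (-1) ^ (n + 1) * q ^ j) * Q.c1 (p i j) = Q.cx (g (i + 1) j)) ∧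
      (∀ i j, i + j = n → (q ^ i + (-1) ^ (n + 1)) * Q.c1 (p i j) = Q.cy (g i (j + 1))) ∧
      (-q + (-1) ^ (n + 1)) * Q.cy (p n 0) = Q.cz (g (n + 1) 0) ∧
      (1 - (-1) ^ (n + 1) * q) * Q.cx (p 0 n) = Q.cz (g 0 (n + 1)) ∧
      (∀ i j, i + j + 1 = n → (-q + (-1) ^ (n + 1) * q ^ (j + 1)) * Q.cy (p i (j + 1)) +
        (q ^ (i + 1) - (-1) ^ (n + 1) * q) * Q.cx (p (i + 1) j) =
          Q.cz (g (i + 1) (j + 1))) := by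
  constructor
  · rintro rfl
    simp
  · rintro ⟨h1, hx, hy, h2, h3, h4, h5, h6⟩
    ext i j
    refine Q.ext ?_ ?_ ?_ ?_
    · rw [h1, c1_dA]
    · rcases i with _ | i
      · rw [hx, cx_dA_zero]
      · rw [cx_dA_succ]
        by_cases h : i + j = n
        · exact h2 i j h
        · rw [hp i j h, hg (i + 1) j (by omega)]; simp
    · rcases j with _ | j
      · rw [hy, cy_dA_zero]
      · rw [cy_dA_succ]
        by_cases h : i + j = n
        · exact h3 i j h
        · rw [hp i j h, hg i (j + 1) (by omega)]; simp
    · rcases i with _ | i <;> rcases j with _ | j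
      · rw [hg 0 0 (by omega)]; simp
      · rw [cz_dA_zero_succ]
        by_cases h : j = n
        · subst h; exact h5
        · rw [hp 0 j (by omega), hg 0 (j + 1) (by omega)]; simp
      · rw [cz_dA_succ_zero]
        by_cases h : i = n
        · subst h; exact h4
        · rw [hp i 0 (by omega), hg (i + 1) 0 (by omega)]; simp
      · rw [cz_dA_succ_succ]
        by_cases h : i + j + 1 = n
        · exact h6 i j h
        · rw [hp i (j + 1) (by omega), hp (i + 1) j (by omega), hg (i + 1) (j + 1) (by omega)]
          simp

/-- A linear map on the Koszul complex that maps the cocycles of degree `n` onto `V` and whose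
kernel on the cocycles consists of the boundaries identifies `HHⁿ(A)` with `V`. -/
lemma nonempty_HH_equiv {V : Type*} [AddCommGroup V] [Module k V] (n : ℕ)
    (T : (ℕ → ℕ → A) →ₗ[k] V) (hT : ∀ v, ∃ g ∈ koszulCocycles Q n, T g = v)
    (hker : ∀ g ∈ koszulCocycles Q n, T g = 0 ↔ IsKoszulBoundary Q n g) :
    Nonempty (HH k A n ≃ₗ[k] V) := by
  let T' : koszulCocycles Q n →ₗ[k] V := T.comp (koszulCocycles Q n).subtype
  have hT' : Function.Surjective T' := fun v => by
    obtain ⟨g, hg, rfl⟩ := hT v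
    exact ⟨⟨g, hg⟩, rfl⟩
  have hk : LinearMap.ker (hcls Q n) = LinearMap.ker T' := by
    ext g
    rw [LinearMap.mem_ker, LinearMap.mem_ker, hcls_eq_zero_iff, ← hker g.1 g.2]
    rfl
  exact ⟨((hcls Q n).quotKerEquivOfSurjective (hcls_surjective Q n)).symm ≪≫ₗ
    Submodule.quotEquivOfEq _ _ hk ≪≫ₗ T'.quotKerEquivOfSurjective hT'⟩

end Koszul

namespace QuantumFrame

variable {k A : Type*} [Field k] [Ring A] [Algebra k A] {q : k} (Q : QuantumFrame A q)

/-- The element with given coordinates. -/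
def mk' (a b c d : k) : A := a • (1 : A) + b • Q.x + c • Q.y + d • (Q.y * Q.x)

@[simp] lemma c1_mk' (a b c d : k) : Q.c1 (Q.mk' a b c d) = a := by simp [mk']
@[simp] lemma cx_mk' (a b c d : k) : Q.cx (Q.mk' a b c d) = b := by simp [mk']
@[simp] lemma cy_mk' (a b c d : k) : Q.cy (Q.mk' a b c d) = c := by simp [mk']
@[simp] lemma cz_mk' (a b c d : k) : Q.cz (Q.mk' a b c d) = d := by simp [mk']

end QuantumFrame
end


/-! ### Explicit cocycles, and the cohomology when `q` is nonzero and not a root of unity -/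

noncomputable section

namespace Koszul

open Hochschild Finset

universe v u

variable {k : Type v} {A : Type u} [Field k] [Ring A] [Algebra k A] {q : k}
  (Q : QuantumFrame A q)

/-- The scalar comes from `ηᵇ ξᶜ = q^(bc) ξᶜ ηᵇ`. -/
lemma mono_kmul_mono (a b c d : ℕ) (s t : A) :
    kmul q (mono a b s) (mono c d t) = mono (a + c) (b + d) (q ^ (b * c) • (s * t)) := by
  ext i j
  rw [mono_apply]
  by_cases h : i = a + c ∧ j = b + d
  · obtain ⟨rfl, rfl⟩ := h
    rw [if_pos ⟨rfl, rfl⟩, kmul, sum_eq_single (a, c), sum_eq_single (b, d)]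
    · simp [mono_apply]
    · rintro ⟨r, r'⟩ hr hne
      have : r ≠ b := by rintro rfl; simp_all
      simp [mono_apply, this]
    · simp
    · rintro ⟨r, r'⟩ hr hne
      have : r ≠ a := by rintro rfl; simp_all
      simp [mono_apply, this]
    · simp
  · rw [if_neg h, kmul]
    refine sum_eq_zero fun p hp => sum_eq_zero fun r hr => ?_
    rw [HasAntidiagonal.mem_antidiagonal] at hp hr
    simp only [mono_apply]
    by_cases h1 : p.1 = a ∧ r.1 = b
    · have h2 : ¬ (p.2 = c ∧ r.2 = d) := by omega
      simp [h2]
    · simp [h1]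

lemma mono_smul (i j : ℕ) (c : k) (a : A) : mono i j (c • a) = c • mono i j a := by
  ext i' j'
  by_cases h : i' = i ∧ j' = j <;> simp [mono_apply, h]

lemma mono_zero (i j : ℕ) : mono i j (0 : A) = 0 := by
  ext i' j'
  simp [mono_apply]

lemma mono_z_mem {i j n : ℕ} (h : i + j = n) : mono i j (Q.y * Q.x) ∈ koszulCocycles Q n := by
  rw [mem_koszulCocycles_iff]
  refine ⟨mono_supported h _, ?_⟩
  simp only [mono_apply]
  refine ⟨?_, ?_, ?_, ?_, ?_⟩ <;> intros <;> split_ifs <;> simp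

/-- This cocycle and `yη` are the Euler derivations of the two gradings by the numbers of factors
`x` and `y`, so they exist for every `q`. -/
lemma mono_x_mem : mono 1 0 Q.x ∈ koszulCocycles Q 1 := by
  rw [mem_koszulCocycles_iff]
  refine ⟨mono_supported (by omega) _, ?_⟩
  simp only [mono_apply]
  refine ⟨?_, ?_, ?_, ?_, ?_⟩ <;> intros <;> split_ifs <;> simp_all

lemma mono_y_mem : mono 0 1 Q.y ∈ koszulCocycles Q 1 := by
  rw [mem_koszulCocycles_iff]
  refine ⟨mono_supported (by omega) _, ?_⟩
  simp only [mono_apply]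
  refine ⟨?_, ?_, ?_, ?_, ?_⟩ <;> intros <;> split_ifs <;> simp_all

lemma mono_xy_mem : mono 1 1 (Q.x * Q.y) ∈ koszulCocycles Q 2 := by
  rw [Q.xy, mono_smul]
  exact Submodule.smul_mem _ _ (mono_z_mem Q rfl)

section NotRootOfUnity

/-- The squared form treats `qⁱ = 1` and `qⁱ = -1` together; every entry of the differential that
has to be nonzero is controlled by one of the two. -/
lemma eq_zero_of_pow_sq {q : k} (hq : ¬ IsOfFinOrder q) {i : ℕ} (h : q ^ i * q ^ i = 1) :
    i = 0 := by
  by_contra hi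
  refine hq (isOfFinOrder_iff_pow_eq_one.mpr ⟨i + i, by omega, ?_⟩)
  rw [pow_add, h]

/-- A cocycle of positive degree is a boundary unless it has a component of weight zero. -/
lemma isKoszulBoundary_of_notRoot (hq0 : q ≠ 0) (hq : ¬ IsOfFinOrder q) {n : ℕ} {g : ℕ → ℕ → A}
    (hg : g ∈ koszulCocycles Q (n + 1))
    (hx : n = 0 → Q.cx (g 1 0) = 0) (hy : n = 0 → Q.cy (g 0 1) = 0)
    (hz : n = 1 → Q.cz (g 1 1) = 0) : IsKoszulBoundary Q (n + 1) g := by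
  classical
  obtain ⟨hs, h1, h2, h3, h4, h5⟩ := (mem_koszulCocycles_iff Q).mp hg
  -- From here on the sign is an abstract `e` with `e² = 1`, so no case distinction by parity or
  -- characteristic is needed.
  have hee : ((-1 : k) ^ (n + 1)) * ((-1 : k) ^ (n + 1)) = 1 := by
    rw [← pow_add, ← two_mul, pow_mul]; simp
  simp only [pow_succ (-1 : k) (n + 1)] at h1 h2 h3 h4 h5
  generalize he : ((-1 : k) ^ (n + 1)) = e at *
  have he0 : e ≠ 0 := by rintro rfl; simp at hee
  have hroot : ∀ i, q ^ i = e ∨ q ^ i = -e → i = 0 := by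
    rintro i (h | h) <;> exact eq_zero_of_pow_sq hq (by rw [h]; linear_combination hee)
  have ha : ∀ j, 1 + e * q ^ j = 0 → j = 0 := fun j h =>
    hroot j (Or.inr (by linear_combination e * h - q ^ j * hee))
  have hb : ∀ i, q ^ i + e = 0 → i = 0 := fun i h => hroot i (Or.inr (by linear_combination h))
  have ha' : ∀ j, -1 + e * q ^ j = 0 → j = 0 := fun j h =>
    hroot j (Or.inl (by linear_combination e * h - q ^ j * hee))
  have hb' : ∀ i, q ^ i - e = 0 → i = 0 := fun i h => hroot i (Or.inl (by linear_combination h))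
  have hqe : q ≠ e := fun h => one_ne_zero (hroot 1 (by simp [h]))
  have hqe' : q ≠ -e := fun h => one_ne_zero (hroot 1 (by simp [h]))
  -- A nonzero constant coordinate would need both of its coefficients to vanish, which forces `i =
  -- j = 0`; but the degree is positive.
  have hc1 : ∀ i j, Q.c1 (g i j) = 0 := by
    intro i j
    by_contra hne
    have hj := ha' j (by
      have := (mul_eq_zero.mp (h1 i j)).resolve_right hne
      linear_combination -this)
    have hi := hb' i (by
      have := (mul_eq_zero.mp (h2 i j)).resolve_right hne
      linear_combination this)
    subst hi hj
    exact hne (by rw [hs 0 0 (by omega)]; simp)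
  have hcy : ∀ i, Q.cy (g i 0) = 0 := fun i =>
    (mul_eq_zero.mp (h3 i)).resolve_left fun h => hqe' (by linear_combination -h)
  have hcx : ∀ j, Q.cx (g 0 j) = 0 := fun j =>
    (mul_eq_zero.mp (h4 j)).resolve_left fun h => hqe' (by linear_combination e * h - q * hee)
  have hrel : ∀ i j, (1 + e * q ^ j) * Q.cy (g i (j + 1)) =
      (q ^ i + e) * Q.cx (g (i + 1) j) := by
    intro i j
    refine mul_left_cancel₀ hq0 ?_
    linear_combination -h5 i j
  -- The `yx` coordinate gives one equation in two unknowns. It is solved by the `y` coordinate of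
  -- `p` unless the coefficient of that one vanishes, which happens only for `j = 0`; then the `x`
  -- coordinate is used. On the edges there is a single unknown with nonzero coefficient.
  let px : ℕ → ℕ → k := fun i j => match i with
    | 0 => Q.cz (g 0 (j + 1)) / (1 - e * q)
    | i + 1 => if -1 + e * q ^ j = 0 then Q.cz (g (i + 1) (j + 1)) / (q * (q ^ i - e)) else 0
  let py : ℕ → ℕ → k := fun i j => match j with
    | 0 => Q.cz (g (i + 1) 0) / (-q + e)
    | j + 1 => if -1 + e * q ^ j = 0 then 0
        else Q.cz (g (i + 1) (j + 1)) / (q * (-1 + e * q ^ j))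
  -- The constant coordinate has to solve two equations, which are compatible by `hrel`. It is
  -- determined by one with nonzero coefficient. If both coefficients vanish, then `i = j = 0`, and
  -- `hx`, `hy` say that the right sides are zero.
  let p : ℕ → ℕ → A := fun i j => if i + j = n then
    Q.mk' (if 1 + e * q ^ j = 0 then Q.cy (g i (j + 1)) / (q ^ i + e)
      else Q.cx (g (i + 1) j) / (1 + e * q ^ j)) (px i j) (py i j) 0 else 0
  have hp : Supported n p := fun i j hij => if_neg hij
  refine ⟨p, hp, (dA_eq_iff Q hp hs).mpr ⟨hc1, hcx, hcy, ?_, ?_, ?_, ?_, ?_⟩⟩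
  · intro i j hij
    simp only [p, hij, if_true, QuantumFrame.c1_mk', he]
    split_ifs with h
    · obtain rfl := ha j h
      rw [h, zero_mul]
      have hr := hrel i 0
      rw [h, zero_mul, zero_eq_mul] at hr
      rcases hr with hr | hr
      · obtain rfl := hb i hr
        exact (hx (by omega)).symm
      · exact hr.symm
    · field_simp
  · intro i j hij
    simp only [p, hij, if_true, QuantumFrame.c1_mk', he]
    split_ifs with h
    · obtain rfl := ha j h
      by_cases h' : q ^ i + e = 0
      · obtain rfl := hb i h'
        rw [h', zero_mul]
        exact (hy (by omega)).symm
      · field_simp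
    · rw [← mul_div_assoc, ← hrel, mul_div_cancel_left₀ _ h]
  · simp only [p, py, add_zero, if_true, QuantumFrame.cy_mk', he]
    refine mul_div_cancel₀ _ fun h => hqe (by linear_combination -h)
  · simp only [p, px, zero_add, if_true, QuantumFrame.cx_mk', he]
    refine mul_div_cancel₀ _ fun h => hqe (by linear_combination -e * h - q * hee)
  · intro i j hij
    simp only [p, px, py, show i + (j + 1) = n by omega, show i + 1 + j = n by omega, if_true,
      QuantumFrame.cx_mk', QuantumFrame.cy_mk', he]
    split_ifs with h
    · obtain rfl := ha' j h
      by_cases h' : q ^ i - e = 0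
      · obtain rfl := hb' i h'
        rw [hz (by omega)]
        simp
      · have h2 : q * (q ^ i - e) ≠ 0 := mul_ne_zero hq0 h'
        rw [show q ^ (i + 1) - e * q = q * (q ^ i - e) by ring, mul_div_cancel₀ _ h2]
        simp
    · have h2 : q * (-1 + e * q ^ j) ≠ 0 := mul_ne_zero hq0 h
      rw [show -q + e * q ^ (j + 1) = q * (-1 + e * q ^ j) by ring, mul_div_cancel₀ _ h2]
      simp

/-- Cocycles of degree zero are central elements. Commuting with `x` and `y` multiplies the `y` and
`x` coordinates by `±(1 + q)`, which is nonzero here. -/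
lemma cocycle_zero_of_notRoot (hq : ¬ IsOfFinOrder q) {g : ℕ → ℕ → A}
    (hg : g ∈ koszulCocycles Q 0) :
    g = Q.c1 (g 0 0) • mono 0 0 1 + Q.cz (g 0 0) • mono 0 0 (Q.y * Q.x) := by
  obtain ⟨hs, -, -, h3, h4, -⟩ := (mem_koszulCocycles_iff Q).mp hg
  have hq1 : q ≠ -1 := fun h => one_ne_zero (eq_zero_of_pow_sq hq (i := 1) (by simp [h]))
  have hx : Q.cx (g 0 0) = 0 :=
    (mul_eq_zero.mp (h4 0)).resolve_left fun h => hq1 (by linear_combination h)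
  have hy : Q.cy (g 0 0) = 0 :=
    (mul_eq_zero.mp (h3 0)).resolve_left fun h => hq1 (by linear_combination -h)
  ext i j
  by_cases h : i = 0 ∧ j = 0
  · obtain ⟨rfl, rfl⟩ := h
    conv_lhs => rw [← Q.sum_coord (g 0 0)]
    simp [hx, hy, mono_apply]
  · rw [hs i j (by omega)]
    simp [mono_apply, h]

end NotRootOfUnity

/-- The part of the differential that preserves weight zero vanishes for every `q`; this also gives
the next statement. -/
lemma boundary_one {g : ℕ → ℕ → A} (hg : Supported 1 g) (h : IsKoszulBoundary Q 1 g) :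
    Q.cx (g 1 0) = 0 ∧ Q.cy (g 0 1) = 0 := by
  obtain ⟨p, hp, h⟩ := h
  obtain ⟨-, -, -, h1, h2, -⟩ := (dA_eq_iff Q hp hg).mp h
  exact ⟨by rw [← h1 0 0 rfl]; simp, by rw [← h2 0 0 rfl]; simp⟩

lemma boundary_two {g : ℕ → ℕ → A} (hg : Supported 2 g) (h : IsKoszulBoundary Q 2 g) :
    Q.cz (g 1 1) = 0 := by
  obtain ⟨p, hp, h⟩ := h
  obtain ⟨-, -, -, -, -, -, -, h3⟩ := (dA_eq_iff Q hp hg).mp h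
  rw [← h3 0 0 rfl]
  simp

/-! ### The five classes -/

/-- The class of `yx` in degree `0`. -/
def classZ : HHRing k A := rcls Q 0 ⟨_, mono_z_mem Q (Nat.add_zero 0)⟩

/-- The class of `x ξ` in degree `1`. -/
def classU₀ : HHRing k A := rcls Q 1 ⟨_, mono_x_mem Q⟩

/-- The class of `y η` in degree `1`. -/
def classU₁ : HHRing k A := rcls Q 1 ⟨_, mono_y_mem Q⟩

lemma rcls_eq_zero_of_eq_zero {n : ℕ} {g : ℕ → ℕ → A} (hg : g ∈ koszulCocycles Q n) (h : g = 0) :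
    rcls Q n ⟨g, hg⟩ = 0 := by
  subst h
  exact map_zero (rcls Q n)

lemma classU₀_mul_self : classU₀ Q * classU₀ Q = 0 := by
  rw [classU₀, rcls_mul]
  exact rcls_eq_zero_of_eq_zero Q _ (by rw [mono_kmul_mono]; simp [mono_zero])

lemma classU₁_mul_self : classU₁ Q * classU₁ Q = 0 := by
  rw [classU₁, rcls_mul]
  exact rcls_eq_zero_of_eq_zero Q _ (by rw [mono_kmul_mono]; simp [mono_zero])

lemma classU₀_mul_classU₁ : classU₀ Q * classU₁ Q = rcls Q 2 ⟨_, mono_xy_mem Q⟩ := by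
  rw [classU₀, classU₁, rcls_mul]
  exact rcls_congr Q rfl _ _ (by rw [mono_kmul_mono]; simp)

/-- The factor `q` from `ηξ = q ξη` meets the factor `-q` from `xy = -q yx`, and only a sign
remains. -/
lemma classU₁_mul_classU₀ : classU₁ Q * classU₀ Q = (-1 : k) • (classU₀ Q * classU₁ Q) := by
  have h : classU₁ Q * classU₀ Q = rcls Q 2 ((-1 : k) • ⟨_, mono_xy_mem Q⟩) := by
    rw [classU₀, classU₁, rcls_mul]
    refine rcls_congr Q rfl _ (Submodule.smul_mem _ _ (mono_xy_mem Q)) ?_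
    rw [mono_kmul_mono, ← mono_smul, Q.xy]
    simp
  rw [h, classU₀_mul_classU₁, map_smul]

lemma classZ_mul_self : classZ Q * classZ Q = 0 := by
  rw [classZ, rcls_mul]
  exact rcls_eq_zero_of_eq_zero Q _ (by rw [mono_kmul_mono]; simp [mono_zero, ← mul_assoc])

lemma classZ_mul_classU₀ : classZ Q * classU₀ Q = 0 := by
  rw [classZ, classU₀, rcls_mul]
  exact rcls_eq_zero_of_eq_zero Q _ (by rw [mono_kmul_mono]; simp [mono_zero])

lemma classZ_mul_classU₁ : classZ Q * classU₁ Q = 0 := by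
  rw [classZ, classU₁, rcls_mul]
  exact rcls_eq_zero_of_eq_zero Q _ (by rw [mono_kmul_mono]; simp [mono_zero])

lemma classU₀_mul_classZ : classU₀ Q * classZ Q = 0 := by
  rw [classZ, classU₀, rcls_mul]
  exact rcls_eq_zero_of_eq_zero Q _ (by rw [mono_kmul_mono]; simp [mono_zero])

lemma classU₁_mul_classZ : classU₁ Q * classZ Q = 0 := by
  rw [classZ, classU₁, rcls_mul]
  exact rcls_eq_zero_of_eq_zero Q _ (by rw [mono_kmul_mono]; simp [mono_zero])

/-- The linear map that sends a coordinate vector to the combination of the five classes. -/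
def fiveClasses : (Fin 5 → k) →ₗ[k] HHRing k A :=
  Fintype.linearCombination k ![1, classZ Q, classU₀ Q, classU₁ Q, classU₀ Q * classU₁ Q]

lemma fiveClasses_apply (c : Fin 5 → k) : fiveClasses Q c = c 0 • 1 + c 1 • classZ Q +
    c 2 • classU₀ Q + c 3 • classU₁ Q + c 4 • (classU₀ Q * classU₁ Q) := by
  simp [fiveClasses, Fintype.linearCombination_apply, Fin.sum_univ_succ]
  abel

lemma component_rcls_of_ne {m n : ℕ} (h : m ≠ n) (g : koszulCocycles Q m) :
    DirectSum.component k ℕ (HH k A) n (rcls Q m g) = 0 := by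
  exact (DirectSum.component.of k n m _).trans (dif_neg h)

lemma component_rcls_self {n : ℕ} (g : koszulCocycles Q n) :
    DirectSum.component k ℕ (HH k A) n (rcls Q n g) = hcls Q n g := by
  exact DirectSum.component.lof_self k n _

/-- The components of degrees `0`, `1` and `2` are tested separately by functionals that vanish on
boundaries. The product of the two classes of degree one is `-q yx ξη`, so `q ≠ 0` is essential. -/
lemma fiveClasses_injective (hq0 : q ≠ 0) : Function.Injective (fiveClasses Q) := by
  rw [injective_iff_map_eq_zero]
  intro c hc
  let g₀ : koszulCocycles Q 0 := c 0 • ⟨_, one_mem Q⟩ + c 1 • ⟨_, mono_z_mem Q (Nat.add_zero 0)⟩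
  let g₁ : koszulCocycles Q 1 := c 2 • ⟨_, mono_x_mem Q⟩ + c 3 • ⟨_, mono_y_mem Q⟩
  let g₂ : koszulCocycles Q 2 := c 4 • ⟨_, mono_xy_mem Q⟩
  have h : rcls Q 0 g₀ + rcls Q 1 g₁ + rcls Q 2 g₂ = 0 := by
    rw [← hc, fiveClasses_apply, classU₀_mul_classU₁]
    simp only [g₀, g₁, g₂, map_add, map_smul, rcls_one, classZ, classU₀, classU₁]
    abel
  have h0 : hcls Q 0 g₀ = 0 := by
    have := congrArg (DirectSum.component k ℕ (HH k A) 0) h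
    simpa [component_rcls_self, component_rcls_of_ne] using this
  have h1 : hcls Q 1 g₁ = 0 := by
    have := congrArg (DirectSum.component k ℕ (HH k A) 1) h
    simpa [component_rcls_self, component_rcls_of_ne] using this
  have h2 : hcls Q 2 g₂ = 0 := by
    have := congrArg (DirectSum.component k ℕ (HH k A) 2) h
    simpa [component_rcls_self, component_rcls_of_ne] using this
  rw [hcls_eq_zero_iff] at h0 h1 h2
  have e0 : g₀.1 = 0 := h0
  obtain ⟨e1, e1'⟩ := boundary_one Q g₁.2.1 h1
  have e2 := boundary_two Q g₂.2.1 h2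
  ext i
  fin_cases i
  · simpa [g₀, mono_apply] using congrArg Q.c1 (congrFun₂ e0 0 0)
  · simpa [g₀, mono_apply] using congrArg Q.cz (congrFun₂ e0 0 0)
  · simpa [g₁, mono_apply] using e1
  · simpa [g₁, mono_apply] using e1'
  · simpa [g₂, mono_apply, hq0] using e2

lemma fiveClasses_surjective (hq0 : q ≠ 0) (hq : ¬ IsOfFinOrder q) :
    Function.Surjective (fiveClasses Q) := by
  rw [← LinearMap.range_eq_top, eq_top_iff]
  intro a _
  induction a using DirectSum.induction_on with
  | zero => exact zero_mem _
  | add a b ha hb => exact add_mem (ha trivial) (hb trivial)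
  | of n h =>
    obtain ⟨g, rfl⟩ := hcls_surjective Q n h
    rw [← rcls_apply]
    obtain ⟨g, hg⟩ := g
    match n, hg with
    | 0, hg =>
      refine ⟨![Q.c1 (g 0 0), Q.cz (g 0 0), 0, 0, 0], ?_⟩
      rw [fiveClasses_apply, classZ, ← rcls_one Q]
      simp only [Matrix.cons_val, zero_smul, add_zero]
      rw [← map_smul, ← map_smul, ← map_add]
      exact rcls_congr Q rfl _ _ (cocycle_zero_of_notRoot Q hq hg).symm
    | 1, hg =>
      refine ⟨![0, 0, Q.cx (g 1 0), Q.cy (g 0 1), 0], ?_⟩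
      rw [fiveClasses_apply, classU₀, classU₁]
      simp only [Matrix.cons_val, zero_smul, add_zero, zero_add]
      rw [← map_smul, ← map_smul, ← map_add, rcls_eq_iff]
      refine isKoszulBoundary_of_notRoot Q hq0 hq (sub_mem (Subtype.property _) hg) ?_ ?_ ?_ <;>
        simp [mono_apply]
    | 2, hg =>
      -- The last basis class is `xy ξη = -q yx ξη`, hence the division by `-q`.
      refine ⟨![0, 0, 0, 0, -Q.cz (g 1 1) / q], ?_⟩
      rw [fiveClasses_apply, classU₀_mul_classU₁]
      simp only [Matrix.cons_val, zero_smul, zero_add]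
      rw [← map_smul, rcls_eq_iff]
      refine isKoszulBoundary_of_notRoot Q hq0 hq (sub_mem (Subtype.property _) hg) ?_ ?_ ?_ <;>
        simp [mono_apply, hq0]
    | n + 3, hg =>
      have : rcls Q (n + 3) ⟨g, hg⟩ = 0 := by
        rw [rcls_eq_zero_iff]
        exact isKoszulBoundary_of_notRoot Q hq0 hq hg (by omega) (by omega) (by omega)
      rw [this]
      exact zero_mem _

lemma subsingleton_HH (Q : QuantumFrame A q) (hq0 : q ≠ 0) (hq : ¬ IsOfFinOrder q) {n : ℕ}
    (hn : 3 ≤ n) : Subsingleton (HH k A n) := by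
  obtain ⟨n, rfl⟩ := Nat.exists_eq_add_of_le' hn
  refine subsingleton_of_forall_eq 0 fun h => ?_
  obtain ⟨g, rfl⟩ := hcls_surjective Q _ h
  rw [hcls_eq_zero_iff]
  exact isKoszulBoundary_of_notRoot Q hq0 hq g.2 (by omega) (by omega) (by omega)

/-- The coefficient of `ξⁱ ηʲ`. -/
def coeffAt (i j : ℕ) : (ℕ → ℕ → A) →ₗ[k] A where
  toFun g := g i j
  map_add' _ _ := rfl
  map_smul' _ _ := rfl

@[simp] lemma coeffAt_apply (i j : ℕ) (g : ℕ → ℕ → A) : coeffAt (k := k) i j g = g i j := rfl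

lemma nonempty_HH_zero (Q : QuantumFrame A q) (hq : ¬ IsOfFinOrder q) :
    Nonempty (HH k A 0 ≃ₗ[k] k × k) := by
  refine nonempty_HH_equiv Q 0 ((Q.c1.comp (coeffAt 0 0)).prod (Q.cz.comp (coeffAt 0 0))) ?_ ?_
  · rintro ⟨a, b⟩
    refine ⟨a • mono 0 0 1 + b • mono 0 0 (Q.y * Q.x), add_mem (Submodule.smul_mem _ _ (one_mem Q))
      (Submodule.smul_mem _ _ (mono_z_mem Q rfl)), ?_⟩
    simp [mono_apply]
  · intro g hg
    constructor
    · intro h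
      obtain ⟨h1, h2⟩ := Prod.mk.inj h
      simp only [LinearMap.comp_apply, coeffAt_apply] at h1 h2
      rw [IsKoszulBoundary, cocycle_zero_of_notRoot Q hq hg, h1, h2]
      simp
    · rintro rfl
      simp

lemma nonempty_HH_one (Q : QuantumFrame A q) (hq0 : q ≠ 0) (hq : ¬ IsOfFinOrder q) :
    Nonempty (HH k A 1 ≃ₗ[k] k × k) := by
  refine nonempty_HH_equiv Q 1
    ((Q.cx.comp (coeffAt 1 0)).prod
      (Q.cy.comp (coeffAt 0 1))) ?_ ?_
  · rintro ⟨a, b⟩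
    refine ⟨a • mono 1 0 Q.x + b • mono 0 1 Q.y, add_mem (Submodule.smul_mem _ _ (mono_x_mem Q))
      (Submodule.smul_mem _ _ (mono_y_mem Q)), ?_⟩
    simp [mono_apply]
  · intro g hg
    refine ⟨fun h => ?_, fun h => ?_⟩
    · obtain ⟨h1, h2⟩ := Prod.mk.inj h
      exact isKoszulBoundary_of_notRoot Q hq0 hq hg (fun _ => h1) (fun _ => h2) (by omega)
    · obtain ⟨h1, h2⟩ := boundary_one Q hg.1 h
      exact Prod.ext h1 h2

lemma nonempty_HH_two (Q : QuantumFrame A q) (hq0 : q ≠ 0) (hq : ¬ IsOfFinOrder q) :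
    Nonempty (HH k A 2 ≃ₗ[k] k) := by
  refine nonempty_HH_equiv Q 2 (Q.cz.comp (coeffAt 1 1)) ?_ ?_
  · intro a
    refine ⟨a • mono 1 1 (Q.y * Q.x), Submodule.smul_mem _ _ (mono_z_mem Q rfl), ?_⟩
    simp [mono_apply]
  · intro g hg
    exact ⟨fun h => isKoszulBoundary_of_notRoot Q hq0 hq hg (by omega) (by omega) fun _ => h,
      boundary_two Q hg.1⟩

lemma finite_HH_of_notRoot (Q : QuantumFrame A q) (hq0 : q ≠ 0) (hq : ¬ IsOfFinOrder q) (n : ℕ) :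
    Module.Finite k (HH k A n) := by
  match n with
  | 0 => exact Module.Finite.equiv (nonempty_HH_zero Q hq).some.symm
  | 1 => exact Module.Finite.equiv (nonempty_HH_one Q hq0 hq).some.symm
  | 2 => exact Module.Finite.equiv (nonempty_HH_two Q hq0 hq).some.symm
  | n + 3 =>
    have := subsingleton_HH Q hq0 hq (n := n + 3) (by omega)
    infer_instance

lemma hilbertSeries_of_notRoot (Q : QuantumFrame A q) (hq0 : q ≠ 0) (hq : ¬ IsOfFinOrder q) :
    hilbertSeries k A = 2 + 2 * PowerSeries.X + PowerSeries.X ^ 2 := by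
  have h2 : (2 : PowerSeries ℚ) = PowerSeries.C 2 := (map_ofNat PowerSeries.C 2).symm
  ext n
  rw [h2]
  simp only [hilbertSeries, PowerSeries.coeff_mk, map_add, PowerSeries.coeff_C_mul,
    PowerSeries.coeff_C, PowerSeries.coeff_X, PowerSeries.coeff_X_pow]
  match n with
  | 0 =>
    rw [(nonempty_HH_zero Q hq).some.finrank_eq]
    simp
  | 1 =>
    rw [(nonempty_HH_one Q hq0 hq).some.finrank_eq]
    simp
  | 2 =>
    rw [(nonempty_HH_two Q hq0 hq).some.finrank_eq]
    simp
  | n + 3 =>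
    have := subsingleton_HH Q hq0 hq (n := n + 3) (by omega)
    rw [Module.finrank_zero_of_subsingleton]
    simp

end Koszul
end


/-! ### The exterior algebra on two generators and the fibre product -/

noncomputable section

namespace ExteriorAlgebra

variable (k : Type*) [Field k]

/-- The generators of the exterior algebra on two generators. -/
def gen (i : Fin 2) : ExteriorAlgebra k (Fin 2 → k) := ι k (Pi.single i 1)

lemma ι_eq_gen (v : Fin 2 → k) : ι k v = v 0 • gen k 0 + v 1 • gen k 1 := by
  have : v = v 0 • Pi.single 0 1 + v 1 • Pi.single 1 1 := by
    ext i; fin_cases i <;> simp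
  conv_lhs => rw [this]
  simp [gen]

lemma gen_mul_self (i : Fin 2) : gen k i * gen k i = 0 := ι_sq_zero _

lemma gen_one_mul_gen_zero : gen k 1 * gen k 0 = -(gen k 0 * gen k 1) := by
  rw [eq_neg_iff_add_eq_zero, add_comm]
  exact ι_add_mul_swap _ _

/-- Only spanning is needed: independence is later transported from the algebra that is compared
with the fibre product. The induction proves stability under right multiplication. -/
lemma exists_eq_gen (w : ExteriorAlgebra k (Fin 2 → k)) : ∃ a b c d : k,
    w = a • 1 + b • gen k 0 + c • gen k 1 + d • (gen k 0 * gen k 1) := by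
  suffices h : ∀ a b c d : k, ∃ a' b' c' d' : k,
      (a • 1 + b • gen k 0 + c • gen k 1 + d • (gen k 0 * gen k 1)) * w =
        a' • 1 + b' • gen k 0 + c' • gen k 1 + d' • (gen k 0 * gen k 1) by
    simpa using h 1 0 0 0
  induction w using ExteriorAlgebra.induction with
  | algebraMap r =>
    intro a b c d
    refine ⟨r * a, r * b, r * c, r * d, ?_⟩
    rw [← Algebra.commutes, ← Algebra.smul_def]
    simp only [smul_add, smul_smul]
  | ι v =>
    intro a b c d
    refine ⟨0, a * v 0, a * v 1, b * v 1 - c * v 0, ?_⟩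
    have h1 : gen k 0 * gen k 1 * gen k 0 = 0 := by
      rw [mul_assoc, gen_one_mul_gen_zero, mul_neg, ← mul_assoc, gen_mul_self, zero_mul, neg_zero]
    have h2 : gen k 0 * gen k 1 * gen k 1 = 0 := by rw [mul_assoc, gen_mul_self, mul_zero]
    rw [ι_eq_gen]
    simp only [add_mul, mul_add, smul_mul_assoc, mul_smul_comm, one_mul, gen_mul_self,
      gen_one_mul_gen_zero, h1, h2, smul_zero, smul_neg]
    module
  | mul w w' ih ih' =>
    intro a b c d
    obtain ⟨a₁, b₁, c₁, d₁, h⟩ := ih a b c d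
    obtain ⟨a₂, b₂, c₂, d₂, h'⟩ := ih' a₁ b₁ c₁ d₁
    exact ⟨a₂, b₂, c₂, d₂, by rw [← mul_assoc, h, h']⟩
  | add w w' ih ih' =>
    intro a b c d
    obtain ⟨a₁, b₁, c₁, d₁, h⟩ := ih a b c d
    obtain ⟨a₂, b₂, c₂, d₂, h'⟩ := ih' a b c d
    refine ⟨a₁ + a₂, b₁ + b₂, c₁ + c₂, d₁ + d₂, ?_⟩
    rw [mul_add, h, h']
    module

end ExteriorAlgebra

/-! ## Algebras isomorphic to the fibre product -/

/-- Elements `z`, `u₀`, `u₁` of an algebra that satisfy the relations of the generators of the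
fibre product of the dual numbers and the exterior algebra. -/
structure FibreRelations (k : Type*) {R : Type*} [Field k] [Ring R] [Algebra k R]
    (z u₀ u₁ : R) : Prop where
  zz : z * z = 0
  zu₀ : z * u₀ = 0
  zu₁ : z * u₁ = 0
  u₀z : u₀ * z = 0
  u₁z : u₁ * z = 0
  u₀u₀ : u₀ * u₀ = 0
  u₁u₁ : u₁ * u₁ = 0
  u₁u₀ : u₁ * u₀ = (-1 : k) • (u₀ * u₁)

namespace FibreRelations

open ExteriorAlgebra

variable {k R : Type*} [Field k] [Ring R] [Algebra k R] {z u₀ u₁ : R}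
  (h : FibreRelations k z u₀ u₁)

variable (k u₀ u₁) in
/-- The linear map that sends the two basis vectors to `u₀` and `u₁`. -/
def degreeOne : (Fin 2 → k) →ₗ[k] R := Fintype.linearCombination k ![u₀, u₁]

lemma degreeOne_apply (v : Fin 2 → k) : degreeOne k u₀ u₁ v = v 0 • u₀ + v 1 • u₁ := by
  simp [degreeOne, Fintype.linearCombination_apply, Fin.sum_univ_succ]

lemma degreeOne_mul_self (h : FibreRelations k z u₀ u₁) (v : Fin 2 → k) :
    degreeOne k u₀ u₁ v * degreeOne k u₀ u₁ v = 0 := by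
  rw [degreeOne_apply]
  simp only [add_mul, mul_add, smul_mul_assoc, mul_smul_comm, h.u₀u₀, h.u₁u₁, h.u₁u₀]
  module

/-- The algebra map from the exterior algebra with `u₁ ↦ u₀` and `u₂ ↦ u₁`. -/
def exteriorMap : ExteriorAlgebra k (Fin 2 → k) →ₐ[k] R :=
  ExteriorAlgebra.lift k ⟨degreeOne k u₀ u₁, h.degreeOne_mul_self⟩

lemma exteriorMap_ι (v : Fin 2 → k) : h.exteriorMap (ι k v) = degreeOne k u₀ u₁ v := by
  simp [exteriorMap]

lemma exteriorMap_gen_zero : h.exteriorMap (gen k 0) = u₀ := by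
  rw [gen, exteriorMap_ι, degreeOne_apply]
  simp

lemma exteriorMap_gen_one : h.exteriorMap (gen k 1) = u₁ := by
  rw [gen, exteriorMap_ι, degreeOne_apply]
  simp

/-- The generators of the exterior algebra kill `z`, so it acts on `z` through its augmentation. -/
lemma exteriorMap_mul (w : ExteriorAlgebra k (Fin 2 → k)) :
    h.exteriorMap w * z = algebraMapInv w • z := by
  induction w using ExteriorAlgebra.induction with
  | algebraMap r => simp [Algebra.smul_def]
  | ι v =>
    rw [exteriorMap_ι, degreeOne_apply]
    simp [add_mul, h.u₀z, h.u₁z, algebraMapInv]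
  | mul w w' ih ih' =>
    rw [map_mul, mul_assoc, ih', mul_smul_comm, ih, smul_smul, map_mul, mul_comm]
  | add w w' ih ih' => rw [map_add, add_mul, ih, ih', map_add, add_smul]

lemma mul_exteriorMap (w : ExteriorAlgebra k (Fin 2 → k)) :
    z * h.exteriorMap w = algebraMapInv w • z := by
  induction w using ExteriorAlgebra.induction with
  | algebraMap r => simp [Algebra.smul_def, Algebra.commutes]
  | ι v =>
    rw [exteriorMap_ι, degreeOne_apply]
    simp [mul_add, h.zu₀, h.zu₁, algebraMapInv]
  | mul w w' ih ih' =>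
    rw [map_mul, ← mul_assoc, ih, smul_mul_assoc, ih', smul_smul, map_mul]
  | add w w' ih ih' => rw [map_add, mul_add, ih, ih', map_add, add_smul]

/-- The linear map on the product of the dual numbers and the exterior algebra that restricts to
an algebra map on the fibre product. -/
def fibreLinear : k[ε] × ExteriorAlgebra k (Fin 2 → k) →ₗ[k] R :=
  h.exteriorMap.toLinearMap.comp (LinearMap.snd k _ _) +
    ((TrivSqZeroExt.sndHom k k).comp (LinearMap.fst k _ _)).smulRight z

lemma fibreLinear_apply (w : k[ε] × ExteriorAlgebra k (Fin 2 → k)) :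
    h.fibreLinear w = h.exteriorMap w.2 + w.1.snd • z := rfl

lemma mem_fibre_iff (w : k[ε] × ExteriorAlgebra k (Fin 2 → k)) :
    w ∈ DualNumberFibreExterior k ↔ w.1.fst = algebraMapInv w.2 := Iff.rfl

/-- The algebra map on the fibre product. -/
def fibreMap : DualNumberFibreExterior k →ₐ[k] R :=
  AlgHom.ofLinearMap (h.fibreLinear.comp (DualNumberFibreExterior k).val.toLinearMap)
    (by
      change h.fibreLinear 1 = 1
      rw [fibreLinear_apply]
      simp)
    (by
      rintro ⟨w, hw⟩ ⟨w', hw'⟩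
      -- The cross terms produce the augmentations of the exterior components. On the fibre product
      -- these equal the constant terms of the dual numbers, which gives their multiplication rule.
      rw [mem_fibre_iff] at hw hw'
      change h.fibreLinear (w * w') = h.fibreLinear w * h.fibreLinear w'
      simp only [fibreLinear_apply, add_mul, mul_add, Prod.snd_mul, Prod.fst_mul, map_mul,
        mul_smul_comm, smul_mul_assoc, exteriorMap_mul, mul_exteriorMap, h.zz, smul_zero,
        add_zero, ← hw, ← hw', TrivSqZeroExt.snd_mul, add_smul, smul_smul, smul_eq_mul,
        MulOpposite.smul_eq_mul_unop, MulOpposite.unop_op]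
      module)

lemma fibreMap_apply (w : DualNumberFibreExterior k) :
    h.fibreMap w = h.exteriorMap w.1.2 + w.1.1.snd • z := rfl

variable (k) in
/-- The element of the fibre product with given coordinates. -/
def fibreElement (c : Fin 5 → k) : DualNumberFibreExterior k :=
  ⟨(TrivSqZeroExt.inl (c 0) + TrivSqZeroExt.inr (c 1),
    c 0 • 1 + c 2 • gen k 0 + c 3 • gen k 1 + c 4 • (gen k 0 * gen k 1)), by
    rw [mem_fibre_iff]
    simp [gen, algebraMapInv]⟩

lemma fibreElement_surjective : Function.Surjective (fibreElement k) := by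
  rintro ⟨⟨d, w⟩, hw⟩
  obtain ⟨a, b, c, e, rfl⟩ := exists_eq_gen k w
  rw [mem_fibre_iff] at hw
  have hd : d.fst = a := by simpa [gen, algebraMapInv] using hw
  refine ⟨![a, d.snd, b, c, e], Subtype.ext (Prod.ext ?_ ?_)⟩
  · refine TrivSqZeroExt.ext ?_ ?_ <;> simp [fibreElement, hd]
  · simp [fibreElement]

lemma fibreMap_fibreElement (c : Fin 5 → k) : h.fibreMap (fibreElement k c) =
    c 0 • 1 + c 1 • z + c 2 • u₀ + c 3 • u₁ + c 4 • (u₀ * u₁) := by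
  rw [fibreMap_apply]
  simp only [fibreElement, map_add, map_smul, map_mul, map_one, exteriorMap_gen_zero,
    exteriorMap_gen_one, TrivSqZeroExt.snd_add, TrivSqZeroExt.snd_inl, TrivSqZeroExt.snd_inr,
    zero_add]
  module

/-- If `1, z, u₀, u₁, u₀ u₁` is a basis, then the algebra is isomorphic to the fibre product. -/
lemma exists_equiv (h : FibreRelations k z u₀ u₁)
    (hb : Function.Bijective fun c : Fin 5 → k =>
      c 0 • 1 + c 1 • z + c 2 • u₀ + c 3 • u₁ + c 4 • (u₀ * u₁)) :
    ∃ φ : R ≃ₐ[k] DualNumberFibreExterior k, (φ z).1 = (DualNumber.eps, 0) ∧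
      (φ u₀).1 = (0, ι k (Pi.single 0 1)) ∧ (φ u₁).1 = (0, ι k (Pi.single 1 1)) := by
  have hbij : Function.Bijective h.fibreMap := by
    have e : h.fibreMap ∘ fibreElement k = fun c : Fin 5 → k =>
      c 0 • 1 + c 1 • z + c 2 • u₀ + c 3 • u₁ + c 4 • (u₀ * u₁) :=
      funext h.fibreMap_fibreElement
    rw [← e] at hb
    -- Injectivity comes from the independence in the target together with the fact that five
    -- coordinates describe every element of the fibre product.
    refine ⟨fun a b hab => ?_, hb.2.of_comp⟩
    obtain ⟨c, rfl⟩ := fibreElement_surjective a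
    obtain ⟨c', rfl⟩ := fibreElement_surjective b
    rw [hb.1 hab]
  let e := AlgEquiv.ofBijective h.fibreMap hbij
  have he : ∀ c w, h.fibreMap (fibreElement k c) = w → e.symm w = fibreElement k c := by
    rintro c _ rfl
    exact e.symm_apply_apply _
  refine ⟨e.symm, ?_, ?_, ?_⟩
  · rw [he ![0, 1, 0, 0, 0] z (by rw [fibreMap_fibreElement]; simp)]
    simp [fibreElement]
  · rw [he ![0, 0, 1, 0, 0] u₀ (by rw [fibreMap_fibreElement]; simp)]
    simp [fibreElement, gen]
  · rw [he ![0, 0, 0, 1, 0] u₁ (by rw [fibreMap_fibreElement]; simp)]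
    simp [fibreElement, gen]

end FibreRelations

namespace Koszul

open Hochschild

universe v u

variable {k : Type v} {A : Type u} [Field k] [Ring A] [Algebra k A] {q : k}
  (Q : QuantumFrame A q)

lemma fiveClasses_bijective (hq0 : q ≠ 0) (hq : ¬ IsOfFinOrder q) :
    Function.Bijective (fiveClasses Q) :=
  ⟨fiveClasses_injective Q hq0, fiveClasses_surjective Q hq0 hq⟩

lemma finrank_HHRing (Q : QuantumFrame A q) (hq0 : q ≠ 0) (hq : ¬ IsOfFinOrder q) :
    Module.finrank k (HHRing k A) = 5 := by
  rw [← (LinearEquiv.ofBijective _ (fiveClasses_bijective Q hq0 hq)).finrank_eq]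
  simp

lemma fibreRelations : FibreRelations k (classZ Q) (classU₀ Q) (classU₁ Q) where
  zz := classZ_mul_self Q
  zu₀ := classZ_mul_classU₀ Q
  zu₁ := classZ_mul_classU₁ Q
  u₀z := classU₀_mul_classZ Q
  u₁z := classU₁_mul_classZ Q
  u₀u₀ := classU₀_mul_self Q
  u₁u₁ := classU₁_mul_self Q
  u₁u₀ := classU₁_mul_classU₀ Q

lemma exists_fibre_equiv (Q : QuantumFrame A q) (hq0 : q ≠ 0) (hq : ¬ IsOfFinOrder q) :
    ∃ (φ : HHRing k A ≃ₐ[k] DualNumberFibreExterior k) (z : HH k A 0) (u : Fin 2 → HH k A 1),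
      (φ (DirectSum.of _ 0 z)).1 = (DualNumber.eps, 0) ∧
      ∀ i, (φ (DirectSum.of _ 1 (u i))).1 = (0, ExteriorAlgebra.ι k (Pi.single i 1)) := by
  have hb := fiveClasses_bijective Q hq0 hq
  rw [show (fiveClasses Q : (Fin 5 → k) → HHRing k A) = _ from
    funext (fiveClasses_apply Q)] at hb
  obtain ⟨φ, hz, h0, h1⟩ := (fibreRelations Q).exists_equiv hb
  refine ⟨φ, hcls Q 0 ⟨_, mono_z_mem Q (Nat.add_zero 0)⟩,
    ![hcls Q 1 ⟨_, mono_x_mem Q⟩, hcls Q 1 ⟨_, mono_y_mem Q⟩], hz, fun i => ?_⟩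
  fin_cases i
  · exact h0
  · exact h1

end Koszul
end


/-! ### Infinite global dimension -/

noncomputable section

open CategoryTheory

section GlobalDimension

universe u

variable {R : Type u} [Ring R]

/-- Right multiplication by `x` as a map from `R` onto the left ideal `Rx`. -/
def mulRightToSpan (x : R) : R →ₗ[R] Submodule.span R {x} :=
  (LinearMap.toSpanSingleton R R x).codRestrict _ fun a =>
    Submodule.mem_span_singleton.mpr ⟨a, rfl⟩

/-- The sequence `0 → Rx → R → Rx → 0`. -/
abbrev spanSequence (x : R) (h : ∀ a : R, a * x = 0 ↔ ∃ b, b * x = a) :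
    ShortComplex (ModuleCat.{u} R) :=
  ShortComplex.mk (ModuleCat.ofHom (Submodule.span R {x}).subtype)
    (ModuleCat.ofHom (mulRightToSpan x)) (by
      ext a
      obtain ⟨b, hb⟩ := Submodule.mem_span_singleton.mp a.2
      change a.1 * x = 0
      exact (h _).mpr ⟨b, hb⟩)

lemma spanSequence_shortExact (x : R) (h : ∀ a : R, a * x = 0 ↔ ∃ b, b * x = a) :
    (spanSequence x h).ShortExact where
  exact := by
    rw [ShortComplex.moduleCat_exact_iff]
    intro a ha
    obtain ⟨b, hb⟩ := (h a).mp (congrArg Subtype.val ha)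
    exact ⟨⟨a, Submodule.mem_span_singleton.mpr ⟨b, hb⟩⟩, rfl⟩
  mono_f := (ModuleCat.mono_iff_injective _).mpr Subtype.val_injective
  epi_g := (ModuleCat.epi_iff_surjective _).mpr fun a => by
    obtain ⟨b, hb⟩ := Submodule.mem_span_singleton.mp a.2
    exact ⟨b, Subtype.ext hb⟩

/-- If the left annihilator of `x` is `Rx` and `Rx` is not a direct summand of `R`, then `R` has
infinite global dimension. -/
lemma globalDimension_eq_top (x : R) (h : ∀ a : R, a * x = 0 ↔ ∃ b, b * x = a)
    (hx : ¬ ∃ b, b * x = x ∧ x * b = 0) : globalDimension R = ⊤ := by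
  have hfree : Projective (spanSequence x h).X₂ :=
    (IsProjective.iff_projective (R := R) R).mp inferInstance
  -- `Rx` is its own first syzygy, so a bound on its projective dimension descends until `Rx` would
  -- be projective.
  have hnot : ∀ n, ¬ HasProjectiveDimensionLT (ModuleCat.of R (Submodule.span R {x})) (n + 1) := by
    intro n
    induction n with
    | zero =>
      intro hp
      have hp' : Module.Projective R (Submodule.span R {x}) :=
        (IsProjective.iff_projective (R := R) _).mpr
          (projective_iff_hasProjectiveDimensionLT_one.mpr hp)
      obtain ⟨s, hs⟩ := Module.projective_lifting_property (mulRightToSpan x) LinearMap.id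
        fun a => by
          obtain ⟨b, hb⟩ := Submodule.mem_span_singleton.mp a.2
          exact ⟨b, Subtype.ext hb⟩
      let x' : Submodule.span R {x} := ⟨x, Submodule.mem_span_singleton_self x⟩
      -- For a section `s` of `R → Rx`, the element `b = s(x)` satisfies `b x = x` and `x b = s(x²)
      -- = 0`.
      refine hx ⟨s x', congrArg Subtype.val (LinearMap.congr_fun hs x'), ?_⟩
      rw [← smul_eq_mul, ← map_smul]
      convert map_zero s
      exact Subtype.ext ((h x).mpr ⟨1, one_mul x⟩)
    | succ n ih =>
      intro hp
      exact ih (((spanSequence_shortExact x h).hasProjectiveDimensionLT_X₃_iff n hfree).mp hp)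
  have htop : projectiveDimension (ModuleCat.of R (Submodule.span R {x})) = ⊤ := by
    by_contra hne
    obtain ⟨n, hn⟩ := (projectiveDimension_ne_top_iff _).mp hne
    exact hnot n inferInstance
  exact top_le_iff.mp (htop ▸ le_iSup (fun M : ModuleCat.{u} R => projectiveDimension M) _)

end GlobalDimension

namespace QuantumFrame

universe v u

variable {k : Type v} {A : Type u} [Field k] [Ring A] [Algebra k A] {q : k}

lemma globalDimension_eq_top (Q : QuantumFrame A q) : globalDimension A = ⊤ := by
  refine _root_.globalDimension_eq_top Q.x (fun a => ⟨fun h => ?_, ?_⟩) ?_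
  -- An element killed by `x` from the right has the form `α x + γ yx = (α + γ y) x`.
  · refine ⟨Q.mk' (Q.cx a) 0 (Q.cz a) 0, Q.ext ?_ ?_ ?_ ?_⟩
    · simpa using (congrArg Q.cx h).symm
    · simp
    · simpa using (congrArg Q.cz h).symm
    · simp
  · rintro ⟨b, rfl⟩
    rw [mul_assoc, Q.xx, mul_zero]
  · rintro ⟨b, h1, h2⟩
    have h1 := congrArg Q.cx h1
    have h2 := congrArg Q.cx h2
    rw [Q.cx_mul] at h1 h2
    simp at h1 h2
    exact one_ne_zero (h1.symm.trans h2)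

lemma globalDimension_op_eq_top (Q : QuantumFrame A q) (hq : q ≠ 0) : globalDimension Aᵐᵒᵖ = ⊤ := by
  refine _root_.globalDimension_eq_top (MulOpposite.op Q.x) (fun a => ⟨fun h => ?_, ?_⟩) ?_
  · obtain ⟨a, rfl⟩ := MulOpposite.op_surjective a
    have h : Q.x * a = 0 := congrArg MulOpposite.unop h
    -- Here `α x + γ yx = x (α - q⁻¹ γ y)`. If `q` were zero, `y` would also be annihilated by `x`
    -- from the left without lying in `xA`.
    refine ⟨MulOpposite.op (Q.mk' (Q.cx a) 0 (-(q⁻¹ * Q.cz a)) 0),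
      congrArg MulOpposite.op (Q.ext ?_ ?_ ?_ ?_)⟩
    · simpa using (congrArg Q.cx h).symm
    · simp
    · have := congrArg Q.cz h
      rw [Q.cz_mul] at this
      simpa [hq, eq_comm] using this
    · simp [hq]
  · rintro ⟨b, rfl⟩
    rw [mul_assoc, ← MulOpposite.op_mul, Q.xx, MulOpposite.op_zero, mul_zero]
  · rintro ⟨b, h1, h2⟩
    have h1 : Q.cx (Q.x * b.unop) = Q.cx Q.x := congrArg (fun a => Q.cx a.unop) h1
    have h2 : Q.cx (b.unop * Q.x) = Q.cx 0 := congrArg (fun a => Q.cx a.unop) h2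
    rw [Q.cx_mul] at h1 h2
    simp at h1 h2
    exact one_ne_zero (h1.symm.trans h2)

end QuantumFrame
end


/-! ### The case `q = 0`: square-zero augmentation ideal and dimensions -/

noncomputable section

section SquareZero

universe v u

variable {k : Type v} {R : Type u} [Field k] [Ring R] [Algebra k R]

lemma mul_eq_zero_of_mem_span {G : Set R} (hG : ∀ a ∈ G, ∀ b ∈ G, a * b = 0) {a b : R}
    (ha : a ∈ Submodule.span k G) (hb : b ∈ Submodule.span k G) : a * b = 0 := by
  induction ha using Submodule.span_induction with
  | mem a ha =>
    induction hb using Submodule.span_induction with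
    | mem b hb => exact hG a ha b hb
    | zero => exact mul_zero a
    | add b b' _ _ h h' => rw [mul_add, h, h', add_zero]
    | smul c b _ h => rw [mul_smul_comm, h, smul_zero]
  | zero => exact zero_mul b
  | add a a' _ _ h h' => rw [add_mul, h, h', add_zero]
  | smul c a _ h => rw [smul_mul_assoc, h, smul_zero]

/-- An algebra of finite type that is spanned by `1` and a set of elements with zero products is
finite dimensional. -/
lemma finite_of_finiteType_of_mul_eq_zero (G : Set R) (hG : ∀ a ∈ G, ∀ b ∈ G, a * b = 0)
    (hspan : ∀ r : R, r ∈ Submodule.span k (insert 1 G)) (hfin : Algebra.FiniteType k R) :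
    Module.Finite k R := by
  have hdec : ∀ r : R, ∃ c : k, ∃ a ∈ Submodule.span k G, c • 1 + a = r := fun r =>
    let ⟨c, a, ha, h⟩ := Submodule.mem_span_insert.mp (hspan r)
    ⟨c, a, ha, h.symm⟩
  choose c a ha hr using hdec
  obtain ⟨S, hS⟩ := hfin.out
  let W : Submodule k R := Submodule.span k (a '' S)
  have hW : W ≤ Submodule.span k G := Submodule.span_le.mpr fun _ ⟨s, _, h⟩ => h ▸ ha s
  have hfW : Module.Finite k W := Module.Finite.span_of_finite k (S.finite_toSet.image a)
  -- Products of elements of `W` vanish, so `k + W` is already closed under multiplication and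
  -- contains the whole subalgebra generated by `S`.
  have key : ∀ r ∈ Algebra.adjoin k (S : Set R), ∃ c : k, ∃ w : W, c • 1 + (w : R) = r := by
    intro r hr'
    induction hr' using Algebra.adjoin_induction with
    | mem s hs => exact ⟨c s, ⟨a s, Submodule.subset_span ⟨s, hs, rfl⟩⟩, hr s⟩
    | algebraMap d => exact ⟨d, 0, by simp [Algebra.algebraMap_eq_smul_one]⟩
    | add r r' _ _ h h' =>
      obtain ⟨d, w, rfl⟩ := h
      obtain ⟨d', w', rfl⟩ := h'
      refine ⟨d + d', w + w', ?_⟩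
      rw [add_smul, Submodule.coe_add]
      abel
    | mul r r' _ _ h h' =>
      obtain ⟨d, w, rfl⟩ := h
      obtain ⟨d', w', rfl⟩ := h'
      refine ⟨d * d', d • w' + d' • w, ?_⟩
      have h0 : (w : R) * w' = 0 := mul_eq_zero_of_mem_span hG (hW w.2) (hW w'.2)
      simp only [add_mul, mul_add, h0, smul_add, smul_smul, smul_mul_assoc, mul_smul_comm, one_mul,
        mul_one, mul_comm d', Submodule.coe_add, Submodule.coe_smul, add_zero]
      abel
  let T : k × W →ₗ[k] R := (LinearMap.toSpanSingleton k R 1).coprod W.subtype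
  refine Module.Finite.of_surjective T fun r => ?_
  obtain ⟨c, w, h⟩ := key r (by rw [hS]; trivial)
  exact ⟨(c, w), h⟩

end SquareZero

lemma not_finite_directSum {k : Type*} [Field k] {M : ℕ → Type*} [∀ n, AddCommGroup (M n)]
    [∀ n, Module k (M n)] (h : ∀ n, Nontrivial (M n)) : ¬ Module.Finite k (⨁ n, M n) := by
  intro hfin
  choose m hm using fun n => exists_ne (0 : M n)
  have hli : LinearIndependent k fun n => DirectSum.lof k ℕ M n (m n) := by
    rw [linearIndependent_iff']
    intro s c hc i hi
    have := congrArg (DirectSum.component k ℕ M i) hc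
    rw [map_sum, map_zero, Finset.sum_eq_single i, map_smul, DirectSum.component.lof_self] at this
    · exact (smul_eq_zero.mp this).resolve_right (hm i)
    · intro j _ hj
      rw [map_smul]
      refine (congrArg (c j • ·) ((DirectSum.component.of k i j _).trans (dif_neg hj))).trans ?_
      exact smul_zero _
    · exact fun h => absurd hi h
  exact not_finite_iff_infinite.mpr inferInstance hli.finite_of_isNoetherian

namespace Koszul

open Hochschild Finset

universe v u

variable {k : Type v} {A : Type u} [Field k] [Ring A] [Algebra k A]

section QZero

variable (Q : QuantumFrame A (0 : k))

/-- For `q = 0` the mixed condition disappears, since each of its terms contains a positive power of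
`q`. Of the two conditions on a constant coordinate away from the origin, one has a coefficient
`±1`. -/
lemma mem_koszulCocycles_zero_iff {n : ℕ} {g : ℕ → ℕ → A} : g ∈ koszulCocycles Q n ↔
    Supported n g ∧ (∀ i j, i + j ≠ 0 → Q.c1 (g i j) = 0) ∧ (∀ i, Q.cy (g i 0) = 0) ∧
      (∀ j, Q.cx (g 0 j) = 0) := by
  rw [mem_koszulCocycles_iff]
  refine and_congr_right fun hs => ?_
  have he : ((-1 : k) ^ (n + 1)) ≠ 0 := pow_ne_zero _ (by simp)
  constructor
  · rintro ⟨h1, h2, h3, h4, -⟩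
    refine ⟨fun i j hij => ?_, fun i => ?_, fun j => ?_⟩
    · rcases i with _ | i
      · rcases j with _ | j
        · exact absurd rfl hij
        · simpa using h1 0 (j + 1)
      · simpa using h2 (i + 1) j
    · simpa using h3 i
    · simpa using h4 j
  · rintro ⟨h1, h3, h4⟩
    refine ⟨fun i j => ?_, fun i j => ?_, fun i => ?_, fun j => ?_, fun i j => ?_⟩
    · by_cases hij : i + j = 0
      · obtain ⟨rfl, rfl⟩ : i = 0 ∧ j = 0 := by omega
        by_cases hn : n = 0
        · simp [hn]
        · simp [hs 0 0 (by omega)]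
      · rw [h1 i j hij, mul_zero]
    · by_cases hij : i + j = 0
      · obtain ⟨rfl, rfl⟩ : i = 0 ∧ j = 0 := by omega
        by_cases hn : n = 0
        · simp [hn]
        · simp [hs 0 0 (by omega)]
      · rw [h1 i j hij, mul_zero]
    · rw [h3, mul_zero]
    · rw [h4, mul_zero]
    · simp

/-- Only `y · x = yx` could contribute, because `xy = 0`. It is weighted by a power of `0` that
survives only if the left factor has no `η` or the right factor has no `ξ`, and in those positions
cocycles have no `y` or no `x` coordinate, respectively. -/
lemma kmul_eq_zero_of_c1_eq_zero {m n : ℕ} {g h : ℕ → ℕ → A} (hg : g ∈ koszulCocycles Q m)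
    (hh : h ∈ koszulCocycles Q n) (hg1 : ∀ i j, Q.c1 (g i j) = 0)
    (hh1 : ∀ i j, Q.c1 (h i j) = 0) : kmul (0 : k) g h = 0 := by
  obtain ⟨-, -, hgy, -⟩ := (mem_koszulCocycles_zero_iff Q).mp hg
  obtain ⟨-, -, -, hhx⟩ := (mem_koszulCocycles_zero_iff Q).mp hh
  ext i j
  refine sum_eq_zero fun p _ => sum_eq_zero fun r _ => ?_
  have h0 : (0 : k) ^ (r.1 * p.2) * (Q.cy (g p.1 r.1) * Q.cx (h p.2 r.2)) = 0 := by
    rcases Nat.eq_zero_or_pos r.1 with h | h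
    · simp [h, hgy]
    · rcases Nat.eq_zero_or_pos p.2 with h' | h'
      · simp [h', hhx]
      · rw [zero_pow (Nat.mul_pos h h').ne', zero_mul]
  refine Q.ext ?_ ?_ ?_ ?_ <;> simp only [map_smul, map_zero, smul_eq_mul]
  · rw [Q.c1_mul]; simp [hg1]
  · rw [Q.cx_mul]; simp [hg1, hh1]
  · rw [Q.cy_mul]; simp [hg1, hh1]
  · rw [Q.cz_mul]; simpa [hg1, hh1] using h0

/-- The classes without constant coefficients. -/
def radicalClasses : Set (HHRing k A) :=
  {r | ∃ (n : ℕ) (g : koszulCocycles Q n), (∀ i j, Q.c1 (g.1 i j) = 0) ∧ rcls Q n g = r}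

lemma radicalClasses_mul (a : HHRing k A) (ha : a ∈ radicalClasses Q) (b : HHRing k A)
    (hb : b ∈ radicalClasses Q) : a * b = 0 := by
  obtain ⟨m, g, hg, rfl⟩ := ha
  obtain ⟨n, h, hh, rfl⟩ := hb
  rw [rcls_mul]
  exact rcls_eq_zero_of_eq_zero Q _ (kmul_eq_zero_of_c1_eq_zero Q g.2 h.2 hg hh)

lemma mem_span_radicalClasses (r : HHRing k A) :
    r ∈ Submodule.span k (insert 1 (radicalClasses Q)) := by
  induction r using DirectSum.induction_on with
  | zero => exact zero_mem _
  | add a b ha hb => exact add_mem ha hb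
  | of n h =>
    obtain ⟨g, rfl⟩ := hcls_surjective Q n h
    rw [← rcls_apply]
    rcases n with _ | n
    · have hg0 := (mem_koszulCocycles_zero_iff Q).mp g.2
      let g' : koszulCocycles Q 0 := g - Q.c1 (g.1 0 0) • ⟨_, one_mem Q⟩
      have e : g = Q.c1 (g.1 0 0) • ⟨_, one_mem Q⟩ + g' := by simp [g']
      rw [e, map_add, map_smul, rcls_one]
      refine add_mem (Submodule.smul_mem _ _ (Submodule.subset_span (Set.mem_insert _ _)))
        (Submodule.subset_span (Set.mem_insert_of_mem _ ⟨0, g', fun i j => ?_, rfl⟩))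
      by_cases hij : i = 0 ∧ j = 0
      · obtain ⟨rfl, rfl⟩ := hij
        simp [g', mono_apply]
      · simp [g', mono_apply, hij, hg0.2.1 i j (by omega)]
    · refine Submodule.subset_span (Set.mem_insert_of_mem _ ⟨n + 1, g, fun i j => ?_, rfl⟩)
      obtain ⟨hs, h1, -⟩ := (mem_koszulCocycles_zero_iff Q).mp g.2
      by_cases hij : i + j = 0
      · rw [hs i j (by omega), map_zero]
      · exact h1 i j hij

lemma nonempty_HH_zero_of_zero (Q : QuantumFrame A (0 : k)) :
    Nonempty (HH k A 0 ≃ₗ[k] k × k) := by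
  refine nonempty_HH_equiv Q 0 ((Q.c1.comp (coeffAt 0 0)).prod (Q.cz.comp (coeffAt 0 0))) ?_ ?_
  · rintro ⟨a, b⟩
    refine ⟨a • mono 0 0 1 + b • mono 0 0 (Q.y * Q.x), add_mem (Submodule.smul_mem _ _ (one_mem Q))
      (Submodule.smul_mem _ _ (mono_z_mem Q rfl)), ?_⟩
    simp [mono_apply]
  · intro g hg
    obtain ⟨hs, -, hy, hx⟩ := (mem_koszulCocycles_zero_iff Q).mp hg
    constructor
    · intro h
      obtain ⟨h1, h2⟩ := Prod.mk.inj h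
      simp only [LinearMap.comp_apply, coeffAt_apply] at h1 h2
      funext i j
      by_cases hij : i + j = 0
      · obtain ⟨rfl, rfl⟩ : i = 0 ∧ j = 0 := by omega
        exact Q.ext (by simpa) (by simpa using hx 0) (by simpa using hy 0) (by simpa)
      · exact hs i j hij
    · rintro rfl
      simp

lemma nonempty_HH_one_of_zero (Q : QuantumFrame A (0 : k)) :
    Nonempty (HH k A 1 ≃ₗ[k] k × k) := by
  refine nonempty_HH_equiv Q 1 ((Q.cx.comp (coeffAt 1 0)).prod (Q.cy.comp (coeffAt 0 1))) ?_ ?_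
  · rintro ⟨a, b⟩
    refine ⟨a • mono 1 0 Q.x + b • mono 0 1 Q.y, add_mem (Submodule.smul_mem _ _ (mono_x_mem Q))
      (Submodule.smul_mem _ _ (mono_y_mem Q)), ?_⟩
    simp [mono_apply]
  · intro g hg
    obtain ⟨hs, h1, hy, hx⟩ := (mem_koszulCocycles_zero_iff Q).mp hg
    refine ⟨fun h => ?_, fun h => ?_⟩
    · obtain ⟨hx', hy'⟩ := Prod.mk.inj h
      simp only [LinearMap.comp_apply, coeffAt_apply] at hx' hy'
      -- The element whose inner derivation removes the two `yx` coordinates: by `xy = 0`, the `x`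
      -- coordinate affects only `η` and the `y` coordinate only `ξ`.
      have hp : Supported 0 (mono 0 0 (Q.mk' 0 (Q.cz (g 0 1)) (-Q.cz (g 1 0)) 0)) :=
        mono_supported (by omega) _
      refine ⟨_, hp, (dA_eq_iff Q hp hs).mpr ⟨fun i j => ?_, hx, hy, ?_, ?_, ?_, ?_, ?_⟩⟩
      · by_cases hij : i + j = 0
        · rw [hs i j (by omega), map_zero]
        · exact h1 i j hij
      · intro i j hij
        obtain ⟨rfl, rfl⟩ : i = 0 ∧ j = 0 := by omega
        simp [mono_apply, hx']
      · intro i j hij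
        obtain ⟨rfl, rfl⟩ : i = 0 ∧ j = 0 := by omega
        simp [mono_apply, hy']
      · simp [mono_apply]
      · simp [mono_apply]
      · omega
    · obtain ⟨h1, h2⟩ := boundary_one Q hg.1 h
      exact Prod.ext h1 h2

/-- The linear functionals on the Koszul complex that identify its cohomology in degree `n + 2`
for `q = 0`. -/
def zeroFunctionals (n : ℕ) :
    (ℕ → ℕ → A) →ₗ[k] (Fin (n + 2) → k) × (Fin (n + 1) → k) :=
  -- The first family measures whether the two equations for a constant coordinate of a primitive
  -- are compatible. The second reads the `yx` coordinates away from the edges, which no boundary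
  -- reaches when `q = 0`.
  (LinearMap.pi fun i : Fin (n + 2) => ((0 : k) ^ (i : ℕ) + (-1) ^ n) •
        Q.cx.comp (coeffAt (i + 1) (n + 1 - i)) -
      (1 + (-1) ^ n * (0 : k) ^ (n + 1 - i)) • Q.cy.comp (coeffAt i (n + 1 - i + 1))).prod
    (LinearMap.pi fun i : Fin (n + 1) => Q.cz.comp (coeffAt (i + 1) (n - i + 1)))

lemma zeroFunctionals_eq_zero_iff {n : ℕ} (g : ℕ → ℕ → A) : zeroFunctionals Q n g = 0 ↔
    (∀ i j, i + j = n + 1 → (0 ^ i + (-1) ^ n) * Q.cx (g (i + 1) j) =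
      (1 + (-1) ^ n * 0 ^ j) * Q.cy (g i (j + 1))) ∧
    (∀ i j, i + j = n → Q.cz (g (i + 1) (j + 1)) = 0) := by
  rw [Prod.ext_iff, funext_iff, funext_iff]
  refine and_congr ⟨fun h i j hij => ?_, fun h i => ?_⟩ ⟨fun h i j hij => ?_, fun h i => ?_⟩
  · have := h ⟨i, by omega⟩
    obtain rfl : j = n + 1 - i := by omega
    simpa [zeroFunctionals, sub_eq_zero] using this
  · have := h i (n + 1 - i) (by omega)
    simpa [zeroFunctionals, sub_eq_zero] using this
  · have := h ⟨i, by omega⟩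
    obtain rfl : j = n - i := by omega
    simpa [zeroFunctionals] using this
  · have := h i (n - i) (by omega)
    simpa [zeroFunctionals] using this

lemma zeroFunctionals_surjective (n : ℕ) (v : (Fin (n + 2) → k) × (Fin (n + 1) → k)) :
    ∃ g ∈ koszulCocycles Q (n + 2), zeroFunctionals Q n g = v := by
  classical
  obtain ⟨l, m⟩ := v
  have hee : ((-1 : k) ^ n) * ((-1 : k) ^ n) = 1 := by
    rw [← pow_add, ← two_mul, pow_mul]; simp
  let l' : ℕ → k := fun i => if h : i < n + 2 then l ⟨i, h⟩ else 0
  let m' : ℕ → k := fun i => if h : i < n + 1 then m ⟨i, h⟩ else 0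
  -- For each index of the first family one coordinate with coefficient `±1` is used: the `y`
  -- coordinate for index `0`, and the `x` coordinate for the others.
  let g : ℕ → ℕ → A := fun i j => if i + j = n + 2 then
    Q.mk' 0 (if 2 ≤ i then (-1) ^ n * l' (i - 1) else 0) (if i = 0 then -l' 0 else 0)
      (if 1 ≤ i ∧ 1 ≤ j then m' (i - 1) else 0) else 0
  have hgs : ∀ i j, i + j = n + 2 → g i j = Q.mk' 0
      (if 2 ≤ i then (-1) ^ n * l' (i - 1) else 0) (if i = 0 then -l' 0 else 0)
      (if 1 ≤ i ∧ 1 ≤ j then m' (i - 1) else 0) := fun i j hij => if_pos hij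
  refine ⟨g, (mem_koszulCocycles_zero_iff Q).mpr ⟨fun i j hij => if_neg hij, fun i j _ => ?_,
    fun i => ?_, fun j => ?_⟩, Prod.ext (funext fun i => ?_) (funext fun i => ?_)⟩
  · simp only [g]; split_ifs <;> simp
  · by_cases hi : i + 0 = n + 2
    · have : i ≠ 0 := by omega
      simp [g, hi, this]
    · simp only [g, hi, if_false, map_zero]
  · by_cases hi : 0 + j = n + 2 <;> simp only [g, hi] <;> simp
  · obtain ⟨i, hi⟩ := i
    change (0 ^ i + (-1) ^ n) * Q.cx (g (i + 1) (n + 1 - i)) -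
      (1 + (-1) ^ n * 0 ^ (n + 1 - i)) * Q.cy (g i (n + 1 - i + 1)) = l ⟨i, hi⟩
    rw [hgs _ _ (by omega), hgs _ _ (by omega), QuantumFrame.cx_mk', QuantumFrame.cy_mk']
    rcases i with _ | i
    · simp [l']
    · simp [l', hi, ← mul_assoc, hee]
  · obtain ⟨i, hi⟩ := i
    change Q.cz (g (i + 1) (n - i + 1)) = m ⟨i, hi⟩
    rw [hgs _ _ (by omega), QuantumFrame.cz_mk', if_pos ⟨by omega, by omega⟩]
    exact dif_pos hi

lemma nonempty_HH_add_two_of_zero (Q : QuantumFrame A (0 : k)) (n : ℕ) :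
    Nonempty (HH k A (n + 2) ≃ₗ[k] (Fin (n + 2) → k) × (Fin (n + 1) → k)) := by
  classical
  refine nonempty_HH_equiv Q (n + 2) (zeroFunctionals Q n) (zeroFunctionals_surjective Q n) ?_
  intro g hg
  obtain ⟨hs, h1, hy, hx⟩ := (mem_koszulCocycles_zero_iff Q).mp hg
  have hee : ((-1 : k) ^ n) * ((-1 : k) ^ n) = 1 := by
    rw [← pow_add, ← two_mul, pow_mul]; simp
  have he : (-1 : k) ^ (n + 1 + 1) = (-1) ^ n := by rw [pow_succ, pow_succ]; simp
  rw [zeroFunctionals_eq_zero_iff]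
  refine ⟨fun ⟨h2, h3⟩ => ?_, ?_⟩
  -- The constant coordinate is found from the `x` equation if `i = 0` and from the `y` equation
  -- otherwise, where the coefficients are `±1`. The other equation holds because the first family
  -- vanishes on `g`.
  · let p : ℕ → ℕ → A := fun i j => if i + j = n + 1 then
      Q.mk' (if i = 0 then Q.cx (g 1 j) else (-1) ^ n * Q.cy (g i (j + 1)))
        (if i = 0 then Q.cz (g 0 (n + 2)) else 0)
        (if j = 0 then (-1) ^ n * Q.cz (g (n + 2) 0) else 0) 0 else 0
    have hp : Supported (n + 1) p := fun i j hij => if_neg hij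
    refine ⟨p, hp, (dA_eq_iff Q hp hs).mpr ⟨fun i j => ?_, hx, hy, ?_, ?_, ?_, ?_, ?_⟩⟩
    · by_cases hij : i + j = 0
      · rw [hs i j (by omega), map_zero]
      · exact h1 i j hij
    · intro i j hij
      have h2 := h2 i j hij
      simp only [p, hij, if_true, he, QuantumFrame.c1_mk']
      rcases i with _ | i
      · obtain rfl : j = n + 1 := by omega
        simp
      · simp only [Nat.succ_ne_zero, ne_eq, not_false_eq_true, zero_pow, zero_add,
          if_false] at h2 ⊢
        linear_combination -(-1) ^ n * h2 + Q.cx (g (i + 1 + 1) j) * hee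
    · intro i j hij
      have h2 := h2 i j hij
      simp only [p, hij, if_true, he, QuantumFrame.c1_mk']
      rcases i with _ | i
      · obtain rfl : j = n + 1 := by omega
        simpa using h2
      · simp [← mul_assoc, hee]
    · simp [p, he, ← mul_assoc, hee]
    · simp [p]
    · intro i j hij
      rw [h3 i j (by omega)]
      simp
  · rintro ⟨p, hp, h⟩
    obtain ⟨-, -, -, h4, h5, -, -, h6⟩ := (dA_eq_iff Q hp hs).mp h
    rw [he] at h4 h5
    refine ⟨fun i j hij => ?_, fun i j hij => ?_⟩
    · rw [← h4 i j hij, ← h5 i j hij]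
      ring
    · rw [← h6 i j (by omega)]
      simp

lemma finite_HH_of_zero (Q : QuantumFrame A (0 : k)) (n : ℕ) : Module.Finite k (HH k A n) := by
  match n with
  | 0 => exact Module.Finite.equiv (nonempty_HH_zero_of_zero Q).some.symm
  | 1 => exact Module.Finite.equiv (nonempty_HH_one_of_zero Q).some.symm
  | n + 2 => exact Module.Finite.equiv (nonempty_HH_add_two_of_zero Q n).some.symm

lemma nontrivial_HH_of_zero (Q : QuantumFrame A (0 : k)) (n : ℕ) : Nontrivial (HH k A n) := by
  match n with
  | 0 => exact (nonempty_HH_zero_of_zero Q).some.toEquiv.nontrivial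
  | 1 => exact (nonempty_HH_one_of_zero Q).some.toEquiv.nontrivial
  | n + 2 => exact (nonempty_HH_add_two_of_zero Q n).some.toEquiv.nontrivial

lemma not_finiteType_of_zero (Q : QuantumFrame A (0 : k)) :
    ¬ Algebra.FiniteType k (HHRing k A) := fun h =>
  not_finite_directSum (nontrivial_HH_of_zero Q) (finite_of_finiteType_of_mul_eq_zero
    (radicalClasses Q) (radicalClasses_mul Q) (mem_span_radicalClasses Q) h)

lemma hilbertSeries_of_zero (Q : QuantumFrame A (0 : k)) : hilbertSeries k A =
    1 + (1 + PowerSeries.X ^ 3) * ((1 - PowerSeries.X) ^ 2)⁻¹ := by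
  rw [← sub_eq_iff_eq_add', PowerSeries.eq_mul_inv_iff_mul_eq (by simp)]
  have hc : ∀ n, PowerSeries.coeff n (hilbertSeries k A) =
      if n < 2 then (2 : ℚ) else 2 * n - 1 := by
    intro n
    rw [hilbertSeries, PowerSeries.coeff_mk]
    match n with
    | 0 => rw [(nonempty_HH_zero_of_zero Q).some.finrank_eq]; simp
    | 1 => rw [(nonempty_HH_one_of_zero Q).some.finrank_eq]; simp
    | n + 2 =>
      rw [(nonempty_HH_add_two_of_zero Q n).some.finrank_eq]
      simp
      ring
  have hc0 : PowerSeries.constantCoeff (hilbertSeries k A) = 2 := by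
    rw [← PowerSeries.coeff_zero_eq_constantCoeff_apply, hc]
    simp
  -- Clearing the denominator leaves shifts of the coefficient sequence. It is linear from degree
  -- `2` on, so its second differences vanish from degree `4` on.
  have e : (hilbertSeries k A - 1) * (1 - PowerSeries.X) ^ 2 = hilbertSeries k A - 1 -
      (hilbertSeries k A - 1) * PowerSeries.X - (hilbertSeries k A - 1) * PowerSeries.X +
      (hilbertSeries k A - 1) * PowerSeries.X * PowerSeries.X := by ring
  rw [e]
  ext n
  match n with
  | 0 =>
    simp [hc0]
    norm_num
  | 1 | 2 | 3 | n + 4 =>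
    simp [hc, hc0, PowerSeries.coeff_X_pow, PowerSeries.coeff_one, PowerSeries.coeff_succ_mul_X]
    try ring

end QZero

end Koszul
end


/-! ### The case of a root of unity: finiteness over a polynomial subalgebra -/

noncomputable section

section PolynomialSubalgebra

universe v u w

variable {k : Type v} {R : Type u} {ι : Type w} [Field k] [Ring R] [Algebra k R]

/-- The products `f m * g` with `g ∈ G`. -/
def translates (f : ι → R) (G : Set R) : Set R := {r | ∃ m, ∃ g ∈ G, f m * g = r}

lemma mul_mem_span_translates [Add ι] {f : ι → R} (hadd : ∀ m m', f (m + m') = f m * f m')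
    (G : Set R) (m : ι) {r : R} (hr : r ∈ Submodule.span k (translates f G)) :
    f m * r ∈ Submodule.span k (translates f G) := by
  induction hr using Submodule.span_induction with
  | mem r hr =>
    obtain ⟨m', g, hg, rfl⟩ := hr
    exact Submodule.subset_span ⟨m + m', g, hg, by rw [hadd, mul_assoc]⟩
  | zero => rw [mul_zero]; exact zero_mem _
  | add a b _ _ ha hb => rw [mul_add]; exact add_mem ha hb
  | smul c a _ ha => rw [mul_smul_comm]; exact Submodule.smul_mem _ c ha

lemma finite_of_mem_span_translates (H : Subalgebra k R) {f : ι → R} (hf : ∀ m, f m ∈ H)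
    {G : Set R} {W : Submodule k R} (hW : W.FG) (hGW : G ⊆ W)
    (hspan : ∀ r, r ∈ Submodule.span k (translates f G)) : Module.Finite H R := by
  obtain ⟨S, hS⟩ := hW
  refine ⟨⟨S, eq_top_iff.mpr fun r _ => ?_⟩⟩
  have h : W ≤ (Submodule.span H (S : Set R)).restrictScalars k := by
    rw [← hS]
    exact Submodule.span_le.mpr Submodule.subset_span
  suffices Submodule.span k (translates f G) ≤
    (Submodule.span H (S : Set R)).restrictScalars k from this (hspan r)
  refine Submodule.span_le.mpr ?_
  rintro _ ⟨m, g, hg, rfl⟩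
  exact Submodule.smul_mem (Submodule.span H (S : Set R)) (⟨f m, hf m⟩ : H) (h (hGW hg))

/-- Since the elements `f m` commute with the generators in `G`, the left-hand spanning set also
spans from the right. -/
lemma finite_op_of_mem_span_translates (H : Subalgebra k R) {f : ι → R} (hf : ∀ m, f m ∈ H)
    {G : Set R} {W : Submodule k R} (hW : W.FG) (hGW : G ⊆ W)
    (hcomm : ∀ m, ∀ g ∈ G, f m * g = g * f m)
    (hspan : ∀ r, r ∈ Submodule.span k (translates f G)) : Module.Finite H.op Rᵐᵒᵖ := by
  let e : R ≃ₗ[k] Rᵐᵒᵖ := MulOpposite.opLinearEquiv k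
  refine finite_of_mem_span_translates (f := fun m => MulOpposite.op (f m)) (G := e '' G) H.op hf
    (hW.map e.toLinearMap) (Set.image_mono hGW) fun r => ?_
  have hr := Submodule.mem_map_of_mem (f := e.toLinearMap) (hspan r.unop)
  rw [Submodule.map_span] at hr
  refine Submodule.span_mono ?_ hr
  rintro _ ⟨_, ⟨m, g, hg, rfl⟩, rfl⟩
  refine ⟨m, e g, ⟨g, hg, rfl⟩, ?_⟩
  rw [hcomm m g hg]
  rfl

lemma linearIndependent_of_dual {M : Type*} [AddCommMonoid M] [Module k M] (f : ι → M)
    (hdual : ∀ m, ∃ l : M →ₗ[k] k, l (f m) = 1 ∧ ∀ m', m' ≠ m → l (f m') = 0) :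
    LinearIndependent k f := by
  rw [linearIndependent_iff'ₛ]
  intro s c d hcd m hm
  obtain ⟨l, h1, h0⟩ := hdual m
  have h : ∀ c : ι → k, l (∑ i ∈ s, c i • f i) = c m := by
    intro c
    rw [map_sum, Finset.sum_eq_single m, map_smul, h1, smul_eq_mul, mul_one]
    · intro m' _ hne
      rw [map_smul, h0 m' hne, smul_zero]
    · exact fun h => absurd hm h
  rw [← h c, ← h d, hcd]

/-- The algebra map from a polynomial ring given by images of the monomials. -/
def monomialHom {σ : Type w} (f : (σ →₀ ℕ) → R) (h0 : f 0 = 1)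
    (hadd : ∀ m m', f (m + m') = f m * f m') : MvPolynomial σ k →ₐ[k] R :=
  AddMonoidAlgebra.lift k R (σ →₀ ℕ)
    { toFun := fun m => f m.toAdd
      map_one' := h0
      map_mul' := fun m m' => hadd m.toAdd m'.toAdd }

lemma monomialHom_monomial {σ : Type w} (f : (σ →₀ ℕ) → R) (h0 : f 0 = 1)
    (hadd : ∀ m m', f (m + m') = f m * f m') (m : σ →₀ ℕ) (c : k) :
    monomialHom f h0 hadd (MvPolynomial.monomial m c) = c • f m :=
  AddMonoidAlgebra.lift_single _ _ _

lemma monomialHom_injective {σ : Type w} (f : (σ →₀ ℕ) → R) (h0 : f 0 = 1)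
    (hadd : ∀ m m', f (m + m') = f m * f m') (hli : LinearIndependent k f) :
    Function.Injective (monomialHom (k := k) f h0 hadd) := by
  have h : Function.Injective ((MvPolynomial.basisMonomials σ k).constr k f) := by
    rw [injective_iff_map_eq_zero]
    intro p hp
    rw [Module.Basis.constr_apply] at hp
    have := (linearIndependent_iff.mp hli) _ hp
    simpa using this
  have e : (monomialHom (k := k) f h0 hadd).toLinearMap =
      (MvPolynomial.basisMonomials σ k).constr k f :=
    (MvPolynomial.basisMonomials σ k).ext fun m => by
      rw [Module.Basis.constr_basis, MvPolynomial.coe_basisMonomials]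
      exact (monomialHom_monomial f h0 hadd m 1).trans (one_smul k _)
  intro a b hab
  exact h (by rw [← e]; exact hab)

/-- An algebra with a linearly independent family of central elements that multiply like the
monomials in `σ`, and which is generated by finitely many elements over the span of this family,
is a finite module over a polynomial subalgebra. -/
theorem exists_polynomial_subalgebra {σ : Type w} [Nonempty σ] (f : (σ →₀ ℕ) → R) (h0 : f 0 = 1)
    (hadd : ∀ m m', f (m + m') = f m * f m') (hli : LinearIndependent k f) {G : Set R}
    {W : Submodule k R} (hW : W.FG) (hGW : G ⊆ W) (hcomm : ∀ m, ∀ g ∈ G, f m * g = g * f m)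
    (hspan : ∀ r, r ∈ Submodule.span k (translates f G)) :
    ¬ Module.Finite k R ∧ ∃ H : Subalgebra k R, Nonempty (MvPolynomial σ k ≃ₐ[k] H) ∧
      Module.Finite H R ∧ Module.Finite H.op Rᵐᵒᵖ := by
  refine ⟨fun hfin => not_finite_iff_infinite.mpr inferInstance hli.finite_of_isNoetherian,
    (monomialHom f h0 hadd).range,
    ⟨AlgEquiv.ofInjective _ (monomialHom_injective f h0 hadd hli)⟩, ?_⟩
  have hf : ∀ m, f m ∈ (monomialHom (k := k) f h0 hadd).range := fun m =>
    ⟨MvPolynomial.monomial m 1, (monomialHom_monomial f h0 hadd m 1).trans (one_smul k _)⟩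
  exact ⟨finite_of_mem_span_translates _ hf hW hGW hspan,
    finite_op_of_mem_span_translates _ hf hW hGW hcomm hspan⟩

end PolynomialSubalgebra

namespace Koszul

open Hochschild Finset

universe v u

variable {k : Type v} {A : Type u} [Field k] [Ring A] [Algebra k A] {q : k}
  (Q : QuantumFrame A q)

lemma finite_koszulCocycles (n : ℕ) : Module.Finite k (koszulCocycles Q n) := by
  have := Q.finite
  let T : koszulCocycles Q n →ₗ[k] (Fin (n + 1) → A) :=
    (LinearMap.pi fun i : Fin (n + 1) => coeffAt i (n - i)).comp (koszulCocycles Q n).subtype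
  refine Module.Finite.of_injective T ?_
  rw [injective_iff_map_eq_zero]
  intro g hg
  refine Subtype.ext (funext₂ fun i j => ?_)
  by_cases hij : i + j = n
  · obtain rfl : j = n - i := by omega
    exact congrFun hg ⟨i, by omega⟩
  · exact g.2.1 i j hij

/-- The span of the classes of degree less than `B`. -/
def classesBelow (B : ℕ) : Submodule k (HHRing k A) :=
  ⨆ n ∈ range B, LinearMap.range (rcls Q n)

lemma classesBelow_fg (B : ℕ) : (classesBelow Q B).FG := by
  refine Submodule.fg_biSup _ _ fun n _ => ?_
  have := finite_koszulCocycles Q n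
  exact Module.Finite.iff_fg.mp inferInstance

lemma rcls_mem_classesBelow {B n : ℕ} (h : n < B) (g : koszulCocycles Q n) :
    rcls Q n g ∈ classesBelow Q B :=
  Submodule.mem_iSup_of_mem n (Submodule.mem_iSup_of_mem (mem_range.mpr h) ⟨g, rfl⟩)

/-- The product with `ξᵃ ηᵇ`. -/
def translate (a b : ℕ) (g : ℕ → ℕ → A) : ℕ → ℕ → A := fun i j =>
  if a ≤ i ∧ b ≤ j then g (i - a) (j - b) else 0

/-- If `qᵇ = 1`, then `ηᵇ` commutes with `ξ` and no scalars appear. Together with the version for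
multiplication from the right this makes the monomials in `ξᴺ` and `ηᴺ` central. -/
lemma kmul_mono_left {a b : ℕ} (hb : q ^ b = 1) (g : ℕ → ℕ → A) :
    kmul q (mono a b 1) g = translate a b g := by
  ext i j
  unfold translate kmul
  split_ifs with h
  · rw [sum_eq_single (a, i - a), sum_eq_single (b, j - b)]
    · simp [mono_apply, pow_mul, hb]
    · rintro ⟨r, r'⟩ hr hne
      rw [HasAntidiagonal.mem_antidiagonal] at hr
      have : r ≠ b := by
        rintro rfl
        exact hne (Prod.ext rfl (by dsimp at hr ⊢; omega))
      simp [mono_apply, this]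
    · simp only [HasAntidiagonal.mem_antidiagonal]; omega
    · rintro ⟨r, r'⟩ hr hne
      rw [HasAntidiagonal.mem_antidiagonal] at hr
      have : r ≠ a := by
        rintro rfl
        exact hne (Prod.ext rfl (by dsimp at hr ⊢; omega))
      simp [mono_apply, this]
    · simp only [HasAntidiagonal.mem_antidiagonal]; omega
  · refine sum_eq_zero fun p hp => sum_eq_zero fun r hr => ?_
    rw [HasAntidiagonal.mem_antidiagonal] at hp hr
    have : ¬ (p.1 = a ∧ r.1 = b) := by omega
    simp [mono_apply, this]

lemma kmul_mono_right {a b : ℕ} (ha : q ^ a = 1) (g : ℕ → ℕ → A) :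
    kmul q g (mono a b 1) = translate a b g := by
  ext i j
  unfold translate kmul
  split_ifs with h
  · rw [sum_eq_single (i - a, a), sum_eq_single (j - b, b)]
    · simp [mono_apply, pow_mul', ha]
    · rintro ⟨r, r'⟩ hr hne
      rw [HasAntidiagonal.mem_antidiagonal] at hr
      have : r' ≠ b := by
        rintro rfl
        exact hne (Prod.ext (by dsimp at hr ⊢; omega) rfl)
      simp [mono_apply, this]
    · simp only [HasAntidiagonal.mem_antidiagonal]; omega
    · rintro ⟨r, r'⟩ hr hne
      rw [HasAntidiagonal.mem_antidiagonal] at hr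
      have : r' ≠ a := by
        rintro rfl
        exact hne (Prod.ext (by dsimp at hr ⊢; omega) rfl)
      simp [mono_apply, this]
    · simp only [HasAntidiagonal.mem_antidiagonal]; omega
  · refine sum_eq_zero fun p hp => sum_eq_zero fun r hr => ?_
    rw [HasAntidiagonal.mem_antidiagonal] at hp hr
    have : ¬ (p.2 = a ∧ r.2 = b) := by omega
    simp [mono_apply, this]

/-- The coefficient of `1` in front of `ξⁱ ηʲ` is well defined on cohomology. -/
lemma exists_constant_functional (i j : ℕ) : ∃ l : HHRing k A →ₗ[k] k,
    ∀ (n : ℕ) (g : koszulCocycles Q n), l (rcls Q n g) = Q.c1 (g.1 i j) := by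
  -- Boundaries have no constant coordinate, so that coordinate descends to classes.
  have hb : ∀ (n : ℕ) (g : ℕ → ℕ → A), Supported n g → IsKoszulBoundary Q n g →
      Q.c1 (g i j) = 0 := by
    rintro (_ | n) g hg h
    · have h : g = 0 := h
      simp [h]
    · obtain ⟨p, hp, h⟩ := h
      exact ((dA_eq_iff Q hp hg).mp h).1 i j
  have hl : ∀ n, ∃ l : HH k A n →ₗ[k] k, ∀ g : koszulCocycles Q n,
      l (hcls Q n g) = Q.c1 (g.1 i j) := by
    intro n
    obtain ⟨s, hs⟩ := (hcls Q n).exists_rightInverse_of_surjective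
      (LinearMap.range_eq_top.mpr (hcls_surjective Q n))
    refine ⟨(Q.c1.comp (coeffAt i j)).comp ((koszulCocycles Q n).subtype.comp s), fun g => ?_⟩
    have h : hcls Q n (s (hcls Q n g) - g) = 0 := by
      rw [map_sub, sub_eq_zero]
      exact LinearMap.congr_fun hs _
    have h' := hb n _ (s (hcls Q n g) - g).2.1 ((hcls_eq_zero_iff Q _).mp h)
    exact sub_eq_zero.mp ((map_sub Q.c1 _ _).symm.trans h')
  choose l hl using hl
  refine ⟨DirectSum.toModule k ℕ k l, fun n g => ?_⟩
  rw [← hl]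
  exact DirectSum.toModule_lof k n _

section RootOfUnity

variable {N : ℕ}

/-- In even degree the differential is a commutator, and both coefficients of a constant reduce to
`1 - 1` because `qᴺ = 1`. This is why `N` has to be even. -/
lemma mono_one_mem (hN : Even N) (hq : q ^ N = 1) (a b : ℕ) :
    mono (N * a) (N * b) (1 : A) ∈ koszulCocycles Q (N * a + N * b) := by
  have he : (-1 : k) ^ (N * a + N * b + 1) = -1 := by
    rw [pow_succ, ((hN.mul_right a).add (hN.mul_right b)).neg_one_pow, one_mul]
  rw [mem_koszulCocycles_iff, he]
  refine ⟨mono_supported rfl _, ?_⟩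
  simp only [mono_apply]
  refine ⟨?_, ?_, ?_, ?_, ?_⟩ <;> intros <;> split_ifs <;> simp_all [pow_mul]

/-- The class of `ξᴺᵃ ηᴺᵇ`. -/
def powerClass (hN : Even N) (hq : q ^ N = 1) (m : Fin 2 →₀ ℕ) : HHRing k A :=
  rcls Q _ ⟨_, mono_one_mem Q hN hq (m 0) (m 1)⟩

lemma powerClass_zero (hN : Even N) (hq : q ^ N = 1) : powerClass Q hN hq 0 = 1 := by
  rw [← rcls_one Q]
  exact rcls_congr Q (by simp) _ _ (by simp)

lemma powerClass_add (hN : Even N) (hq : q ^ N = 1) (m m' : Fin 2 →₀ ℕ) :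
    powerClass Q hN hq (m + m') = powerClass Q hN hq m * powerClass Q hN hq m' := by
  unfold powerClass
  rw [rcls_mul]
  refine rcls_congr Q (by simp; ring) _ _ ?_
  rw [mono_kmul_mono, show N * m 1 * (N * m' 0) = N * (m 1 * (N * m' 0)) by ring, pow_mul, hq]
  simp [mul_add]

lemma powerClass_mul (hN : Even N) (hq : q ^ N = 1) (m : Fin 2 →₀ ℕ) {n : ℕ}
    (g : koszulCocycles Q n) : powerClass Q hN hq m * rcls Q n g =
      rcls Q n g * powerClass Q hN hq m := by
  unfold powerClass
  rw [rcls_mul, rcls_mul]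
  refine rcls_congr Q (by ring) _ _ ?_
  rw [kmul_mono_left (by rw [pow_mul, hq, one_pow]), kmul_mono_right (by rw [pow_mul, hq, one_pow])]

lemma powerClass_linearIndependent (hN : Even N) (hN0 : 0 < N) (hq : q ^ N = 1) :
    LinearIndependent k (powerClass Q hN hq) := by
  refine linearIndependent_of_dual _ fun m => ?_
  obtain ⟨l, hl⟩ := exists_constant_functional Q (N * m 0) (N * m 1)
  refine ⟨l, ?_, fun m' hne => ?_⟩
  · rw [powerClass, hl]
    simp [mono_apply]
  · rw [powerClass, hl]
    refine (congrArg Q.c1 ((mono_apply _ _ _ _ _).trans (if_neg ?_))).trans (map_zero Q.c1)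
    rintro ⟨h0, h1⟩
    refine hne (Finsupp.ext fun i => ?_)
    fin_cases i
    · exact (Nat.eq_of_mul_eq_mul_left hN0 h0).symm
    · exact (Nat.eq_of_mul_eq_mul_left hN0 h1).symm

/-- In high degrees, every cocycle is a combination of multiples of `ξᴺ` and `ηᴺ`. -/
lemma exists_eq_translate_add (hN : Even N) (hq : q ^ N = 1) {n : ℕ} (hn : N < n)
    {g : ℕ → ℕ → A} (hg : g ∈ koszulCocycles Q (N + n)) :
    ∃ g₁ ∈ koszulCocycles Q n, ∃ g₂ ∈ koszulCocycles Q n,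
      g = translate N 0 g₁ + translate 0 N g₂ := by
  classical
  obtain ⟨hs, h1, h2, h3, h4, h5⟩ := (mem_koszulCocycles_iff Q).mp hg
  have he : (-1 : k) ^ (N + n + 1) = (-1) ^ (n + 1) := by
    rw [add_assoc, pow_add, hN.neg_one_pow, one_mul]
  rw [he] at h1 h2 h3 h4 h5
  -- The components are cut by the exponent of `ξ`: at `N` for constants and `y` coordinates, at `N
  -- + 1` for `x` and `yx` coordinates. The mixed cocycle condition couples the `y` coordinate at
  -- `i` with the `x` coordinate at `i + 1`, so each such pair stays on one side. The shifted cut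
  -- also gives `g₁` no `x` coordinate at `i = 0`, as the edge condition there demands.
  let g₁ : ℕ → ℕ → A := fun i j => Q.mk' (Q.c1 (g (i + N) j))
    (if i = 0 then 0 else Q.cx (g (i + N) j)) (Q.cy (g (i + N) j))
    (if i = 0 then 0 else Q.cz (g (i + N) j))
  let g₂ : ℕ → ℕ → A := fun i j => Q.mk' (if i < N then Q.c1 (g i (j + N)) else 0)
    (if i < N + 1 then Q.cx (g i (j + N)) else 0) (if i < N then Q.cy (g i (j + N)) else 0)
    (if i < N + 1 then Q.cz (g i (j + N)) else 0)
  have hs₁ : Supported n g₁ := fun i j hij => by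
    simp [g₁, hs (i + N) j (by omega), QuantumFrame.mk']
  have hs₂ : Supported n g₂ := fun i j hij => by
    simp [g₂, hs i (j + N) (by omega), QuantumFrame.mk']
  refine ⟨g₁, (mem_koszulCocycles_iff Q).mpr ⟨hs₁, fun i j => ?_, fun i j => ?_,
    fun i => ?_, fun j => ?_, fun i j => ?_⟩, g₂, (mem_koszulCocycles_iff Q).mpr
    ⟨hs₂, fun i j => ?_, fun i j => ?_, fun i => ?_, fun j => ?_, fun i j => ?_⟩, ?_⟩
  · simpa [g₁] using h1 (i + N) j
  · have := h2 (i + N) j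
    rw [pow_add q, hq, mul_one] at this
    simpa [g₁] using this
  · simpa [g₁] using h3 (i + N)
  · simp [g₁]
  · have := h5 (i + N) j
    rw [add_right_comm, pow_add q (i + 1), hq, mul_one] at this
    simpa [g₁] using this
  · have := h1 i (j + N)
    rw [pow_add q, hq, mul_one] at this
    simp only [g₂, QuantumFrame.c1_mk']
    split_ifs
    · exact this
    · exact mul_zero _
  · simp only [g₂, QuantumFrame.c1_mk']
    split_ifs
    · exact h2 i (j + N)
    · exact mul_zero _
  · simp only [g₂, QuantumFrame.cy_mk']
    split_ifs
    -- Here `i < N < n`, so `ξⁱ ηᴺ` does not have the degree of `g`.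
    · rw [hs i (0 + N) (by omega), map_zero, mul_zero]
    · exact mul_zero _
  · simpa [g₂] using h4 (j + N)
  · have := h5 i (j + N)
    rw [add_right_comm, pow_add q, hq, mul_one] at this
    simp only [g₂, QuantumFrame.cx_mk', QuantumFrame.cy_mk', Nat.add_lt_add_iff_right]
    split_ifs
    · exact this
    · simp
  · funext i j
    simp only [Pi.add_apply, translate, Nat.zero_le, and_true, true_and, Nat.sub_zero]
    by_cases hij : i + j = N + n
    · rcases lt_or_ge i N with hi | hi
      · rw [if_neg (by omega), if_pos (by omega), zero_add]
        have hj : j - N + N = j := by omega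
        have hi' : i < N + 1 := by omega
        refine Q.ext ?_ ?_ ?_ ?_ <;>
          simp only [g₂, hi, hi', hj, if_true, QuantumFrame.c1_mk', QuantumFrame.cx_mk',
            QuantumFrame.cy_mk', QuantumFrame.cz_mk']
      · obtain ⟨i, rfl⟩ := Nat.exists_eq_add_of_le' hi
        rw [if_pos hi, Nat.add_sub_cancel]
        have hi' : ¬ i + N < N := by omega
        rcases i with _ | i
        -- On the row `i = N`, which is shared by both summands, `j = n > N`, so division by `ηᴺ`
        -- loses nothing.
        · have hj : j - N + N = j := by omega
          rw [if_pos (by omega)]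
          refine Q.ext ?_ ?_ ?_ ?_ <;> simp [g₁, g₂, hj]
        · have h0 : g₂ (i + 1 + N) (j - N) = 0 := by
            simp [g₂, hi', QuantumFrame.mk']
          rw [h0, ite_self, add_zero]
          refine Q.ext ?_ ?_ ?_ ?_ <;> simp [g₁]
    · rw [hs i j hij]
      split_ifs with h h' h'
      · rw [hs₁ _ _ (by omega), hs₂ _ _ (by omega), add_zero]
      · rw [hs₁ _ _ (by omega), add_zero]
      · rw [hs₂ _ _ (by omega), add_zero]
      · rw [add_zero]

lemma mem_span_translates_powerClass (hN : Even N) (hN0 : 0 < N) (hq : q ^ N = 1) (n : ℕ)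
    (g : koszulCocycles Q n) : rcls Q n g ∈ Submodule.span k
      (translates (powerClass Q hN hq) {r | ∃ n < 2 * N + 1, ∃ g, rcls Q n g = r}) := by
  induction n using Nat.strong_induction_on with
  | _ n ih =>
    rcases Nat.lt_or_ge n (2 * N + 1) with hn | hn
    · refine Submodule.subset_span ⟨0, _, ⟨n, hn, g, rfl⟩, ?_⟩
      rw [powerClass, rcls_mul]
      refine rcls_congr Q (by simp) _ g.2 ?_
      rw [kmul_mono_left (by simp)]
      funext i j
      simp [translate]
    -- Degree at least `2N + 1` leaves more than `N` after removing one factor `ξᴺ` or `ηᴺ`, as the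
    -- splitting requires.
    · obtain ⟨n, rfl⟩ := Nat.exists_eq_add_of_le (show N ≤ n by omega)
      obtain ⟨g, hg⟩ := g
      obtain ⟨g₁, hg₁, g₂, hg₂, e⟩ := exists_eq_translate_add Q hN hq (by omega) hg
      have h₁ : translate N 0 g₁ ∈ koszulCocycles Q (N + n) := by
        have := kmul_mem Q (mono_one_mem Q hN hq 1 0) hg₁
        rw [kmul_mono_left (by simp)] at this
        simpa using this
      have h₂ : translate 0 N g₂ ∈ koszulCocycles Q (N + n) := by
        have := kmul_mem Q (mono_one_mem Q hN hq 0 1) hg₂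
        rw [kmul_mono_left (by simp [hq])] at this
        simpa using this
      have e₁ : powerClass Q hN hq (Finsupp.single 0 1) * rcls Q n ⟨g₁, hg₁⟩ =
          rcls Q (N + n) ⟨_, h₁⟩ := by
        rw [powerClass, rcls_mul]
        refine rcls_congr Q (by simp) _ _ ?_
        rw [kmul_mono_left (by simp)]
        simp
      have e₂ : powerClass Q hN hq (Finsupp.single 1 1) * rcls Q n ⟨g₂, hg₂⟩ =
          rcls Q (N + n) ⟨_, h₂⟩ := by
        rw [powerClass, rcls_mul]
        refine rcls_congr Q (by simp) _ _ ?_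
        rw [kmul_mono_left (by simp [hq])]
        simp
      have e' : (⟨g, hg⟩ : koszulCocycles Q (N + n)) = ⟨_, h₁⟩ + ⟨_, h₂⟩ := Subtype.ext e
      rw [e', map_add, ← e₁, ← e₂]
      exact add_mem
        (mul_mem_span_translates (powerClass_add Q hN hq) _ _ (ih n (by omega) ⟨g₁, hg₁⟩))
        (mul_mem_span_translates (powerClass_add Q hN hq) _ _ (ih n (by omega) ⟨g₂, hg₂⟩))

theorem exists_polynomial_subalgebra_of_root (Q : QuantumFrame A q) (hq : IsOfFinOrder q) :
    ¬ Module.Finite k (HHRing k A) ∧ ∃ H : Subalgebra k (HHRing k A),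
      Nonempty (MvPolynomial (Fin 2) k ≃ₐ[k] H) ∧ Module.Finite H (HHRing k A) ∧
        Module.Finite H.op (HHRing k A)ᵐᵒᵖ := by
  obtain ⟨r, hr, hqr⟩ := isOfFinOrder_iff_pow_eq_one.mp hq
  -- Doubling the exponent makes it even without losing `qᴺ = 1`.
  have hN : Even (2 * r) := even_two_mul r
  have hN0 : 0 < 2 * r := by omega
  have hqN : q ^ (2 * r) = 1 := by rw [mul_comm, pow_mul, hqr, one_pow]
  refine exists_polynomial_subalgebra (powerClass Q hN hqN) (powerClass_zero Q hN hqN)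
    (powerClass_add Q hN hqN) (powerClass_linearIndependent Q hN hN0 hqN)
    (G := {r' | ∃ n < 2 * (2 * r) + 1, ∃ g, rcls Q n g = r'})
    (classesBelow_fg Q (2 * (2 * r) + 1)) ?_ ?_ fun a => ?_
  · rintro _ ⟨n, hn, g, rfl⟩
    exact rcls_mem_classesBelow Q hn g
  · rintro m _ ⟨n, hn, g, rfl⟩
    exact powerClass_mul Q hN hqN m g
  · induction a using DirectSum.induction_on with
    | zero => exact zero_mem _
    | add a b ha hb => exact add_mem ha hb
    | of n h =>
      obtain ⟨g, rfl⟩ := hcls_surjective Q n h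
      exact mem_span_translates_powerClass Q hN hN0 hqN n g

end RootOfUnity

end Koszul
end

open Hochschild in
theorem mainTheorem1 (k : Type*) [Field k] (q : k) :
    -- (a)
    (q ≠ 0 → ¬ IsOfFinOrder q →
      Module.finrank k (HHRing k (QuantumExterior k q)) = 5 ∧
      (∀ n, Module.Finite k (HH k (QuantumExterior k q) n)) ∧
      hilbertSeries k (QuantumExterior k q) = 2 + 2 * PowerSeries.X + PowerSeries.X ^ 2 ∧
      (∃ (φ : HHRing k (QuantumExterior k q) ≃ₐ[k] DualNumberFibreExterior k)
          (z : HH k (QuantumExterior k q) 0) (u : Fin 2 → HH k (QuantumExterior k q) 1),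
        (φ (DirectSum.of _ 0 z)).1 = (DualNumber.eps, 0) ∧
        ∀ i, (φ (DirectSum.of _ 1 (u i))).1 = (0, ExteriorAlgebra.ι k (Pi.single i 1))) ∧
      Module.Finite k (QuantumExterior k q) ∧
      (∀ n, 3 ≤ n → Subsingleton (HH k (QuantumExterior k q) n)) ∧
      globalDimension (QuantumExterior k q) = ⊤ ∧
      globalDimension (QuantumExterior k q)ᵐᵒᵖ = ⊤) ∧
    -- (b)
    (IsOfFinOrder q →
      ¬ Module.Finite k (HHRing k (QuantumExterior k q)) ∧
      ∃ H : Subalgebra k (HHRing k (QuantumExterior k q)),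
        Nonempty (MvPolynomial (Fin 2) k ≃ₐ[k] H) ∧
        Module.Finite H (HHRing k (QuantumExterior k q)) ∧
        Module.Finite H.op (HHRing k (QuantumExterior k q))ᵐᵒᵖ) ∧
    -- (c)
    (q = 0 →
      ¬ Algebra.FiniteType k (HHRing k (QuantumExterior k q)) ∧
      (∀ n, Module.Finite k (HH k (QuantumExterior k q) n)) ∧
      hilbertSeries k (QuantumExterior k q) =
        1 + (1 + PowerSeries.X ^ 3) * ((1 - PowerSeries.X) ^ 2)⁻¹) := by
  refine ⟨fun hq0 hq => ?_, fun hq => ?_, ?_⟩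
  · have Q := QuantumExterior.frame k q
    exact ⟨Koszul.finrank_HHRing Q hq0 hq, Koszul.finite_HH_of_notRoot Q hq0 hq,
      Koszul.hilbertSeries_of_notRoot Q hq0 hq, Koszul.exists_fibre_equiv Q hq0 hq, Q.finite,
      fun n hn => Koszul.subsingleton_HH Q hq0 hq hn, Q.globalDimension_eq_top,
      Q.globalDimension_op_eq_top hq0⟩
  · exact Koszul.exists_polynomial_subalgebra_of_root (QuantumExterior.frame k q) hq
  · rintro rfl
    have Q := QuantumExterior.frame k (0 : k)
    exact ⟨Koszul.not_finiteType_of_zero Q, Koszul.finite_HH_of_zero Q,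
      Koszul.hilbertSeries_of_zero Q⟩
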